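/- **Setting.** All logarithms are base $2$. Let $f:\{0,1\}^n\to\{0,1\}$. For $S\subseteq[n+1]$ let $x^{(S)}$ be $x$ with the coordinates in $S\setminus\{n+1\}$ flipped ($n+1$ is a dummy variable) and $x^{(i)}=x^{(\{i\})}$. An edge $(x,x^{(i)})$, $i\in[n]$, is bichromatic if $f(x)\ne f(x^{(i)})$; it is then monotone if $x_i=f(x)$ and anti-monotone if $x_i\neq f(x)$. An *edge violation to unateness* is a pair consisting of a monotone and an anti-monotone edge along the same variable. $\mathrm{Inf}_f[i]=\Pr_x[f(x)\ne f(x^{(i)})]$. For $0<\varepsilon\le 1$ let $\Lambda=\lceil 2\log(n/\varepsilon)\rceil$. *Persistency.* A point $x$ is $S$-persistent if for both $k=\lfloor |S|/2\rfloor$ and $k=\lfloor |S|/2\rfloor+1$ a uniformly random $k$-subset $T$ of $S$ satisfies $f(x)=f(x^{(T)})$ with probability at least $1-1/\log^2 n$ (every point is $\emptyset$-persistent). An edge is $S$-persistent if both of its endpoints are. *Preprocessing.* $\mathrm{BinarySearch}(f,x,S,\pi)$ returns nil if $f(x)=f(x^{(S)})$; otherwise it runs binary search on the path $x=x_0,\dots,x_{|S|}=x^{(S)}$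 that flips the variables of $S$ in the order $\pi$: starting with $(l,r)=(0,|S|)$, while $r-l>1$ it sets $q=\lceil (l+r)/2\rceil$ and replaces $r$ by $q$ if $f(x_l)\ne f(x_q)$ and $l$ by $q$ otherwise; it returns $\pi(r)$. $\mathrm{Preprocess}(f,S,\pi,\xi)$ repeats the following while $S\ne\emptyset$: in up to $\log^4 n/\xi$ (rounded up) rounds it draws a uniform $x\in\{0,1\}^n$, chooses one of the sizes $\lfloor|S|/2\rfloor,\lfloor|S|/2\rfloor+1$ by a fair coin, draws a uniform $T\subseteq S$ of that size and runs $\mathrm{BinarySearch}(f,x,T,\pi|_T)$; the first variable returned is removed from $S$ and from $\pi$; if all rounds return nil, it stops. It returns the final $S$. For $1\le m\le n+1$ and $\xi\in(0,1)$, $\mathcal H_{\xi,m}$ is the distribution of $\mathrm{Preprocess}(f,S_0,\pi,\xi)$ for a uniformly random $S_0\subseteq[n+1]$ with $|S_0|=m$ and $n+1\in S_0$ and a uniformly random ordering $\pi$ of $S_0$. $\mathcal P_{i,m}$ is the uniform distribution on the $m$-subsets of $[n]\setminus\{i\}$. *Scores.* A bichromatic edge $e$ along $i$ is $l$-strong if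 (1) for every power of two $m\le n^{2/3}$ and every $\xi=2^{-k}$ with $l\le k\le\Lambda$, $e$ is $S$-persistent with probability at least $1-1/\log n$ over $S\sim\mathcal H_{\xi,m}$; and (2) the same holds for $S\sim\mathcal P_{i,\lceil\sqrt n/2^l\rceil}$. $\mathrm{Score}^+_{i,l}$ (resp. $\mathrm{Score}^-_{i,l}$) is $2^{-n}$ times the number of $l$-strong monotone (resp. anti-monotone) edges along $i$. *Algorithms.* A query algorithm is a randomized adaptive algorithm with query access to $f$; it makes at most $q$ queries if it does so for all answers and all random choices. It either outputs "unate" or outputs a pair of edges. **Lemma.** There is an absolute constant $k$ such that for every $c>0$ there is $C>0$ with the following property. Let $n\in\mathbb N$, $0<\varepsilon\le1$, $s,t\in[\Lambda]$ with $s\ge t$, $h\in[3\Lambda]$ and $\ell\in[\lfloor\log n\rfloor]$ with $2^\ell/2^t\ge n^{2/3}$. Then there is a query algorithm, depending only on these parameters, that makes at most $C\cdot\frac{n^{2/3}}{\varepsilon^2}\cdot\log^k(n/\varepsilon)$ queries (that is, $\tilde O(n^{2/3}/\varepsilon^2)$) and such that, for every $f:\{0,1\}^n\to\{0,1\}$ for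 which there is a set $\mathcal I\subseteq[n]$ with $|\mathcal I|=2^\ell$ satisfying (i) $|\mathcal I|/2^h\ge c\,\varepsilon^2/\Lambda^{11}$ and $\min\{\mathrm{Score}^+_{i,s}\cdot 2^{-s},\ \mathrm{Score}^-_{i,t}\cdot 2^{-t}\}\ge 2^{-h}$ for every $i\in\mathcal I$, and (ii) at least half of the $i\in\mathcal I$ satisfy $\mathrm{Inf}_f[i]>\frac{\varepsilon^2}{\Lambda^{13}}\cdot\frac{n^{1/3}}{|\mathcal I|}$, the algorithm outputs an edge violation of $f$ to unateness with probability at least $2/3$. -/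

import Mathlib

namespace Unateness

/-- Points of the hypercube `{0,1}^n`. -/
abbrev Point (n : ℕ) : Type := Fin n → Bool

/-- Variables `[n+1]`: `i : Fin n` is the variable `i.castSucc`, and `Fin.last n` is the
placeholder (dummy) variable. -/
abbrev Var (n : ℕ) : Type := Fin (n + 1)

/-- `x^(S)`: flip the coordinates in `S` (nothing happens for the placeholder). -/
def flipSet {n : ℕ} (x : Point n) (S : Finset (Var n)) : Point n :=
  fun k => if k.castSucc ∈ S then !(x k) else x k

/-- `x^(i)` for a genuine variable `i`. -/
def flipVar {n : ℕ} (x : Point n) (i : Fin n) : Point n := flipSet x {i.castSucc}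

/-- The edge `(x, x^(i))` is a monotone bichromatic edge of `f`. -/
def MonoEdge {n : ℕ} (f : Point n → Bool) (i : Fin n) (x : Point n) : Prop :=
  f x ≠ f (flipVar x i) ∧ x i = f x

/-- The edge `(x, x^(i))` is an anti-monotone bichromatic edge of `f`. -/
def AntiEdge {n : ℕ} (f : Point n → Bool) (i : Fin n) (x : Point n) : Prop :=
  f x ≠ f (flipVar x i) ∧ x i ≠ f x

/-- The probability of an event under a discrete distribution, as a real number. -/
noncomputable def prob {α : Type} (p : PMF α) (E : Set α) : ℝ := (p.toOuterMeasure E).toReal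

/-- The influence of variable `i`. -/
noncomputable def influence {n : ℕ} (f : Point n → Bool) (i : Fin n) : ℝ :=
  prob (PMF.uniformOfFintype (Point n)) {x | f x ≠ f (flipVar x i)}

/-- A uniformly random `k`-element subset of `S` (the empty set if there is none). -/
noncomputable def uniformSubset {α : Type} (S : Finset α) (k : ℕ) : PMF (Finset α) :=
  if h : k ≤ S.card then
    PMF.uniformOfFinset (S.powersetCard k) (Finset.powersetCard_nonempty.2 h)
  else PMF.pure ∅

/-- A uniformly random ordering `π : [|S|] → S` of `S`, written as the list
`π(1), …, π(|S|)`. -/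
noncomputable def uniformOrdering {α : Type} (S : Finset α) : PMF (List α) :=
  haveI : DecidableEq S := Classical.decEq _
  haveI : Nonempty (Fin S.card ≃ S) := ⟨S.equivFin.symm⟩
  (PMF.uniformOfFintype (Fin S.card ≃ S)).map fun π => List.ofFn fun j => (π j : α)

/-- `x` is `S`-persistent. -/
def Persistent {n : ℕ} (f : Point n → Bool) (S : Finset (Var n)) (x : Point n) : Prop :=
  1 - 1 / Real.logb 2 n ^ 2 ≤
      prob (uniformSubset S (S.card / 2)) {T | f x = f (flipSet x T)} ∧
    1 - 1 / Real.logb 2 n ^ 2 ≤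
      prob (uniformSubset S (S.card / 2 + 1)) {T | f x = f (flipSet x T)}

/-- The edge `(x, x^(i))` is `S`-persistent. -/
def EdgePersistent {n : ℕ} (f : Point n → Bool) (i : Fin n) (x : Point n)
    (S : Finset (Var n)) : Prop :=
  Persistent f S x ∧ Persistent f S (flipVar x i)

/-! Ordered sets of variables `(S, π)` are represented by the list `L = π(1), …, π(|S|)`. -/

/-- The point `x_j` on the path from `x` to `x^(S)`: flip the first `j` variables of `L`. -/
def pathPoint {n : ℕ} (x : Point n) (L : List (Var n)) (j : ℕ) : Point n :=
  flipSet x (L.take j).toFinset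

/-- The main loop of binary search, with current left end `l` and right end `r`; at the end it
returns `π(r)`. -/
def binarySearchLoop {n : ℕ} (f : Point n → Bool) (x : Point n) (L : List (Var n))
    (l r : ℕ) : Option (Var n) :=
  if _h : 1 < r - l then
    if f (pathPoint x L l) ≠ f (pathPoint x L ((l + r + 1) / 2)) then
      binarySearchLoop f x L l ((l + r + 1) / 2)
    else
      binarySearchLoop f x L ((l + r + 1) / 2) r
  else L[r - 1]?
termination_by r - l
decreasing_by all_goals omega

/-- The variable returned by binary search along the path from `x` to `x^(S)`; `none` is `nil`. -/
def binarySearch {n : ℕ} (f : Point n → Bool) (x : Point n) (L : List (Var n)) :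
    Option (Var n) :=
  if f x = f (flipSet x L.toFinset) then none else binarySearchLoop f x L 0 L.length

/-- `N` rounds of the persistence check on the ordered set `L`. -/
noncomputable def checkRounds {n : ℕ} (f : Point n → Bool) (L : List (Var n)) :
    ℕ → PMF (Option (Var n))
  | 0 => PMF.pure none
  | N + 1 =>
    (PMF.uniformOfFintype (Point n)).bind fun x =>
    (PMF.uniformOfFintype Bool).bind fun b =>
    (uniformSubset L.toFinset
      (if b then L.toFinset.card / 2 else L.toFinset.card / 2 + 1)).bind fun T =>
    match binarySearch f x (L.filter fun v => v ∈ T) with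
    | some v => PMF.pure (some v)
    | none => checkRounds f L N

/-- `CheckPersistence(f, S, π, ξ)`: it runs `log⁴ n / ξ` rounds. -/
noncomputable def checkPersistence {n : ℕ} (f : Point n → Bool) (ξ : ℝ) (L : List (Var n)) :
    PMF (Option (Var n)) :=
  checkRounds f L ⌈Real.logb 2 n ^ 4 / ξ⌉₊

/-- At most `k` iterations of the loop of `Preprocess`. -/
noncomputable def preprocessLoop {n : ℕ} (f : Point n → Bool) (ξ : ℝ) :
    ℕ → List (Var n) → PMF (Finset (Var n))
  | 0, L => PMF.pure L.toFinset
  | k + 1, L => (checkPersistence f ξ L).bind fun o =>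
    match o with
    | none => PMF.pure L.toFinset
    | some v => preprocessLoop f ξ k (L.erase v)

/-- `Preprocess(f, S₀, π, ξ)`: run `CheckPersistence`, removing the returned variable, until it
returns `nil` or the set is empty. Each iteration removes one variable, so the set is empty after
`|S₀|` iterations. -/
noncomputable def preprocess {n : ℕ} (f : Point n → Bool) (ξ : ℝ) (L : List (Var n)) :
    PMF (Finset (Var n)) :=
  preprocessLoop f ξ L.length L

/-- The distribution `H_{ξ,m}`: preprocess a random `m`-subset of `[n+1]` that contains the
placeholder, with a random ordering. -/
noncomputable def distH {n : ℕ} (f : Point n → Bool) (ξ : ℝ) (m : ℕ) : PMF (Finset (Var n)) :=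
  (uniformSubset (Finset.univ.erase (Fin.last n)) (m - 1)).bind fun T =>
  (uniformOrdering (insert (Fin.last n) T)).bind fun L =>
  preprocess f ξ L

/-- The distribution `P_{i,m}`: a random `m`-subset of `[n] \ {i}`. -/
noncomputable def distP {n : ℕ} (i : Fin n) (m : ℕ) : PMF (Finset (Var n)) :=
  uniformSubset ((Finset.univ.erase (Fin.last n)).erase i.castSucc) m

/-- `Λ = ⌈2 log (n/ε)⌉`. -/
noncomputable def Lam (n : ℕ) (ε : ℝ) : ℕ := ⌈2 * Real.logb 2 (n / ε)⌉₊

/-- The two persistence conditions for the edge `(x, x^(i))` to be `l`-strong. -/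
def Strong {n : ℕ} (ε : ℝ) (f : Point n → Bool) (l : ℕ) (i : Fin n) (x : Point n) : Prop :=
  (∀ j k : ℕ, (2 : ℝ) ^ j ≤ (n : ℝ) ^ (2 / 3 : ℝ) → l ≤ k → k ≤ Lam n ε →
    1 - 1 / Real.logb 2 n ≤ prob (distH f (1 / 2 ^ k) (2 ^ j)) {S | EdgePersistent f i x S}) ∧
  1 - 1 / Real.logb 2 n ≤ prob (distP i ⌈√(n : ℝ) / 2 ^ l⌉₊) {S | EdgePersistent f i x S}

/-- `Score⁺_{i,l}(f)`: the number of `l`-strong monotone edges along `i`, divided by `2^n`. Each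
edge is counted through its endpoint `x` with `x_i = 0`. -/
noncomputable def scorePos {n : ℕ} (ε : ℝ) (f : Point n → Bool) (l : ℕ) (i : Fin n) : ℝ :=
  (Set.ncard {x : Point n | x i = false ∧ MonoEdge f i x ∧ Strong ε f l i x} : ℝ) / 2 ^ n

/-- `Score⁻_{i,l}(f)`: the same for anti-monotone edges. -/
noncomputable def scoreNeg {n : ℕ} (ε : ℝ) (f : Point n → Bool) (l : ℕ) (i : Fin n) : ℝ :=
  (Set.ncard {x : Point n | x i = false ∧ AntiEdge f i x ∧ Strong ε f l i x} : ℝ) / 2 ^ n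

/-- The score summary for `f` with `s, t, h` and `I`, with `c` the constant hidden in
`|I| / 2^h = Ω(ε² / Λ^11)`. -/
def ScoreSummary {n : ℕ} (c ε : ℝ) (s t h : ℕ) (f : Point n → Bool)
    (I : Finset (Fin n)) : Prop :=
  c * (ε ^ 2 / (Lam n ε : ℝ) ^ 11) ≤ (I.card : ℝ) / 2 ^ h ∧
  ∀ i ∈ I, 1 / 2 ^ h ≤ min (scorePos ε f s i * (1 / 2 ^ s)) (scoreNeg ε f t i * (1 / 2 ^ t))

/-- The influence threshold `(ε² / Λ^13) · n^{1/3} / m`, for `m = |I|`. -/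
noncomputable def infThreshold (n : ℕ) (ε : ℝ) (m : ℕ) : ℝ :=
  ε ^ 2 / (Lam n ε : ℝ) ^ 13 * ((n : ℝ) ^ (1 / 3 : ℝ) / m)

/-- Randomized adaptive query algorithms on functions `{0,1}^n → {0,1}` with outputs in `α`:
output a value, query a point and continue according to the answer, or draw an element of
`{0, …, N}` uniformly at random and continue according to it. -/
inductive QueryAlg (n : ℕ) (α : Type) : Type
  | output (a : α) : QueryAlg n α
  | query (x : Point n) (next : Bool → QueryAlg n α) : QueryAlg n α
  | sample (N : ℕ) (next : Fin (N + 1) → QueryAlg n α) : QueryAlg n α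

namespace QueryAlg

/-- The worst-case number of queries, over all answers and all random choices. -/
def queries {n : ℕ} {α : Type} : QueryAlg n α → ℕ
  | output _ => 0
  | query _ next => 1 + max (next false).queries (next true).queries
  | sample _ next => Finset.univ.sup fun j => (next j).queries

/-- The distribution of the output when the queries are answered by `f`. -/
noncomputable def run {n : ℕ} {α : Type} (f : Point n → Bool) : QueryAlg n α → PMF α
  | output a => PMF.pure a
  | query x next => (next (f x)).run f
  | sample N next => (PMF.uniformOfFintype (Fin (N + 1))).bind fun j => (next j).run f

end QueryAlg

/-- Possible outputs: `none` is "unate", and `some (i, x, y)` is the pair of edges `(x, x^(i))`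
and `(y, y^(i))`. -/
abbrev Answer (n : ℕ) : Type := Option (Fin n × Point n × Point n)

/-- The answer is an edge violation of `f` to unateness: a monotone and an anti-monotone
bichromatic edge along the same variable. -/
def IsEdgeViolation {n : ℕ} (f : Point n → Bool) (o : Answer n) : Prop :=
  ∃ (i : Fin n) (x y : Point n), o = some (i, x, y) ∧ MonoEdge f i x ∧ AntiEdge f i y

end Unateness

open Unateness

/-!
For finitely many `n` the algorithm queries all points. Otherwise it combines two kinds of attacks,
one for functions of large and one for functions of small total influence. An attempt of either
kind succeeds with a small probability only, which repetition brings up to `2 / 3`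
(`QueryAlg.success_amplify`).

*Large total influence*, above `n ^ (2 / 3) / 144`. By a level-one Fourier bound
(`sum_abs_dirInf_sub_le`), the monotone and the anti-monotone influences of the variables differ by
at most `√n` in total. Both kinds of edges are therefore frequent along the same variables, and two
random edges along the same random variable form a violation with probability at least
`n ^ (-2 / 3) / 331776` (`le_success_randomPair`).

*Small total influence.* Half of the variables in `I` are influential, so a quarter of `I` is
influential in the same direction `σ` (`exists_direction`), while all of `I` has many strong edges
in the opposite direction `!σ`. With `l` the strength of these edges and `m = ⌈√n / 2 ^ l⌉`, each
attempt (`attempt`) draws a random set `S` of `m + 1` variables and looks along the variables of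
`S` for an edge with direction `σ` and one with direction `!σ` along the same variable.

The basic tool (`search`) finds the variable of an edge at `x` among a set `R` of variables with
logarithmically many queries: it repeatedly flips a random half of `R` and keeps the candidates that
explain the change of the value. It works at an edge along `i` if flips of a random half of the
other variables in `R` rarely change the values at its two endpoints. For `R = S` this is the
persistency of strong edges, so they are found from random points.

Influential edges need not be persistent, and are found in groups (`edgeGroup`) at dyadic scales.
The search at a point `x` uses random subsets of `S` of size `2 ^ a`. Every edge has a scale `a ≤ A`
at which it is calm enough for this search, while, unless `a = A`, flips of about `2 ^ a` variables
matter at one of its endpoints (`exists_calm`). Such endpoints are recognized with few queries, and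
they are rare, since the influence of `S` is small; so the search is restricted to them, and the
`2 ^ (A - a)` searches made there compensate for the smallness of the subsets. This gives the same
rate at each scale, up to logarithmic factors (`le_ev_edgeGroup`), and one of the scales is good for
many variables (`exists_le_success_attempt`).

A second moment argument (`le_success_attempt`) turns the rates for edges of both directions into a
bound for the probability of a collision, and `total_cost_le` adds up the queries with the
parameters chosen in `exists_directedSearch`.
-/

open scoped BigOperators

namespace Unateness

/-! ### Expectations over query algorithms -/

/-- The indicator of a proposition, as a real number. -/
noncomputable def ind (p : Prop) : ℝ := open Classical in if p then 1 else 0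

lemma ind_of {p : Prop} (h : p) : ind p = 1 := by simp [ind, h]

lemma ind_of_not {p : Prop} (h : ¬p) : ind p = 0 := by simp [ind, h]

lemma ind_nonneg (p : Prop) : 0 ≤ ind p := by unfold ind; split_ifs <;> norm_num

lemma ind_le_one (p : Prop) : ind p ≤ 1 := by unfold ind; split_ifs <;> norm_num

lemma ind_mono {p q : Prop} (h : p → q) : ind p ≤ ind q := by
  by_cases hp : p
  · rw [ind_of hp, ind_of (h hp)]
  · rw [ind_of_not hp]; exact ind_nonneg q

lemma ind_congr {p q : Prop} (h : p ↔ q) : ind p = ind q := by rw [propext h]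

lemma ind_not (p : Prop) : ind (¬p) = 1 - ind p := by
  by_cases hp : p <;> simp [ind, hp]

lemma ind_and (p q : Prop) : ind (p ∧ q) = ind p * ind q := by
  by_cases hp : p <;> by_cases hq : q <;> simp [ind, hp, hq]

lemma ind_or_le (p q : Prop) : ind (p ∨ q) ≤ ind p + ind q := by
  by_cases hp : p <;> by_cases hq : q <;> simp [ind, hp, hq]

lemma ind_mul_self (p : Prop) : ind p * ind p = ind p := by
  by_cases hp : p <;> simp [ind, hp]

lemma sum_ind {α : Type*} (s : Finset α) (p : α → Prop) [DecidablePred p] :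
    ∑ a ∈ s, ind (p a) = ((s.filter p).card : ℝ) := by
  rw [Finset.card_filter]
  push_cast
  exact Finset.sum_congr rfl fun a _ => by by_cases h : p a <;> simp [ind, h]

namespace QueryAlg

variable {n : ℕ} {α β : Type}

/-- The expectation of `φ` over the output of a query algorithm run on `f`. -/
noncomputable def ev (f : Point n → Bool) (φ : α → ℝ) : QueryAlg n α → ℝ
  | output a => φ a
  | query x next => (next (f x)).ev f φ
  | sample N next => 𝔼 j : Fin (N + 1), (next j).ev f φ

/-- Run `A`, then continue with `g a`, where `a` is the output of `A`. -/
def bind : QueryAlg n α → (α → QueryAlg n β) → QueryAlg n β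
  | output a, g => g a
  | query x next, g => query x fun b => (next b).bind g
  | sample N next, g => sample N fun j => (next j).bind g

/-- Every possible output of the algorithm, when run on `f`, satisfies `P`. -/
def Always (f : Point n → Bool) (P : α → Prop) : QueryAlg n α → Prop
  | output a => P a
  | query x next => (next (f x)).Always f P
  | sample _ next => ∀ j, (next j).Always f P

variable (f : Point n → Bool)

lemma prob_run (E : Set α) (A : QueryAlg n α) :
    prob (A.run f) E = A.ev f fun a => ind (a ∈ E) := by
  classical
  induction A with
  | output a =>
    simp only [run, ev, prob, PMF.toOuterMeasure_pure_apply, ind]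
    split_ifs <;> simp
  | query x next ih => simpa only [run, ev] using ih (f x)
  | sample N next ih =>
    simp only [run, ev]
    rw [Fintype.expect_eq_sum_div_card, Finset.sum_div]
    simp only [← ih]
    unfold prob
    rw [PMF.toOuterMeasure_bind_apply, tsum_fintype, ENNReal.toReal_sum]
    · refine Finset.sum_congr rfl fun j _ => ?_
      rw [ENNReal.toReal_mul, PMF.uniformOfFintype_apply, div_eq_inv_mul, ENNReal.toReal_inv,
        ENNReal.toReal_natCast]
    · intro j _
      refine ENNReal.mul_ne_top (PMF.apply_ne_top _ _) ?_
      refine ne_of_lt (lt_of_le_of_lt (MeasureTheory.OuterMeasure.mono _ (Set.subset_univ E)) ?_)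
      exact lt_of_eq_of_lt ((PMF.toOuterMeasure_apply_eq_one_iff ((next j).run f) Set.univ).2
        (Set.subset_univ _)) ENNReal.one_lt_top

@[simp] lemma ev_output (φ : α → ℝ) (a : α) : (output a : QueryAlg n α).ev f φ = φ a := rfl

@[simp] lemma ev_query (φ : α → ℝ) (x : Point n) (next : Bool → QueryAlg n α) :
    (query x next).ev f φ = (next (f x)).ev f φ := rfl

@[simp] lemma ev_bind (φ : β → ℝ) (A : QueryAlg n α) (g : α → QueryAlg n β) :
    (A.bind g).ev f φ = A.ev f fun a => (g a).ev f φ := by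
  induction A with
  | output a => rfl
  | query x next ih => exact ih (f x)
  | sample N next ih => exact Finset.expect_congr rfl fun j _ => ih j

lemma ev_const (c : ℝ) (A : QueryAlg n α) : A.ev f (fun _ => c) = c := by
  induction A with
  | output a => rfl
  | query x next ih => exact ih (f x)
  | sample N next ih => simp [ev, ih]

lemma ev_add (φ ψ : α → ℝ) (A : QueryAlg n α) :
    A.ev f (fun a => φ a + ψ a) = A.ev f φ + A.ev f ψ := by
  induction A with
  | output a => rfl
  | query x next ih => exact ih (f x)
  | sample N next ih => simp [ev, ih, Finset.expect_add_distrib]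

lemma ev_mul_left (c : ℝ) (φ : α → ℝ) (A : QueryAlg n α) :
    A.ev f (fun a => c * φ a) = c * A.ev f φ := by
  induction A with
  | output a => rfl
  | query x next ih => exact ih (f x)
  | sample N next ih => simp [ev, ih, Finset.mul_expect]

lemma ev_sub (φ ψ : α → ℝ) (A : QueryAlg n α) :
    A.ev f (fun a => φ a - ψ a) = A.ev f φ - A.ev f ψ := by
  have := ev_add f φ (fun a => (-1) * ψ a) A
  rw [ev_mul_left] at this
  simpa [sub_eq_add_neg] using this

lemma ev_sum {ι : Type*} (s : Finset ι) (φ : ι → α → ℝ) (A : QueryAlg n α) :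
    A.ev f (fun a => ∑ i ∈ s, φ i a) = ∑ i ∈ s, A.ev f (φ i) := by
  classical
  induction s using Finset.induction_on with
  | empty => simpa using ev_const f 0 A
  | insert i s hi ih => simp only [Finset.sum_insert hi, ev_add, ih]

lemma ev_le_of_always {P : α → Prop} {φ ψ : α → ℝ} (A : QueryAlg n α) (hA : A.Always f P)
    (h : ∀ a, P a → φ a ≤ ψ a) : A.ev f φ ≤ A.ev f ψ := by
  induction A with
  | output a => exact h a hA
  | query x next ih => exact ih (f x) hA
  | sample N next ih => exact Finset.expect_le_expect fun j _ => ih j (hA j)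

lemma always_true (A : QueryAlg n α) : A.Always f fun _ => True := by
  induction A with
  | output a => trivial
  | query x next ih => exact ih (f x)
  | sample N next ih => exact ih

lemma ev_mono {φ ψ : α → ℝ} (A : QueryAlg n α) (h : ∀ a, φ a ≤ ψ a) : A.ev f φ ≤ A.ev f ψ :=
  ev_le_of_always f A (always_true f A) fun a _ => h a

lemma ev_nonneg {φ : α → ℝ} (A : QueryAlg n α) (h : ∀ a, 0 ≤ φ a) : 0 ≤ A.ev f φ := by
  simpa [ev_const] using ev_mono f (φ := fun _ => 0) A h

lemma ev_le_one {φ : α → ℝ} (A : QueryAlg n α) (h : ∀ a, φ a ≤ 1) : A.ev f φ ≤ 1 := by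
  simpa [ev_const] using ev_mono f (ψ := fun _ => 1) A h

lemma Always.bind {P : α → Prop} {Q : β → Prop} {A : QueryAlg n α} {g : α → QueryAlg n β}
    (hA : A.Always f P) (h : ∀ a, P a → (g a).Always f Q) : (A.bind g).Always f Q := by
  induction A with
  | output a => exact h a hA
  | query x next ih => exact ih (f x) hA
  | sample N next ih => exact fun j => ih j (hA j)

@[simp] lemma queries_output (a : α) : (output a : QueryAlg n α).queries = 0 := rfl

lemma queries_query_le {x : Point n} {next : Bool → QueryAlg n α} {B : ℕ}
    (h : ∀ b, (next b).queries ≤ B) : (query x next).queries ≤ 1 + B := by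
  simp only [queries]
  have := h false
  have := h true
  omega

lemma queries_bind_le {A : QueryAlg n α} {g : α → QueryAlg n β} {a b : ℕ} (hA : A.queries ≤ a)
    (hg : ∀ a, (g a).queries ≤ b) : (A.bind g).queries ≤ a + b := by
  refine le_trans ?_ (Nat.add_le_add_right hA b)
  clear hA
  induction A with
  | output a => simpa [bind] using hg a
  | query x next ih =>
    simp only [bind, queries]
    have := ih false
    have := ih true
    omega
  | sample N next ih =>
    simp only [bind, queries]
    refine Finset.sup_le fun j _ => (ih j).trans (Nat.add_le_add_right ?_ b)
    exact Finset.le_sup (f := fun j => (next j).queries) (Finset.mem_univ j)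

/-! ### Sampling, repetition and amplification -/

/-- A uniformly random element of `s` (a default value if `s` is empty). -/
noncomputable def pick [Inhabited α] (s : Finset α) : QueryAlg n α :=
  if h : s.Nonempty then
    sample (s.card - 1) fun j =>
      output (s.equivFin.symm (Fin.cast (Nat.sub_add_cancel h.card_pos) j) : α)
  else output default

lemma ev_pick [Inhabited α] {s : Finset α} (h : s.Nonempty) (φ : α → ℝ) :
    (pick s : QueryAlg n α).ev f φ = 𝔼 a ∈ s, φ a := by
  rw [pick, dif_pos h]
  simp only [ev]
  have hc : Fintype.card (Fin (s.card - 1 + 1)) = s.card := by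
    rw [Fintype.card_fin, Nat.sub_add_cancel h.card_pos]
  rw [Fintype.expect_eq_sum_div_card, Finset.expect_eq_sum_div_card, hc]
  congr 1
  rw [← Finset.sum_coe_sort s φ]
  exact Fintype.sum_equiv
    ((finCongr (Nat.sub_add_cancel h.card_pos)).trans s.equivFin.symm) _ _ fun j => rfl

@[simp] lemma queries_pick [Inhabited α] (s : Finset α) : (pick s : QueryAlg n α).queries = 0 := by
  unfold pick
  split_ifs
  · simp only [queries]
    exact Nat.le_zero.1 (Finset.sup_le fun j _ => le_rfl)
  · rfl

/-- `k` independent runs of `A`. -/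
def replicate : ℕ → QueryAlg n α → QueryAlg n (List α)
  | 0, _ => output []
  | k + 1, A => A.bind fun a => (replicate k A).bind fun l => output (a :: l)

lemma ev_replicate_zero (φ : List α → ℝ) (A : QueryAlg n α) :
    (replicate 0 A).ev f φ = φ [] := rfl

lemma ev_replicate_succ (k : ℕ) (φ : List α → ℝ) (A : QueryAlg n α) :
    (replicate (k + 1) A).ev f φ =
      A.ev f fun a => (replicate k A).ev f fun l => φ (a :: l) := by
  simp [replicate]

lemma queries_replicate_le (k : ℕ) (A : QueryAlg n α) :
    (replicate k A).queries ≤ k * A.queries := by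
  induction k with
  | zero => simp [replicate]
  | succ k ih =>
    refine (queries_bind_le le_rfl fun a => queries_bind_le ih (b := 0) fun l => ?_).trans ?_
    · simp
    · rw [Nat.succ_mul]; omega

lemma Always.replicate {P : α → Prop} {A : QueryAlg n α} (hA : A.Always f P) (k : ℕ) :
    (replicate k A).Always f fun l => l.length = k ∧ ∀ a ∈ l, P a := by
  induction k with
  | zero => exact ⟨rfl, by simp⟩
  | succ k ih =>
    refine hA.bind f fun a ha => ih.bind f fun l hl => ?_
    refine ⟨by simp [hl.1], ?_⟩
    simpa using ⟨ha, hl.2⟩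

lemma ev_replicate_sum (k : ℕ) (φ : α → ℝ) (A : QueryAlg n α) :
    (replicate k A).ev f (fun l => (l.map φ).sum) = k * A.ev f φ := by
  induction k with
  | zero => simp [ev_replicate_zero]
  | succ k ih =>
    rw [ev_replicate_succ]
    simp only [List.map_cons, List.sum_cons, ev_add, ev_const, ih]
    push_cast
    ring

lemma ev_replicate_sum_sq_le (k : ℕ) (φ : α → ℝ) (A : QueryAlg n α) :
    (replicate k A).ev f (fun l => (l.map φ).sum ^ 2) ≤
      k * A.ev f (fun a => φ a ^ 2) + k ^ 2 * A.ev f φ ^ 2 := by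
  have h : (replicate k A).ev f (fun l => (l.map φ).sum ^ 2) =
      k * A.ev f (fun a => φ a ^ 2) + k * (k - 1) * A.ev f φ ^ 2 := by
    induction k with
    | zero => simp [ev_replicate_zero]
    | succ k ih =>
      rw [ev_replicate_succ]
      have e : ∀ a : α, ((replicate k A).ev f fun l => ((a :: l).map φ).sum ^ 2) =
          φ a ^ 2 + (2 * (k * A.ev f φ)) * φ a +
            (k * A.ev f (fun a => φ a ^ 2) + k * (k - 1) * A.ev f φ ^ 2) := by
        intro a
        rw [← ih, ← ev_replicate_sum]
        have : ∀ l : List α, ((a :: l).map φ).sum ^ 2 =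
            φ a ^ 2 + (2 * φ a) * (l.map φ).sum + (l.map φ).sum ^ 2 := by
          intro l; simp only [List.map_cons, List.sum_cons]; ring
        simp only [this, ev_add, ev_mul_left, ev_const]
        ring
      simp only [e, ev_add, ev_mul_left, ev_const]
      push_cast
      ring
  rw [h]
  nlinarith [sq_nonneg (A.ev f φ), (Nat.cast_nonneg k : (0 : ℝ) ≤ k)]

lemma ev_replicate_exists (k : ℕ) (P : α → Prop) (A : QueryAlg n α) :
    (replicate k A).ev f (fun l => ind (∃ a ∈ l, P a)) =
      1 - (1 - A.ev f fun a => ind (P a)) ^ k := by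
  induction k with
  | zero => simp [ev_replicate_zero, ind]
  | succ k ih =>
    rw [ev_replicate_succ]
    set s := A.ev f fun a => ind (P a)
    have e : ∀ a : α, ((replicate k A).ev f fun l => ind (∃ b ∈ a :: l, P b)) =
        (1 - s) ^ k * ind (P a) + (1 - (1 - s) ^ k) := by
      intro a
      by_cases ha : P a
      · have : ∀ l : List α, ind (∃ b ∈ a :: l, P b) = 1 := fun l => ind_of ⟨a, by simp, ha⟩
        simp only [this, ev_const, ind_of ha]
        ring
      · have : ∀ l : List α, ind (∃ b ∈ a :: l, P b) = ind (∃ b ∈ l, P b) := fun l =>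
          ind_congr (by simp [ha])
        simp only [this, ih, ind_of_not ha]
        ring
    simp only [e, ev_add, ev_mul_left, ev_const]
    change (1 - s) ^ k * s + _ = _
    ring

/-- The probability that the output is an edge violation of `f`. -/
noncomputable def success (A : QueryAlg n (Answer n)) : ℝ :=
  A.ev f fun o => ind (IsEdgeViolation f o)

lemma success_nonneg (A : QueryAlg n (Answer n)) : 0 ≤ A.success f :=
  ev_nonneg f A fun _ => ind_nonneg _

lemma success_le_one (A : QueryAlg n (Answer n)) : A.success f ≤ 1 :=
  ev_le_one f A fun _ => ind_le_one _

/-- Run `A` and query the four endpoints of the pair of edges it returns; if they do not form an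
edge violation, run `B` instead. -/
def orElse (A B : QueryAlg n (Answer n)) : QueryAlg n (Answer n) :=
  A.bind fun o => match o with
    | none => B
    | some (i, x, y) =>
      query x fun a => query (flipVar x i) fun b => query y fun c => query (flipVar y i) fun d =>
        if (a ≠ b ∧ x i = a) ∧ (c ≠ d ∧ y i ≠ c) then output (some (i, x, y)) else B

lemma success_orElse (A B : QueryAlg n (Answer n)) :
    (A.orElse B).success f = 1 - (1 - A.success f) * (1 - B.success f) := by
  have e : (A.orElse B).success f =
      A.ev f fun o => (1 - B.success f) * ind (IsEdgeViolation f o) + B.success f := by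
    rw [success, orElse, ev_bind]
    congr 1
    funext o
    rcases o with _ | ⟨i, x, y⟩
    · have : ¬IsEdgeViolation f (none : Answer n) := by rintro ⟨i, x, y, h, -⟩; simp at h
      simp only [ind_of_not this, mul_zero, zero_add]
      rfl
    · simp only [ev_query]
      split_ifs with h
      · have : IsEdgeViolation f (some (i, x, y)) := ⟨i, x, y, rfl, h.1, h.2⟩
        simp [ind_of this]
      · have : ¬IsEdgeViolation f (some (i, x, y)) := by
          rintro ⟨i', x', y', h', h1, h2⟩
          simp only [Option.some.injEq, Prod.mk.injEq] at h'
          obtain ⟨rfl, rfl, rfl⟩ := h'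
          exact h ⟨h1, h2⟩
        simp only [ind_of_not this, mul_zero, zero_add]
        rfl
  rw [e]
  simp only [ev_add, ev_mul_left, ev_const]
  change (1 - B.success f) * A.success f + _ = _
  ring

lemma queries_orElse_le (A B : QueryAlg n (Answer n)) :
    (A.orElse B).queries ≤ A.queries + (4 + B.queries) := by
  refine queries_bind_le le_rfl fun o => ?_
  rcases o with _ | ⟨i, x, y⟩
  · simp
  · have : 4 + B.queries = 1 + (1 + (1 + (1 + B.queries))) := by omega
    rw [this]
    refine queries_query_le fun a => queries_query_le fun b => queries_query_le fun c =>
      queries_query_le fun d => ?_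
    split_ifs <;> simp

/-- Try the algorithms of the list in turn, until an edge violation is found. -/
def tryAll : List (QueryAlg n (Answer n)) → QueryAlg n (Answer n)
  | [] => output none
  | A :: l => A.orElse (tryAll l)

lemma success_le_tryAll {l : List (QueryAlg n (Answer n))} {A : QueryAlg n (Answer n)}
    (hA : A ∈ l) : A.success f ≤ (tryAll l).success f := by
  induction l with
  | nil => simp at hA
  | cons B l ih =>
    rw [tryAll, success_orElse]
    have h1 := success_nonneg f B
    have h2 := success_le_one f B
    have h3 := success_nonneg f (tryAll l)
    have h4 := success_le_one f (tryAll l)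
    rcases List.mem_cons.1 hA with rfl | hA
    · nlinarith
    · have := ih hA
      nlinarith

lemma queries_tryAll_le {l : List (QueryAlg n (Answer n))} {B : ℕ} (h : ∀ A ∈ l, A.queries ≤ B) :
    (tryAll l).queries ≤ l.length * (B + 4) := by
  induction l with
  | nil => simp [tryAll]
  | cons A l ih =>
    have h1 := queries_orElse_le A (tryAll l)
    have h2 := ih fun A hA => h A (List.mem_cons_of_mem _ hA)
    have h3 := h A List.mem_cons_self
    rw [tryAll, List.length_cons, Nat.succ_mul]
    omega

/-- Repeating an algorithm with success probability `p` at least `2 / p` times gives success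
probability `2/3`. -/
lemma success_amplify {A : QueryAlg n (Answer n)} {N : ℕ} (h : 2 ≤ N * A.success f) :
    2 / 3 ≤ (tryAll (List.replicate N A)).success f := by
  have e : ∀ N : ℕ, (tryAll (List.replicate N A)).success f = 1 - (1 - A.success f) ^ N := by
    intro N
    induction N with
    | zero =>
      have : ¬IsEdgeViolation f (none : Answer n) := by rintro ⟨i, x, y, h, -⟩; simp at h
      simp [tryAll, success, ind_of_not this]
    | succ N ih => rw [List.replicate_succ, tryAll, success_orElse, ih]; ring
  rw [e]
  set s := A.success f
  have h1 : 1 - s ≤ Real.exp (-s) := by have := Real.add_one_le_exp (-s); linarith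
  have h2 : (1 - s) ^ N ≤ Real.exp (-2) := by
    calc (1 - s) ^ N ≤ Real.exp (-s) ^ N :=
          pow_le_pow_left₀ (by linarith [success_le_one f A]) h1 N
      _ = Real.exp (-(N * s)) := by rw [← Real.exp_nat_mul]; ring_nf
      _ ≤ Real.exp (-2) := Real.exp_le_exp.2 (by linarith)
  have h3 : Real.exp (-2) ≤ 1 / 3 := by
    rw [Real.exp_neg, inv_eq_one_div]
    exact one_div_le_one_div_of_le (by norm_num) (by linarith [Real.add_one_le_exp (2 : ℝ)])
  linarith

end QueryAlg

/-! ### Averages over subsets of a given size -/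

section Subsets

open Finset

variable {α : Type*} [DecidableEq α] {V : Finset α} {i : α} {m k r : ℕ}

lemma expect_ind_mem_mul (hi : i ∈ V) (hm : m + 1 ≤ #V) (h : Finset α → ℝ) :
    𝔼 S ∈ V.powersetCard (m + 1), ind (i ∈ S) * h S =
      ((m + 1 : ℝ) / #V) * 𝔼 Q ∈ (V.erase i).powersetCard m, h (insert i Q) := by
  have e : ∑ S ∈ V.powersetCard (m + 1), ind (i ∈ S) * h S =
      ∑ Q ∈ (V.erase i).powersetCard m, h (insert i Q) := by
    have h1 : ∑ S ∈ V.powersetCard (m + 1), ind (i ∈ S) * h S =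
        ∑ S ∈ (V.powersetCard (m + 1)).filter (i ∈ ·), h S := by
      rw [sum_filter]
      exact sum_congr rfl fun S _ => by by_cases hS : i ∈ S <;> simp [ind, hS]
    rw [h1]
    refine sum_bij' (fun S _ => S.erase i) (fun Q _ => insert i Q) ?_ ?_ ?_ ?_ ?_
    · intro S hS
      simp only [mem_filter, mem_powersetCard] at hS ⊢
      exact ⟨erase_subset_erase i hS.1.1, by rw [card_erase_of_mem hS.2, hS.1.2]; rfl⟩
    · intro Q hQ
      simp only [mem_filter, mem_powersetCard] at hQ ⊢
      have : i ∉ Q := fun h => notMem_erase i V (hQ.1 h)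
      exact ⟨⟨insert_subset hi (hQ.1.trans (erase_subset _ _)),
        by rw [card_insert_of_notMem this, hQ.2]⟩, mem_insert_self _ _⟩
    · intro S hS
      exact insert_erase (mem_filter.1 hS).2
    · intro Q hQ
      exact erase_insert fun h => notMem_erase i V ((mem_powersetCard.1 hQ).1 h)
    · intro S hS
      rw [insert_erase (mem_filter.1 hS).2]
  rw [expect_eq_sum_div_card, e, expect_eq_sum_div_card, card_powersetCard, card_powersetCard,
    card_erase_of_mem hi]
  obtain ⟨N, hN⟩ : ∃ N, #V = N + 1 := ⟨#V - 1, by omega⟩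
  rw [hN, Nat.add_sub_cancel]
  have hc := Nat.add_one_mul_choose_eq N m
  have h1 : (0 : ℝ) < (N + 1).choose (m + 1) := by exact_mod_cast Nat.choose_pos (by omega)
  have h2 : (0 : ℝ) < N.choose m := by exact_mod_cast Nat.choose_pos (by omega)
  have hc' : ((N : ℝ) + 1) * N.choose m = (N + 1).choose (m + 1) * (m + 1) := by exact_mod_cast hc
  push_cast
  rw [div_mul_div_comm, div_eq_div_iff h1.ne' (by positivity)]
  linear_combination (∑ Q ∈ (V.erase i).powersetCard m, h (insert i Q)) * hc'

lemma expect_ind_notMem_mul (hi : i ∈ V) (hk : k ≤ #V) (h : Finset α → ℝ) :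
    𝔼 S ∈ V.powersetCard k, ind (i ∉ S) * h S =
      (1 - (k : ℝ) / #V) * 𝔼 Q ∈ (V.erase i).powersetCard k, h Q := by
  have e : ∑ S ∈ V.powersetCard k, ind (i ∉ S) * h S =
      ∑ Q ∈ (V.erase i).powersetCard k, h Q := by
    have h1 : (V.erase i).powersetCard k = (V.powersetCard k).filter (i ∉ ·) := by
      ext S
      simp only [mem_filter, mem_powersetCard, subset_erase]
      tauto
    rw [h1, sum_filter]
    exact sum_congr rfl fun S _ => by by_cases hS : i ∈ S <;> simp [ind, hS]
  rw [expect_eq_sum_div_card, e, expect_eq_sum_div_card, card_powersetCard, card_powersetCard,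
    card_erase_of_mem hi]
  obtain ⟨N, hN⟩ : ∃ N, #V = N + 1 := ⟨#V - 1, by have := card_pos.2 ⟨i, hi⟩; omega⟩
  rw [hN] at hk ⊢
  rw [Nat.add_sub_cancel]
  have h1 : (0 : ℝ) < (N + 1).choose k := by exact_mod_cast Nat.choose_pos hk
  have h3 : ((N + 1 : ℕ) : ℝ) ≠ 0 := by positivity
  rcases Nat.lt_or_ge N k with hk' | hk'
  · obtain rfl : k = N + 1 := by omega
    rw [div_self h3, sub_self, zero_mul, powersetCard_eq_empty.2, sum_empty, zero_div]
    rw [card_erase_of_mem hi, hN]; omega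
  · have h2 : (0 : ℝ) < N.choose k := by exact_mod_cast Nat.choose_pos hk'
    have hc : ((N.choose k : ℕ) : ℝ) * (N + 1) = (N + 1).choose k * (N + 1 - k) := by
      have := Nat.choose_mul_succ_eq N k
      have h4 : ((N + 1 - k : ℕ) : ℝ) = (N : ℝ) + 1 - k := by
        rw [Nat.cast_sub hk]; push_cast; ring
      rw [← h4]
      exact_mod_cast this
    rw [one_sub_div h3, div_mul_div_comm, div_eq_div_iff h1.ne' (by positivity)]
    push_cast
    linear_combination (∑ Q ∈ (V.erase i).powersetCard k, h Q) * hc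

lemma expect_ind_mem (hi : i ∈ V) (hk : k ≤ #V) :
    𝔼 S ∈ V.powersetCard k, ind (i ∈ S) = (k : ℝ) / #V := by
  have hne : (V.powersetCard k).Nonempty := powersetCard_nonempty.2 hk
  have h1 := expect_ind_notMem_mul hi hk fun _ => 1
  rcases Nat.lt_or_ge k #V with h | h
  · have hne' : ((V.erase i).powersetCard k).Nonempty := powersetCard_nonempty.2 (by
      rw [card_erase_of_mem hi]; omega)
    simp only [mul_one, ind_not, expect_sub_distrib, expect_const hne, expect_const hne'] at h1
    linarith
  · obtain rfl : k = #V := le_antisymm hk h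
    have : (#V : ℝ) ≠ 0 := by have := card_pos.2 ⟨i, hi⟩; positivity
    rw [div_self this, sub_self, zero_mul] at h1
    simp only [mul_one, ind_not, expect_sub_distrib, expect_const hne] at h1
    rw [div_self this]
    linarith

/-- A random `k`-subset of a random `r`-subset is a random `k`-subset. -/
lemma expect_powersetCard_powersetCard (hk : k ≤ r) (hr : r ≤ #V) (g : Finset α → ℝ) :
    𝔼 R ∈ V.powersetCard r, 𝔼 T ∈ R.powersetCard k, g T = 𝔼 T ∈ V.powersetCard k, g T := by
  have e : ∑ R ∈ V.powersetCard r, ∑ T ∈ R.powersetCard k, g T =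
      (#V - k).choose (r - k) * ∑ T ∈ V.powersetCard k, g T := by
    rw [mul_sum, sum_comm' (t' := V.powersetCard k)
      (s' := fun T => (V.powersetCard r).filter (T ⊆ ·))]
    · refine sum_congr rfl fun T hT => ?_
      have hT := mem_powersetCard.1 hT
      rw [sum_const, card_filter_powersetCard_subset T V r hT.1 (by omega), hT.2, nsmul_eq_mul]
    · intro R T
      simp only [mem_filter, mem_powersetCard]
      constructor
      · rintro ⟨⟨h1, h2⟩, h3, h4⟩
        exact ⟨⟨⟨h1, h2⟩, h3⟩, h3.trans h1, h4⟩
      · rintro ⟨⟨⟨h1, h2⟩, h3⟩, h4, h5⟩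
        exact ⟨⟨h1, h2⟩, h3, h5⟩
  have e2 : 𝔼 R ∈ V.powersetCard r, 𝔼 T ∈ R.powersetCard k, g T =
      𝔼 R ∈ V.powersetCard r, (∑ T ∈ R.powersetCard k, g T) / r.choose k := by
    refine expect_congr rfl fun R hR => ?_
    rw [expect_eq_sum_div_card, card_powersetCard, (mem_powersetCard.1 hR).2]
  rw [e2, expect_eq_sum_div_card, ← sum_div, e, expect_eq_sum_div_card, card_powersetCard,
    card_powersetCard]
  have h1 : (0 : ℝ) < r.choose k := by exact_mod_cast Nat.choose_pos hk
  have h2 : (0 : ℝ) < (#V).choose r := by exact_mod_cast Nat.choose_pos hr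
  have h3 : (0 : ℝ) < (#V).choose k := by exact_mod_cast Nat.choose_pos (hk.trans hr)
  have hc : (((#V).choose r : ℕ) : ℝ) * r.choose k = (#V).choose k * (#V - k).choose (r - k) := by
    exact_mod_cast Nat.choose_mul hk
  rw [div_div, div_eq_div_iff (by positivity) h3.ne']
  linear_combination (-∑ T ∈ V.powersetCard k, g T) * hc

/-- A random half of `V` separates two given elements with probability at least `1/2`. -/
lemma expect_not_separated_le {v : α} (hi : i ∈ V) (hv : v ∈ V) (hiv : i ≠ v)
    (hV : #V = m + 1) :
    𝔼 T ∈ V.powersetCard (m / 2 + 1), ind (i ∈ T ↔ v ∈ T) ≤ 1 / 2 := by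
  have hm : 1 ≤ m := by
    have : #{i, v} ≤ #V := card_le_card (by simp [insert_subset_iff, hi, hv])
    rw [card_pair hiv] at this
    omega
  have key : ∀ a b, a ∈ V → b ∈ V → a ≠ b →
      𝔼 T ∈ V.powersetCard (m / 2 + 1), ind (a ∈ T) * ind (b ∉ T) =
        ((m / 2 : ℕ) + 1) / (m + 1) * (1 - (m / 2 : ℕ) / m) := by
    intro a b ha hb hab
    rw [expect_ind_mem_mul ha (by omega)]
    have h1 : ∀ Q ∈ (V.erase a).powersetCard (m / 2), ind (b ∉ insert a Q) = 1 - ind (b ∈ Q) := by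
      intro Q _
      rw [← ind_not]
      exact ind_congr (by simp [hab.symm])
    have hb' : b ∈ V.erase a := mem_erase.2 ⟨hab.symm, hb⟩
    have hc : #(V.erase a) = m := by rw [card_erase_of_mem ha, hV]; rfl
    rw [expect_congr rfl h1, expect_sub_distrib, expect_ind_mem hb' (by omega),
      expect_const (powersetCard_nonempty.2 (by omega)), hc, hV]
    push_cast
    ring
  have e : ∀ T : Finset α, ind (i ∈ T ↔ v ∈ T) =
      1 - ind (i ∈ T) * ind (v ∉ T) - ind (v ∈ T) * ind (i ∉ T) := by
    intro T
    by_cases h1 : i ∈ T <;> by_cases h2 : v ∈ T <;> simp [ind, h1, h2]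
  simp only [e, expect_sub_distrib, key i v hi hv hiv, key v i hv hi hiv.symm]
  rw [expect_const (powersetCard_nonempty.2 (by omega))]
  have hm' : (0 : ℝ) < m := by exact_mod_cast hm
  have h4 : (1 : ℝ) / 4 ≤ ((m / 2 : ℕ) + 1) / (m + 1) * (1 - (m / 2 : ℕ) / m) := by
    rw [one_sub_div hm'.ne', div_mul_div_comm, div_le_div_iff₀ (by norm_num) (by positivity)]
    rcases Nat.even_or_odd' m with ⟨u, rfl | rfl⟩
    · have : 2 * u / 2 = u := by omega
      rw [this]; push_cast at hm' ⊢; nlinarith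
    · have : (2 * u + 1) / 2 = u := by omega
      rw [this]; push_cast at hm' ⊢; nlinarith [(Nat.cast_nonneg u : (0 : ℝ) ≤ u)]
  linarith

/-- The second moment of the size of the intersection of `I` with a random `m + 1`-subset. -/
lemma expect_sum_ind_mem_sq_le {I : Finset α} (hI : I ⊆ V) (hm : m + 1 ≤ #V) :
    𝔼 S ∈ V.powersetCard (m + 1), (∑ i ∈ I, ind (i ∈ S)) ^ 2 ≤
      (#I * ((m + 1 : ℝ) / #V)) ^ 2 + #I * ((m + 1 : ℝ) / #V) := by
  set p : ℝ := (m + 1 : ℝ) / #V with hp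
  have hV : (0 : ℝ) < #V := by exact_mod_cast (by omega : 0 < #V)
  have hp0 : 0 ≤ p := by positivity
  have e : ∀ S : Finset α, (∑ i ∈ I, ind (i ∈ S)) ^ 2 =
      ∑ i ∈ I, ind (i ∈ S) * ∑ j ∈ I, ind (j ∈ S) := by
    intro S; rw [sq, sum_mul]
  simp only [e]
  rw [expect_sum_comm]
  have h : ∀ i ∈ I, 𝔼 S ∈ V.powersetCard (m + 1), ind (i ∈ S) * ∑ j ∈ I, ind (j ∈ S) ≤
      p * (1 + #I * p) := by
    intro i hi
    rw [expect_ind_mem_mul (hI hi) hm, ← hp]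
    refine mul_le_mul_of_nonneg_left ?_ hp0
    have hc : #(V.erase i) = #V - 1 := card_erase_of_mem (hI hi)
    have hne : ((V.erase i).powersetCard m).Nonempty := powersetCard_nonempty.2 (by omega)
    have h1 : ∀ Q ∈ (V.erase i).powersetCard m, ∑ j ∈ I, ind (j ∈ insert i Q) ≤
        1 + ∑ j ∈ I.erase i, ind (j ∈ Q) := by
      intro Q _
      rw [← add_sum_erase I _ hi]
      refine add_le_add (ind_le_one _) (sum_le_sum fun j hj => ind_mono fun h => ?_)
      exact (mem_insert.1 h).resolve_left (ne_of_mem_erase hj)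
    refine (expect_le_expect h1).trans ?_
    rw [expect_add_distrib, expect_const hne, expect_sum_comm]
    gcongr
    have h2 : ∀ j ∈ I.erase i, 𝔼 Q ∈ (V.erase i).powersetCard m, ind (j ∈ Q) ≤ p := by
      intro j hj
      rw [expect_ind_mem (erase_subset_erase i hI hj) (by omega), hc, hp]
      have hV1 : 1 < #V := by
        have : 0 < #(V.erase i) := card_pos.2 ⟨j, erase_subset_erase i hI hj⟩
        omega
      have h3 : ((#V - 1 : ℕ) : ℝ) = #V - 1 := by rw [Nat.cast_sub (by omega)]; norm_num
      have h4 : (1 : ℝ) < #V := by exact_mod_cast hV1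
      have h5 : (m : ℝ) + 1 ≤ #V := by exact_mod_cast hm
      rw [h3, div_le_div_iff₀ (by linarith) hV]
      nlinarith
    refine (sum_le_sum h2).trans ?_
    rw [sum_const, nsmul_eq_mul]
    gcongr
    exact erase_subset _ _
  refine (sum_le_sum h).trans ?_
  rw [sum_const, nsmul_eq_mul]
  nlinarith

end Subsets

/-! ### Flips, edges and noise -/

section Noise

variable {n : ℕ}

/-- The point `x` with the coordinates in `S` flipped. -/
def flip (x : Point n) (S : Finset (Fin n)) : Point n := fun j => if j ∈ S then !(x j) else x j

lemma flipSet_map (x : Point n) (S : Finset (Fin n)) :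
    flipSet x (S.map Fin.castSuccEmb) = flip x S := by
  funext j
  simp only [flipSet, flip]
  congr 1
  simp

lemma flipVar_eq (x : Point n) (i : Fin n) : flipVar x i = flip x {i} := by
  rw [flipVar, ← flipSet_map]; rfl

@[simp] lemma flip_empty (x : Point n) : flip x ∅ = x := by funext j; simp [flip]

@[simp] lemma flip_flip (x : Point n) (S : Finset (Fin n)) : flip (flip x S) S = x := by
  funext j; by_cases h : j ∈ S <;> simp [flip, h]

lemma flip_insert (x : Point n) {i : Fin n} {S : Finset (Fin n)} (h : i ∉ S) :
    flip x (insert i S) = flip (flip x {i}) S := by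
  funext j
  by_cases hj : j = i
  · subst hj; simp [flip, h]
  · simp [flip, hj]

/-- Flipping the coordinates in `S`, as a permutation of the cube. -/
def flipEquiv (S : Finset (Fin n)) : Point n ≃ Point n where
  toFun x := flip x S
  invFun x := flip x S
  left_inv x := flip_flip x S
  right_inv x := flip_flip x S

lemma expect_flip (S : Finset (Fin n)) (φ : Point n → ℝ) : 𝔼 x, φ (flip x S) = 𝔼 x, φ x :=
  Fintype.expect_equiv (flipEquiv S) _ _ fun _ => rfl

/-- The edge `(x, x^(i))` is bichromatic with direction `σ`: monotone if `σ` is `true`,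
anti-monotone otherwise. -/
def HasEdge (f : Point n → Bool) (σ : Bool) (i : Fin n) (x : Point n) : Prop :=
  f x ≠ f (flip x {i}) ∧ (x i = f x ↔ σ = true)

variable (f : Point n → Bool)

lemma hasEdge_true {i : Fin n} {x : Point n} : HasEdge f true i x ↔ MonoEdge f i x := by
  simp [HasEdge, MonoEdge, flipVar_eq]

lemma hasEdge_false {i : Fin n} {x : Point n} : HasEdge f false i x ↔ AntiEdge f i x := by
  simp [HasEdge, AntiEdge, flipVar_eq]

lemma hasEdge_flip {σ : Bool} {i : Fin n} {x : Point n} :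
    HasEdge f σ i (flip x {i}) ↔ HasEdge f σ i x := by
  have h : flip x {i} i = !(x i) := by simp [flip]
  simp only [HasEdge, flip_flip, h]
  cases hx : x i <;> cases h1 : f x <;> cases h2 : f (flip x {i}) <;> simp

/-- The probability that the edge along `i` at a random point is bichromatic with direction
`σ`. -/
noncomputable def dirInf (σ : Bool) (i : Fin n) : ℝ := 𝔼 x, ind (HasEdge f σ i x)

lemma dirInf_nonneg (σ : Bool) (i : Fin n) : 0 ≤ dirInf f σ i :=
  Finset.expect_nonneg fun _ _ => ind_nonneg _

lemma influence_eq_expect (i : Fin n) : influence f i = 𝔼 x, ind (f x ≠ f (flip x {i})) := by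
  classical
  rw [influence, prob, PMF.toOuterMeasure_uniformOfFintype_apply, ENNReal.toReal_div,
    Fintype.expect_eq_sum_div_card, sum_ind]
  simp [Fintype.card_subtype, flipVar_eq]

lemma influence_nonneg (i : Fin n) : 0 ≤ influence f i := by
  rw [influence_eq_expect]; exact Finset.expect_nonneg fun _ _ => ind_nonneg _

lemma dirInf_add (i : Fin n) : dirInf f true i + dirInf f false i = influence f i := by
  rw [dirInf, dirInf, ← Finset.expect_add_distrib, influence_eq_expect]
  refine Finset.expect_congr rfl fun x _ => ?_
  simp only [HasEdge]
  by_cases h1 : f x = f (flip x {i}) <;> by_cases h2 : x i = f x <;> simp [ind, h1, h2]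

/-- The probability that flipping a random `k`-subset of `Q` changes the value of `f` at `x`. -/
noncomputable def noise (Q : Finset (Fin n)) (k : ℕ) (x : Point n) : ℝ :=
  𝔼 T ∈ Q.powersetCard k, ind (f (flip x T) ≠ f x)

lemma noise_nonneg (Q : Finset (Fin n)) (k : ℕ) (x : Point n) : 0 ≤ noise f Q k x :=
  Finset.expect_nonneg fun _ _ => ind_nonneg _

lemma expect_ind_flip_ne_le (T : Finset (Fin n)) :
    𝔼 x, ind (f (flip x T) ≠ f x) ≤ ∑ j ∈ T, influence f j := by
  induction T using Finset.induction_on with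
  | empty => simp [ind]
  | insert i S hi ih =>
    have h1 : ∀ x : Point n, ind (f (flip x (insert i S)) ≠ f x) ≤
        ind (f (flip (flip x {i}) S) ≠ f (flip x {i})) + ind (f x ≠ f (flip x {i})) := by
      intro x
      rw [flip_insert x hi]
      refine (ind_mono fun h => ?_).trans (ind_or_le _ _)
      by_contra hc
      push Not at hc
      exact h (hc.1.trans hc.2.symm)
    refine (Finset.expect_le_expect fun x _ => h1 x).trans ?_
    rw [Finset.expect_add_distrib,
      expect_flip {i} (fun x => ind (f (flip x S) ≠ f x)), ← influence_eq_expect,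
      Finset.sum_insert hi]
    linarith

lemma expect_noise_le {S : Finset (Fin n)} {k : ℕ} (hk : k ≤ S.card) :
    𝔼 x, noise f S k x ≤ (k / S.card : ℝ) * ∑ j ∈ S, influence f j := by
  unfold noise
  rw [Finset.expect_comm]
  have h : ∀ T ∈ S.powersetCard k, 𝔼 x, ind (f (flip x T) ≠ f x) ≤
      ∑ j ∈ S, influence f j * ind (j ∈ T) := by
    intro T hT
    refine (expect_ind_flip_ne_le f T).trans (le_of_eq ?_)
    rw [← Finset.sum_subset (Finset.mem_powersetCard.1 hT).1]
    · exact Finset.sum_congr rfl fun j hj => by rw [ind_of hj, mul_one]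
    · intro j _ hj
      rw [ind_of_not hj, mul_zero]
  refine (Finset.expect_le_expect h).trans ?_
  rw [Finset.expect_sum_comm, Finset.mul_sum]
  refine Finset.sum_le_sum fun j hj => ?_
  rw [← Finset.mul_expect, expect_ind_mem hj hk, mul_comm]

/-- Removing one of the elements of `S` at most doubles the noise of sets of half the size. -/
lemma noise_erase_le {S : Finset (Fin n)} {i : Fin n} (hi : i ∈ S) {k : ℕ} (hk : 2 * k ≤ S.card)
    (x : Point n) : noise f (S.erase i) k x ≤ 2 * noise f S k x := by
  have h1 := expect_ind_notMem_mul hi (by omega : k ≤ S.card) fun T => ind (f (flip x T) ≠ f x)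
  have h2 : 𝔼 T ∈ S.powersetCard k, ind (i ∉ T) * ind (f (flip x T) ≠ f x) ≤ noise f S k x :=
    Finset.expect_le_expect fun T _ =>
      mul_le_of_le_one_left (ind_nonneg _) (ind_le_one _)
  rw [h1] at h2
  change _ * noise f (S.erase i) k x ≤ _ at h2
  have hS : (0 : ℝ) < S.card := by exact_mod_cast Finset.card_pos.2 ⟨i, hi⟩
  have h3 : (k : ℝ) / S.card ≤ 1 / 2 := by
    rw [div_le_div_iff₀ hS (by norm_num)]
    have : ((2 * k : ℕ) : ℝ) ≤ S.card := by exact_mod_cast hk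
    push_cast at this
    linarith
  nlinarith [noise_nonneg f (S.erase i) k x]

end Noise

open QueryAlg Finset

variable {n : ℕ}

/-! ### Searching for a bichromatic edge at a point -/

section Search

/-- `q` rounds of narrowing down the set `C` of candidates for the variable responsible for changes
of the value `b` at `x`: flip a random `k`-subset `T` of `R`, and keep the candidates in `T` if
the value changes and those outside `T` if it does not. -/
noncomputable def narrow (x : Point n) (b : Bool) (R : Finset (Fin n)) (k : ℕ) :
    ℕ → Finset (Fin n) → QueryAlg n (Finset (Fin n))
  | 0, C => output C
  | q + 1, C => (pick (R.powersetCard k)).bind fun T =>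
      query (flip x T) fun b' => narrow x b R k q (C.filter fun v => v ∈ T ↔ b' ≠ b)

/-- Search for a bichromatic edge with direction `σ` at `x` along a variable in `R`: narrow down
the set of candidates with random halves of `R`, and check the edge along the remaining one. -/
noncomputable def search (σ : Bool) (q : ℕ) (x : Point n) (R : Finset (Fin n)) :
    QueryAlg n (Option (Fin n × Point n)) :=
  query x fun b => (narrow x b R ((R.card - 1) / 2 + 1) q R).bind fun C =>
    match C.toList with
    | [i] => query (flip x {i}) fun b' =>
        if b ≠ b' ∧ (x i = b ↔ σ = true) then output (some (i, x)) else output none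
    | _ => output none

variable (f : Point n → Bool)

lemma queries_narrow_le (x : Point n) (b : Bool) (R : Finset (Fin n)) (k q : ℕ)
    (C : Finset (Fin n)) : (narrow x b R k q C).queries ≤ q := by
  induction q generalizing C with
  | zero => simp [narrow]
  | succ q ih =>
    rw [narrow, add_comm, ← Nat.zero_add (1 + q)]
    exact queries_bind_le (queries_pick _).le fun T => queries_query_le fun b' => ih _

lemma queries_search_le (σ : Bool) (q : ℕ) (x : Point n) (R : Finset (Fin n)) :
    (search σ q x R).queries ≤ q + 2 := by
  have : q + 2 = 1 + (q + 1) := by ring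
  rw [search, this]
  refine queries_query_le fun b => queries_bind_le (queries_narrow_le ..) fun C => ?_
  split
  · refine queries_query_le (B := 0) fun b' => ?_
    split_ifs <;> simp
  · simp

lemma always_search (σ : Bool) (q : ℕ) (x : Point n) (R : Finset (Fin n)) :
    (search σ q x R).Always f fun o => ∀ e ∈ o, HasEdge f σ e.1 e.2 := by
  rw [search]
  change ((narrow x (f x) R ((R.card - 1) / 2 + 1) q R).bind _).Always f _
  refine (always_true f _).bind f fun C _ => ?_
  split
  · rename_i i _
    change (if f x ≠ f (flip x {i}) ∧ (x i = f x ↔ σ = true) then output (some (i, x))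
      else output none : QueryAlg n (Option (Fin n × Point n))).Always f _
    split_ifs with h
    · intro e he
      obtain rfl : (i, x) = e := by simpa using he
      exact h
    · intro e he
      simp at he
  · intro e he
    simp at he

/-- The rounds of `narrow` isolate `i`, except with the probability that one of the flips of random
halves gives a misleading answer, or that some other candidate is never separated from `i`. -/
lemma le_ev_narrow {x : Point n} {i : Fin n} {R : Finset (Fin n)} {m : ℕ} (hi : i ∈ R)
    (hR : R.card = m + 1) (hx : f x ≠ f (flip x {i})) (q : ℕ) (C : Finset (Fin n)) (hC : C ⊆ R)
    (hiC : i ∈ C) :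
    1 - q * (noise f (R.erase i) (m / 2 + 1) x + noise f (R.erase i) (m / 2) (flip x {i})) -
        ((C.card : ℝ) - 1) / 2 ^ q ≤
      (narrow x (f x) R (m / 2 + 1) q C).ev f fun C' => ind (C' = {i}) := by
  set δ := noise f (R.erase i) (m / 2 + 1) x + noise f (R.erase i) (m / 2) (flip x {i}) with hδ
  have hδ0 : 0 ≤ δ := add_nonneg (noise_nonneg ..) (noise_nonneg ..)
  have hne : (R.powersetCard (m / 2 + 1)).Nonempty := powersetCard_nonempty.2 (by omega)
  -- a flip of `T` is misleading with probability at most `δ`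
  have hwrong : 𝔼 T ∈ R.powersetCard (m / 2 + 1), ind (¬(i ∈ T ↔ f (flip x T) ≠ f x)) ≤ δ := by
    have e : ∀ T : Finset (Fin n), ind (¬(i ∈ T ↔ f (flip x T) ≠ f x)) =
        ind (i ∈ T) * ind (f (flip x T) = f x) + ind (i ∉ T) * ind (f (flip x T) ≠ f x) := by
      intro T
      by_cases h1 : i ∈ T <;> by_cases h2 : f (flip x T) = f x <;> simp [ind, h1, h2]
    simp only [e]
    rw [expect_add_distrib, expect_ind_mem_mul hi (by omega), expect_ind_notMem_mul hi (by omega)]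
    have h1 : 𝔼 Q ∈ (R.erase i).powersetCard (m / 2), ind (f (flip x (insert i Q)) = f x) =
        noise f (R.erase i) (m / 2) (flip x {i}) := by
      refine expect_congr rfl fun Q hQ => ind_congr ?_
      rw [flip_insert x fun h => notMem_erase i R ((mem_powersetCard.1 hQ).1 h)]
      generalize f (flip (flip x {i}) Q) = a at *
      generalize f (flip x {i}) = b at *
      generalize f x = c at *
      cases a <;> cases b <;> cases c <;> simp at hx ⊢
    rw [h1]
    change _ + _ * noise f (R.erase i) (m / 2 + 1) x ≤ _
    have hR0 : (0 : ℝ) < R.card := by rw [hR]; positivity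
    have h2 : (((m / 2 : ℕ) : ℝ) + 1) / R.card ≤ 1 := by
      rw [div_le_one hR0, hR]
      exact_mod_cast (by omega : m / 2 + 1 ≤ m + 1)
    have h3 : 1 - ((m / 2 + 1 : ℕ) : ℝ) / R.card ≤ 1 := by
      have : (0 : ℝ) ≤ ((m / 2 + 1 : ℕ) : ℝ) / R.card := by positivity
      linarith
    have h4 := mul_le_of_le_one_left (noise_nonneg f (R.erase i) (m / 2) (flip x {i})) h2
    have h5 := mul_le_of_le_one_left (noise_nonneg f (R.erase i) (m / 2 + 1) x) h3
    linarith
  induction q generalizing C with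
  | zero =>
    rw [narrow, ev_output]
    by_cases h : C = {i}
    · simp [h, ind]
    · have hc : 2 ≤ C.card := by
        by_contra hcon
        exact h (eq_singleton_iff_unique_mem.2 ⟨hiC, fun j hj =>
          card_le_one.1 (by omega) j hj i hiC⟩)
      have hc' : (2 : ℝ) ≤ C.card := by exact_mod_cast hc
      rw [ind_of_not h]
      simp
      linarith
  | succ q ih =>
    rw [narrow, ev_bind, ev_pick f hne]
    simp only [ev_query]
    -- the candidates that survive a flip of `T` which is not misleading
    have step : ∀ T ∈ R.powersetCard (m / 2 + 1),
        (1 - q * δ) - ind (¬(i ∈ T ↔ f (flip x T) ≠ f x)) -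
          (∑ v ∈ C.erase i, ind (i ∈ T ↔ v ∈ T)) / 2 ^ q ≤
        (narrow x (f x) R (m / 2 + 1) q (C.filter fun v => v ∈ T ↔ f (flip x T) ≠ f x)).ev f
          fun C' => ind (C' = {i}) := by
      intro T _
      have hs0 : 0 ≤ (∑ v ∈ C.erase i, ind (i ∈ T ↔ v ∈ T)) / 2 ^ q :=
        div_nonneg (sum_nonneg fun _ _ => ind_nonneg _) (by positivity)
      by_cases hT : i ∈ T ↔ f (flip x T) ≠ f x
      · have h1 := ih (C.filter fun v => v ∈ T ↔ f (flip x T) ≠ f x)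
          ((filter_subset _ _).trans hC) (mem_filter.2 ⟨hiC, hT⟩)
        refine le_trans ?_ h1
        have h2 : ((C.filter fun v => v ∈ T ↔ f (flip x T) ≠ f x).card : ℝ) - 1 =
            ∑ v ∈ C.erase i, ind (i ∈ T ↔ v ∈ T) := by
          rw [← sum_ind, ← add_sum_erase C _ hiC, ind_of hT, add_sub_cancel_left]
          refine sum_congr rfl fun v _ => ind_congr ?_
          rw [← hT]
          exact Iff.comm
        rw [h2, ind_of_not (not_not.2 hT)]
        linarith
      · rw [ind_of hT]
        have h0 : 0 ≤ (narrow x (f x) R (m / 2 + 1) q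
            (C.filter fun v => v ∈ T ↔ f (flip x T) ≠ f x)).ev f fun C' => ind (C' = {i}) :=
          ev_nonneg f _ fun _ => ind_nonneg _
        have : 0 ≤ (q : ℝ) * δ := by positivity
        linarith
    refine le_trans ?_ (expect_le_expect step)
    rw [expect_sub_distrib, expect_sub_distrib, expect_const hne, ← expect_div, expect_sum_comm]
    have hsep : ∑ v ∈ C.erase i, 𝔼 T ∈ R.powersetCard (m / 2 + 1), ind (i ∈ T ↔ v ∈ T) ≤
        ((C.card : ℝ) - 1) * (1 / 2) := by
      have h1 : ∀ v ∈ C.erase i,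
          𝔼 T ∈ R.powersetCard (m / 2 + 1), ind (i ∈ T ↔ v ∈ T) ≤ 1 / 2 := fun v hv =>
        expect_not_separated_le hi (hC (mem_of_mem_erase hv)) (ne_of_mem_erase hv).symm hR
      refine (sum_le_sum h1).trans (le_of_eq ?_)
      rw [sum_const, nsmul_eq_mul, card_erase_of_mem hiC, Nat.cast_sub (card_pos.2 ⟨i, hiC⟩)]
      norm_num
    have h3 : (∑ v ∈ C.erase i, 𝔼 T ∈ R.powersetCard (m / 2 + 1), ind (i ∈ T ↔ v ∈ T)) / 2 ^ q ≤
        ((C.card : ℝ) - 1) / 2 ^ (q + 1) := by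
      rw [pow_succ, ← div_div, div_right_comm]
      gcongr
      linarith
    push_cast
    linarith

/-- The search at an endpoint of an edge along `i ∈ R` finds this edge, unless the endpoints of the
edge are sensitive to the flips of random halves of `R \ {i}`. -/
lemma le_ev_search {σ : Bool} {x : Point n} {i : Fin n} {R : Finset (Fin n)} {m : ℕ} (hi : i ∈ R)
    (hR : R.card = m + 1) (hx : HasEdge f σ i x) (q : ℕ) :
    1 - q * (noise f (R.erase i) (m / 2 + 1) x + noise f (R.erase i) (m / 2) (flip x {i})) -
        (m : ℝ) / 2 ^ q ≤
      (search σ q x R).ev f fun o => ind (∃ e ∈ o, e.1 = i) := by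
  have h := le_ev_narrow f hi hR hx.1 q R subset_rfl hi
  rw [search, ev_query, ev_bind, hR]
  have e : ((m + 1 : ℕ) : ℝ) - 1 = m := by push_cast; ring
  rw [hR, e] at h
  refine h.trans (ev_mono f _ fun C => ?_)
  by_cases hC : C = {i}
  · subst hC
    rw [ind_of rfl]
    simp only [toList_singleton, ev_query]
    rw [if_pos ⟨hx.1, hx.2⟩, ev_output, ind_of ⟨(i, x), rfl, rfl⟩]
  · rw [ind_of_not hC]
    exact ev_nonneg f _ fun _ => ind_nonneg _

end Search

/-! ### Collisions between two samples of edges -/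

section Collision

/-- The pair of edges along a common variable given by an edge with direction `σ` and an edge with
the opposite direction, the monotone one first. -/
def pairUp (σ : Bool) (e₁ e₂ : Fin n × Point n) : Fin n × Point n × Point n :=
  if σ then (e₁.1, e₁.2, e₂.2) else (e₁.1, e₂.2, e₁.2)

/-- A pair of edges along a common variable, one from each of two lists, if there is one. -/
noncomputable def matchEdges (σ : Bool) (l₁ : List (List (Fin n × Point n)))
    (l₂ : List (Option (Fin n × Point n))) : Answer n :=
  open Classical in
  if h : ∃ p : (Fin n × Point n) × (Fin n × Point n),
      (∃ F ∈ l₁, p.1 ∈ F) ∧ some p.2 ∈ l₂ ∧ p.1.1 = p.2.1 then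
    some (pairUp σ h.choose.1 h.choose.2)
  else none

/-- Run `A` `M` times and `B` `b` times, and look for a pair of edges along a common variable. -/
noncomputable def collide (σ : Bool) (M b : ℕ) (A : QueryAlg n (List (Fin n × Point n)))
    (B : QueryAlg n (Option (Fin n × Point n))) : QueryAlg n (Answer n) :=
  (QueryAlg.replicate M A).bind fun l₁ => (QueryAlg.replicate b B).bind fun l₂ =>
    output (matchEdges σ l₁ l₂)

lemma queries_collide_le (σ : Bool) (M b : ℕ) (A : QueryAlg n (List (Fin n × Point n)))
    (B : QueryAlg n (Option (Fin n × Point n))) :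
    (collide σ M b A B).queries ≤ M * A.queries + b * B.queries :=
  queries_bind_le (queries_replicate_le M A) fun l₁ => by
    have := queries_bind_le (queries_replicate_le b B) (b := 0) (g := fun l₂ =>
      output (matchEdges σ l₁ l₂)) fun _ => le_rfl
    simpa using this

variable (f : Point n → Bool)

lemma isEdgeViolation_matchEdges {σ : Bool} {l₁ : List (List (Fin n × Point n))}
    {l₂ : List (Option (Fin n × Point n))} (h₁ : ∀ F ∈ l₁, ∀ e ∈ F, HasEdge f σ e.1 e.2)
    (h₂ : ∀ X ∈ l₂, ∀ e ∈ X, HasEdge f (!σ) e.1 e.2)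
    (h : ∃ p : (Fin n × Point n) × (Fin n × Point n),
      (∃ F ∈ l₁, p.1 ∈ F) ∧ some p.2 ∈ l₂ ∧ p.1.1 = p.2.1) :
    IsEdgeViolation f (matchEdges σ l₁ l₂) := by
  rw [matchEdges, dif_pos h]
  obtain ⟨⟨F, hF, h3⟩, h4, h5⟩ := h.choose_spec
  generalize h.choose = p at *
  have e1 := h₁ F hF _ h3
  have e2 := h₂ _ h4 _ rfl
  rw [← h5] at e2
  cases σ
  · exact ⟨_, _, _, rfl, (hasEdge_true f).1 e2, (hasEdge_false f).1 e1⟩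
  · exact ⟨_, _, _, rfl, (hasEdge_true f).1 e1, (hasEdge_false f).1 e2⟩

/-- A second moment bound for the probability of a collision. The runs of `A` find an edge along
each variable of `G` with probability at least `α`, and those of `B` with probability at least `w`;
the number of collisions along the variables of `G` is counted with weights which reduce these
probabilities to exactly `α` and `w`. The free parameter `t` makes the bound linear in the
moments, so that it can be averaged over `G`. -/
lemma le_success_collide {σ : Bool} {A : QueryAlg n (List (Fin n × Point n))}
    {B : QueryAlg n (Option (Fin n × Point n))} {K : ℕ}
    (hA : A.Always f fun F => F.length ≤ K ∧ ∀ e ∈ F, HasEdge f σ e.1 e.2)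
    (hB : B.Always f fun X => ∀ e ∈ X, HasEdge f (!σ) e.1 e.2)
    {G : Finset (Fin n)} {α w : ℝ} (hα : 0 < α) (hw : 0 < w)
    (hαG : ∀ i ∈ G, α ≤ A.ev f fun F => ind (∃ e ∈ F, e.1 = i))
    (hwG : ∀ i ∈ G, w ≤ B.ev f fun X => ind (∃ e ∈ X, e.1 = i))
    {M b : ℕ} (hM : M * α ≤ 2) (hb : b * K * w ≤ 2) (t : ℝ) :
    2 * t * (M * b * α * w * G.card) -
        t ^ 2 * ((M * b * α * w * G.card) ^ 2 + 5 * (M * b * α * w * G.card)) ≤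
      (collide σ M b A B).success f := by
  classical
  set c : Fin n → List (Fin n × Point n) → ℝ := fun i F => ind (∃ e ∈ F, e.1 = i) with hc
  set d : Fin n → Option (Fin n × Point n) → ℝ := fun i X => ind (∃ e ∈ X, e.1 = i) with hd
  set a : Fin n → ℝ := fun i => A.ev f (c i) with ha
  set v : Fin n → ℝ := fun i => B.ev f (d i) with hv
  set ω : Fin n → ℝ := fun i => (α / a i) * (w / v i) with hω
  have ha0 : ∀ i ∈ G, 0 < a i := fun i hi => hα.trans_le (hαG i hi)
  have hv0 : ∀ i ∈ G, 0 < v i := fun i hi => hw.trans_le (hwG i hi)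
  have hαa : ∀ i ∈ G, α / a i ≤ 1 := fun i hi => (div_le_one (ha0 i hi)).2 (hαG i hi)
  have hwv : ∀ i ∈ G, w / v i ≤ 1 := fun i hi => (div_le_one (hv0 i hi)).2 (hwG i hi)
  have hαa0 : ∀ i ∈ G, 0 ≤ α / a i := fun i hi => (div_pos hα (ha0 i hi)).le
  have hwv0 : ∀ i ∈ G, 0 ≤ w / v i := fun i hi => (div_pos hw (hv0 i hi)).le
  have hω0 : ∀ i ∈ G, 0 ≤ ω i := fun i hi => mul_nonneg (hαa0 i hi) (hwv0 i hi)
  have hω1 : ∀ i ∈ G, ω i ≤ 1 := fun i hi => mul_le_one₀ (hαa i hi) (hwv0 i hi) (hwv i hi)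
  have hωv : ∀ i ∈ G, ω i * v i = α / a i * w := fun i hi => by
    simp only [hω]; rw [mul_assoc, div_mul_cancel₀ _ (hv0 i hi).ne']
  have hωva : ∀ i ∈ G, ω i * v i * a i = α * w := fun i hi => by
    rw [hωv i hi, mul_right_comm, div_mul_cancel₀ _ (ha0 i hi).ne']
  have hωv1 : ∀ i ∈ G, ω i * v i ≤ w := fun i hi => by
    rw [hωv i hi]; exact mul_le_of_le_one_left hw.le (hαa i hi)
  have hωa1 : ∀ i ∈ G, ω i * a i ≤ α := fun i hi => by
    simp only [hω]
    rw [mul_right_comm, div_mul_cancel₀ _ (ha0 i hi).ne']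
    exact mul_le_of_le_one_right hα.le (hwv i hi)
  set N : Fin n → List (List (Fin n × Point n)) → ℝ := fun i l => (l.map (c i)).sum with hN
  set φ : List (List (Fin n × Point n)) → Option (Fin n × Point n) → ℝ :=
    fun l X => ∑ i ∈ G, ω i * N i l * d i X with hφ
  set Z : List (List (Fin n × Point n)) → List (Option (Fin n × Point n)) → ℝ :=
    fun l₁ l₂ => (l₂.map (φ l₁)).sum with hZ
  set h : List (Fin n × Point n) → ℝ := fun F => ∑ i ∈ G, ω i * v i * c i F with hh
  -- a positive number of collisions gives a violation
  have h1 : ∀ l₁ l₂, (∀ F ∈ l₁, F.length ≤ K ∧ ∀ e ∈ F, HasEdge f σ e.1 e.2) →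
      (∀ X ∈ l₂, ∀ e ∈ X, HasEdge f (!σ) e.1 e.2) →
      2 * t * Z l₁ l₂ - t ^ 2 * Z l₁ l₂ ^ 2 ≤ ind (IsEdgeViolation f (matchEdges σ l₁ l₂)) := by
    intro l₁ l₂ hl₁ hl₂
    by_cases hz : Z l₁ l₂ = 0
    · rw [hz]; simpa using ind_nonneg _
    · rw [ind_of]
      · nlinarith [sq_nonneg (1 - t * Z l₁ l₂)]
      · apply isEdgeViolation_matchEdges f (fun F hF => (hl₁ F hF).2) hl₂
        have : ∃ X ∈ l₂, φ l₁ X ≠ 0 := by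
          by_contra hcon
          push Not at hcon
          exact hz (List.sum_eq_zero fun y hy => by
            obtain ⟨X, hX, rfl⟩ := List.mem_map.1 hy
            exact hcon X hX)
        obtain ⟨X, hX, hX0⟩ := this
        obtain ⟨i, hi, hi0⟩ := exists_ne_zero_of_sum_ne_zero hX0
        have hd0 : d i X ≠ 0 := right_ne_zero_of_mul hi0
        have hN0 : N i l₁ ≠ 0 := right_ne_zero_of_mul (left_ne_zero_of_mul hi0)
        have : ∃ F ∈ l₁, c i F ≠ 0 := by
          by_contra hcon
          push Not at hcon
          exact hN0 (List.sum_eq_zero fun y hy => by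
            obtain ⟨F, hF, rfl⟩ := List.mem_map.1 hy
            exact hcon F hF)
        obtain ⟨F, hF, hF0⟩ := this
        obtain ⟨e₁, he₁, rfl⟩ : ∃ e ∈ F, e.1 = i := by
          by_contra hcon; exact hF0 (ind_of_not hcon)
        obtain ⟨e₂, he₂, h2⟩ : ∃ e ∈ X, e.1 = e₁.1 := by
          by_contra hcon; exact hd0 (ind_of_not hcon)
        obtain rfl : X = some e₂ := by simpa using he₂
        exact ⟨(e₁, e₂), ⟨F, hF, he₁⟩, hX, h2.symm⟩
  -- the moments over the second sample
  have hvφ : ∀ l₁, B.ev f (φ l₁) = ∑ i ∈ G, ω i * N i l₁ * v i := by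
    intro l₁
    simp only [hφ, ev_sum, ev_mul_left, hv]
  have hdd : ∀ i j X, i ≠ j → d i X * d j X = 0 := by
    intro i j X hij
    by_contra hcon
    obtain ⟨e₁, he₁, rfl⟩ : ∃ e ∈ X, e.1 = i := by
      by_contra h'; exact hcon (by simp only [hd, ind_of_not h', zero_mul])
    obtain ⟨e₂, he₂, rfl⟩ : ∃ e ∈ X, e.1 = j := by
      by_contra h'; exact hcon (by simp only [hd, ind_of_not h', mul_zero])
    rw [Option.mem_unique he₁ he₂] at hij
    exact hij rfl
  have hvφ2 : ∀ l₁, B.ev f (fun X => φ l₁ X ^ 2) = ∑ i ∈ G, ω i ^ 2 * N i l₁ ^ 2 * v i := by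
    intro l₁
    have e : ∀ X, φ l₁ X ^ 2 = ∑ i ∈ G, ω i ^ 2 * N i l₁ ^ 2 * d i X := by
      intro X
      rw [hφ, sq, sum_mul_sum]
      refine sum_congr rfl fun i hi => ?_
      rw [sum_eq_single_of_mem i hi]
      · have := ind_mul_self (∃ e ∈ X, e.1 = i)
        linear_combination (ω i ^ 2 * N i l₁ ^ 2) * this
      · intro j _ hij
        linear_combination (ω i * N i l₁ * (ω j * N j l₁)) * hdd i j X hij.symm
    simp only [e, ev_sum, ev_mul_left, hv]
  have hHN : ∀ l₁ : List (List (Fin n × Point n)),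
      ∑ i ∈ G, ω i * N i l₁ * v i = (l₁.map h).sum := by
    intro l₁
    induction l₁ with
    | nil => simp [hN]
    | cons F l ih =>
      rw [List.map_cons, List.sum_cons, ← ih, hh, ← sum_add_distrib]
      refine sum_congr rfl fun i _ => ?_
      simp only [hN, List.map_cons, List.sum_cons]
      ring
  have hev2 : ∀ l₁, 2 * t * (b * (l₁.map h).sum) - t ^ 2 * (b * ∑ i ∈ G, ω i ^ 2 * v i * N i l₁ ^ 2
      + b ^ 2 * (l₁.map h).sum ^ 2) ≤
      (QueryAlg.replicate b B).ev f (fun l₂ => 2 * t * Z l₁ l₂ - t ^ 2 * Z l₁ l₂ ^ 2) := by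
    intro l₁
    rw [ev_sub, ev_mul_left, ev_mul_left, hZ, ev_replicate_sum, hvφ, hHN]
    have h2 := ev_replicate_sum_sq_le f b (φ l₁) B
    rw [hvφ2, hvφ, hHN] at h2
    have h3 : ∑ i ∈ G, ω i ^ 2 * N i l₁ ^ 2 * v i = ∑ i ∈ G, ω i ^ 2 * v i * N i l₁ ^ 2 :=
      sum_congr rfl fun i _ => by ring
    rw [h3] at h2
    have := mul_le_mul_of_nonneg_left h2 (sq_nonneg t)
    linarith
  -- the moments over the first sample
  have hEh : A.ev f h = α * w * G.card := by
    simp only [hh, ev_sum, ev_mul_left]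
    rw [sum_congr rfl hωva, sum_const, nsmul_eq_mul, mul_comm]
  have hh0 : ∀ F, 0 ≤ h F := fun F => sum_nonneg fun i hi =>
    mul_nonneg (mul_nonneg (hω0 i hi) (hv0 i hi).le) (ind_nonneg _)
  have hhK : ∀ F : List (Fin n × Point n), F.length ≤ K → h F ≤ K * w := by
    intro F hF
    have h2 : ∑ i ∈ G, c i F ≤ K := by
      simp only [hc]
      rw [sum_ind]
      have : (G.filter fun i => ∃ e ∈ F, e.1 = i) ⊆ (F.map Prod.fst).toFinset := by
        intro i hi
        simpa using (mem_filter.1 hi).2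
      have h4 := (card_le_card this).trans (List.toFinset_card_le _)
      rw [List.length_map] at h4
      exact_mod_cast h4.trans hF
    calc h F ≤ ∑ i ∈ G, w * c i F :=
          sum_le_sum fun i hi => mul_le_mul_of_nonneg_right (hωv1 i hi) (ind_nonneg _)
      _ = w * ∑ i ∈ G, c i F := by rw [mul_sum]
      _ ≤ w * K := by gcongr
      _ = K * w := mul_comm _ _
  have hEh2 : A.ev f (fun F => h F ^ 2) ≤ K * w * (α * w * G.card) := by
    rw [← hEh, ← ev_mul_left]
    refine ev_le_of_always f A hA fun F hF => ?_
    rw [sq]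
    exact mul_le_mul_of_nonneg_right (hhK F hF.1) (hh0 F)
  have hEH2 : (QueryAlg.replicate M A).ev f (fun l => (l.map h).sum ^ 2) ≤
      M * (K * w * (α * w * G.card)) + M ^ 2 * (α * w * G.card) ^ 2 := by
    refine (ev_replicate_sum_sq_le f M h A).trans ?_
    rw [hEh]
    gcongr
  have hEN2 : ∀ i ∈ G, ω i ^ 2 * v i * (QueryAlg.replicate M A).ev f (fun l => N i l ^ 2) ≤
      α * w * (M + M ^ 2 * α) := by
    intro i hi
    have h2 := ev_replicate_sum_sq_le f M (c i) A
    have h3 : A.ev f (fun F => c i F ^ 2) = a i := by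
      simp only [ha]
      congr 1
      funext F
      rw [sq]
      exact ind_mul_self _
    rw [h3] at h2
    have h5 := hω0 i hi
    have h6 := (hv0 i hi).le
    have h7 := (ha0 i hi).le
    have h8 := hωva i hi
    calc ω i ^ 2 * v i * (QueryAlg.replicate M A).ev f (fun l => N i l ^ 2)
        ≤ ω i ^ 2 * v i * (M * a i + M ^ 2 * a i ^ 2) := by gcongr
      _ = (ω i * v i * a i) * (M * ω i + M ^ 2 * (ω i * a i)) := by ring
      _ ≤ (α * w) * (M * 1 + M ^ 2 * α) := by
          rw [h8]
          gcongr
          · exact hω1 i hi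
          · exact hωa1 i hi
      _ = _ := by ring
  have hfin : 2 * t * (M * b * α * w * G.card) -
      t ^ 2 * (b * (G.card * (α * w * (M + M ^ 2 * α))) +
        b ^ 2 * (M * (K * w * (α * w * G.card)) + M ^ 2 * (α * w * G.card) ^ 2)) ≤
      (collide σ M b A B).success f := by
    have h2 : (QueryAlg.replicate M A).ev f (fun l₁ =>
        2 * t * (b * (l₁.map h).sum) - t ^ 2 * (b * ∑ i ∈ G, ω i ^ 2 * v i * N i l₁ ^ 2
          + b ^ 2 * (l₁.map h).sum ^ 2)) ≤ (collide σ M b A B).success f := by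
      rw [success, collide, ev_bind]
      simp only [ev_bind, ev_output]
      refine ev_le_of_always f _ (hA.replicate f M) fun l₁ hl₁ => (hev2 l₁).trans ?_
      exact ev_le_of_always f _ (hB.replicate f b) fun l₂ hl₂ => h1 l₁ l₂ hl₁.2 hl₂.2
    refine le_trans ?_ h2
    simp only [ev_sub, ev_mul_left, ev_add, ev_sum, ev_replicate_sum, hEh]
    have h3 : ∑ i ∈ G, ω i ^ 2 * v i * (QueryAlg.replicate M A).ev f (fun l => N i l ^ 2) ≤
        G.card * (α * w * (M + M ^ 2 * α)) := by
      refine (sum_le_sum hEN2).trans (le_of_eq ?_)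
      rw [sum_const, nsmul_eq_mul]
    have h4 : (b : ℝ) * ∑ i ∈ G, ω i ^ 2 * v i * (QueryAlg.replicate M A).ev f
        (fun l => N i l ^ 2) + b ^ 2 * (QueryAlg.replicate M A).ev f (fun l => (l.map h).sum ^ 2) ≤
        b * (G.card * (α * w * (M + M ^ 2 * α))) +
        b ^ 2 * (M * (K * w * (α * w * G.card)) + M ^ 2 * (α * w * G.card) ^ 2) := by
      gcongr
    have h5 := mul_le_mul_of_nonneg_left h4 (sq_nonneg t)
    linarith
  refine le_trans ?_ hfin
  have hy : 0 ≤ M * b * α * w * G.card := by positivity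
  have h6 : (b : ℝ) * (G.card * (α * w * (M + M ^ 2 * α))) +
        b ^ 2 * (M * (K * w * (α * w * G.card)) + M ^ 2 * (α * w * G.card) ^ 2) =
      (M * b * α * w * G.card) * (1 + M * α + b * K * w) + (M * b * α * w * G.card) ^ 2 := by ring
  rw [h6]
  have h7 : (M * b * α * w * G.card) * (1 + M * α + b * K * w) ≤
      5 * (M * b * α * w * G.card) := by nlinarith
  have h8 := mul_le_mul_of_nonneg_left h7 (sq_nonneg t)
  linarith

end Collision

/-! ### Finding bichromatic edges of influential variables -/

section EdgeGroup

/-- Draw up to `g` random points, and return the first one that passes the test `pos`. -/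
noncomputable def firstPos (pos : Point n → QueryAlg n Bool) : ℕ → QueryAlg n (Option (Point n))
  | 0 => output none
  | g + 1 => (pick univ).bind fun x => (pos x).bind fun b =>
      if b then output (some x) else firstPos pos g

/-- Test whether `f` changes when a random `k`-subset or a random `k - 1`-subset of `S` is
flipped at `x`. -/
noncomputable def loudTest (S : Finset (Fin n)) (k : ℕ) (x : Point n) : QueryAlg n Bool :=
  (pick (S.powersetCard k)).bind fun R => (pick (S.powersetCard (k - 1))).bind fun R' =>
    query x fun b => query (flip x R) fun c => query (flip x R') fun c' =>
      output (decide (c ≠ b ∨ c' ≠ b))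

/-- The test for starting points at scale `a`: points at which flips of about `2 ^ a` variables
matter, and all points at the top scale `A`. -/
noncomputable def startTest (S : Finset (Fin n)) (A a : ℕ) (x : Point n) : QueryAlg n Bool :=
  if a = A then output true else loudTest S (2 ^ a) x

/-- Search for an edge at `x` along one of the variables of a random `r`-subset of `S`. -/
noncomputable def randSearch (σ : Bool) (q : ℕ) (S : Finset (Fin n)) (r : ℕ) (x : Point n) :
    QueryAlg n (Option (Fin n × Point n)) :=
  (pick (S.powersetCard r)).bind fun R => search σ q x R

/-- Find a starting point at scale `a` with `2 ^ (A - a)` attempts, and search for edges at this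
point along the variables of `2 ^ (A - a)` random `2 ^ a`-subsets of `S`. -/
noncomputable def edgeGroup (σ : Bool) (q : ℕ) (S : Finset (Fin n)) (A a : ℕ) :
    QueryAlg n (List (Fin n × Point n)) :=
  (firstPos (startTest S A a) (2 ^ (A - a))).bind fun o =>
    match o with
    | none => output []
    | some x => (QueryAlg.replicate (2 ^ (A - a)) (randSearch σ q S (2 ^ a) x)).bind fun l =>
        output l.reduceOption

lemma queries_firstPos_le {pos : Point n → QueryAlg n Bool} {B : ℕ}
    (h : ∀ x, (pos x).queries ≤ B) (g : ℕ) : (firstPos pos g).queries ≤ g * B := by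
  induction g with
  | zero => simp [firstPos]
  | succ g ih =>
    rw [firstPos, Nat.succ_mul, add_comm, ← Nat.zero_add (B + _)]
    refine queries_bind_le (queries_pick _).le fun x => queries_bind_le (h x) fun b => ?_
    split_ifs
    · simp
    · exact ih

lemma queries_startTest_le (S : Finset (Fin n)) (A a : ℕ) (x : Point n) :
    (startTest S A a x).queries ≤ 3 := by
  unfold startTest
  split_ifs
  · simp
  · rw [loudTest, ← Nat.zero_add 3]
    refine queries_bind_le (queries_pick _).le fun R => ?_
    rw [← Nat.zero_add 3]
    exact queries_bind_le (queries_pick _).le fun R' => queries_query_le fun b =>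
      queries_query_le (B := 1) fun c => queries_query_le (B := 0) fun c' => by simp

lemma queries_randSearch_le (σ : Bool) (q : ℕ) (S : Finset (Fin n)) (r : ℕ) (x : Point n) :
    (randSearch σ q S r x).queries ≤ q + 2 := by
  rw [randSearch, ← Nat.zero_add (q + 2)]
  exact queries_bind_le (queries_pick _).le fun R => queries_search_le ..

lemma queries_edgeGroup_le (σ : Bool) (q : ℕ) (S : Finset (Fin n)) (A a : ℕ) :
    (edgeGroup σ q S A a).queries ≤ 2 ^ (A - a) * (q + 5) := by
  have : 2 ^ (A - a) * (q + 5) = 2 ^ (A - a) * 3 + (2 ^ (A - a) * (q + 2) + 0) := by ring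
  rw [this]
  refine queries_bind_le (queries_firstPos_le (queries_startTest_le S A a) _) fun o => ?_
  rcases o with _ | x
  · simp
  · refine queries_bind_le ((queries_replicate_le _ _).trans ?_) fun l => le_rfl
    exact Nat.mul_le_mul_left _ (queries_randSearch_le ..)

variable (f : Point n → Bool)

lemma always_edgeGroup (σ : Bool) (q : ℕ) (S : Finset (Fin n)) (A a : ℕ) :
    (edgeGroup σ q S A a).Always f fun F =>
      F.length ≤ 2 ^ (A - a) ∧ ∀ e ∈ F, HasEdge f σ e.1 e.2 := by
  refine (always_true f _).bind f fun o _ => ?_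
  rcases o with _ | x
  · simp [Always]
  · have h : (randSearch σ q S (2 ^ a) x).Always f fun o => ∀ e ∈ o, HasEdge f σ e.1 e.2 :=
      (always_true f _).bind f fun R _ => always_search f σ q x R
    refine (h.replicate f _).bind f fun l hl => ?_
    refine ⟨(List.reduceOption_length_le l).trans hl.1.le, fun e he => ?_⟩
    exact hl.2 _ (List.reduceOption_mem_iff.1 he) e rfl

lemma le_ev_firstPos {pos : Point n → QueryAlg n Bool} {φ : Point n → ℝ} (hφ : ∀ x, 0 ≤ φ x)
    (g : ℕ) :
    g * (𝔼 x, (pos x).ev f (fun b => ind (b = true)) * φ x) *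
        (1 - (g - 1) * 𝔼 x, (pos x).ev f fun b => ind (b = true)) ≤
      (firstPos pos g).ev f fun o => o.elim 0 φ := by
  set π : Point n → ℝ := fun x => (pos x).ev f fun b => ind (b = true) with hπ
  have hπ0 : ∀ x, 0 ≤ π x := fun x => ev_nonneg f _ fun _ => ind_nonneg _
  have hπ1 : ∀ x, π x ≤ 1 := fun x => ev_le_one f _ fun _ => ind_le_one _
  change g * (𝔼 x, π x * φ x) * (1 - (g - 1) * 𝔼 x, π x) ≤ _
  set e := 𝔼 x, π x * φ x
  set p := 𝔼 x, π x
  have he : 0 ≤ e := expect_nonneg fun x _ => mul_nonneg (hπ0 x) (hφ x)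
  have hp : 0 ≤ p := expect_nonneg fun x _ => hπ0 x
  have hp1 : p ≤ 1 := expect_le univ_nonempty fun x _ => hπ1 x
  induction g with
  | zero => simp [firstPos]
  | succ g ih =>
    set v := (firstPos pos g).ev f fun o => o.elim 0 φ
    have h1 : (firstPos pos (g + 1)).ev f (fun o => o.elim 0 φ) = e + (1 - p) * v := by
      rw [firstPos, ev_bind, ev_pick f univ_nonempty]
      have h2 : ∀ x, ((pos x).bind fun b => if b = true then output (some x)
          else firstPos pos g).ev f (fun o => o.elim 0 φ) = π x * φ x + (v - v * π x) := by
        intro x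
        rw [ev_bind]
        have h3 : ∀ b : Bool, (if b = true then output (some x)
            else firstPos pos g).ev f (fun o => o.elim 0 φ) = (φ x - v) * ind (b = true) + v := by
          intro b
          cases b
          · simp [ind, v]
          · simp [ind]
        simp only [h3, ev_add, ev_mul_left, ev_const]
        simp only [hπ]
        ring
      simp only [h2]
      rw [expect_add_distrib, expect_sub_distrib, expect_const univ_nonempty, ← mul_expect]
      change e + (v - v * p) = _
      ring
    rw [h1]
    have h2 := mul_le_mul_of_nonneg_left ih (by linarith : 0 ≤ 1 - p)
    refine le_trans ?_ (add_le_add_right h2 e)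
    push_cast
    rcases Nat.eq_zero_or_pos g with rfl | hg
    · simp
    · have hg' : (1 : ℝ) ≤ g := by exact_mod_cast hg
      have h3 : 0 ≤ g * e * (g - 1) * p ^ 2 := by
        have : 0 ≤ (g : ℝ) - 1 := by linarith
        positivity
      nlinarith [mul_nonneg (mul_nonneg (by linarith : (0 : ℝ) ≤ g) he) hp]

/-- Flips of `2 ^ a` or `2 ^ a - 1` random variables in `Q` change the value at `x` with
probability larger than `η`. -/
def Loud (Q : Finset (Fin n)) (η : ℝ) (a : ℕ) (x : Point n) : Prop :=
  η < noise f Q (2 ^ a) x ∨ η < noise f Q (2 ^ a - 1) x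

/-- The search with subsets of size `2 ^ a` is not disturbed at the edge along `i` at `x`: the
relevant flips, which are of half of this size, are not loud at either endpoint. -/
def Calm (Q : Finset (Fin n)) (i : Fin n) (η : ℝ) : ℕ → Point n → Prop
  | 0, _ => True
  | a + 1, x => ¬Loud f Q η a x ∧ ¬Loud f Q η a (flip x {i})

/-- The points from which the search at scale `a` is started. -/
def IsStart (Q : Finset (Fin n)) (η : ℝ) (A a : ℕ) (x : Point n) : Prop :=
  a = A ∨ Loud f Q η a x

/-- Every edge has a scale at which it is calm, but too loud for the next scale at one of its
endpoints, unless it is the top scale. -/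
lemma exists_calm (Q : Finset (Fin n)) (i : Fin n) (η : ℝ) (A : ℕ) (x : Point n) :
    ∃ a ≤ A, Calm f Q i η a x ∧ (IsStart f Q η A a x ∨ IsStart f Q η A a (flip x {i})) := by
  induction A with
  | zero => exact ⟨0, le_rfl, trivial, Or.inl (Or.inl rfl)⟩
  | succ A ih =>
    by_cases h : Calm f Q i η (A + 1) x
    · exact ⟨A + 1, le_rfl, h, Or.inl (Or.inl rfl)⟩
    · obtain ⟨a, ha, h1, h2⟩ := ih
      refine ⟨a, by omega, h1, ?_⟩
      rcases eq_or_ne a A with rfl | hne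
      · by_contra hcon
        simp only [not_or, IsStart] at hcon
        exact h ⟨hcon.1.2, hcon.2.2⟩
      · exact h2.imp (fun h3 => Or.inr (h3.resolve_left hne))
          (fun h3 => Or.inr (h3.resolve_left hne))

lemma calm_flip {Q : Finset (Fin n)} {i : Fin n} {η : ℝ} {a : ℕ} {x : Point n} :
    Calm f Q i η a (flip x {i}) ↔ Calm f Q i η a x := by
  cases a with
  | zero => rfl
  | succ a => simp only [Calm, flip_flip]; exact and_comm

lemma exists_scale (σ : Bool) (Q : Finset (Fin n)) (i : Fin n) (η : ℝ) (A : ℕ) :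
    ∃ a ≤ A, dirInf f σ i / (2 * (A + 1)) ≤
      𝔼 x, ind (HasEdge f σ i x ∧ Calm f Q i η a x ∧ IsStart f Q η A a x) := by
  set e : ℕ → ℝ := fun a =>
    𝔼 x, ind (HasEdge f σ i x ∧ Calm f Q i η a x ∧ IsStart f Q η A a x) with he
  have h1 : dirInf f σ i ≤ ∑ a ∈ range (A + 1), 2 * e a := by
    have h2 : ∀ a, 2 * e a = 𝔼 x, (ind (HasEdge f σ i x ∧ Calm f Q i η a x ∧ IsStart f Q η A a x) +
        ind (HasEdge f σ i x ∧ Calm f Q i η a x ∧ IsStart f Q η A a (flip x {i}))) := by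
      intro a
      rw [expect_add_distrib, two_mul]
      congr 1
      rw [he, ← expect_flip {i}]
      refine expect_congr rfl fun x _ => ind_congr ?_
      rw [hasEdge_flip, calm_flip, flip_flip]
    simp only [h2]
    rw [← expect_sum_comm, dirInf]
    refine expect_le_expect fun x _ => ?_
    by_cases hx : HasEdge f σ i x
    · obtain ⟨a, ha, h3, h4⟩ := exists_calm f Q i η A x
      refine le_trans ?_ (single_le_sum (f := fun a => _ + _)
        (fun a _ => add_nonneg (ind_nonneg _) (ind_nonneg _))
        (mem_range.2 (Nat.lt_succ_of_le ha)))
      refine (ind_mono fun _ => ?_).trans (ind_or_le _ _)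
      exact h4.imp (fun h => ⟨hx, h3, h⟩) (fun h => ⟨hx, h3, h⟩)
    · rw [ind_of_not hx]
      exact sum_nonneg fun a _ => add_nonneg (ind_nonneg _) (ind_nonneg _)
  by_contra hcon
  push Not at hcon
  have h2 : ∑ a ∈ range (A + 1), 2 * e a <
      ∑ a ∈ range (A + 1), 2 * (dirInf f σ i / (2 * (A + 1))) :=
    sum_lt_sum_of_nonempty (by simp) fun a ha =>
      mul_lt_mul_of_pos_left (hcon a (Nat.lt_succ_iff.1 (mem_range.1 ha))) two_pos
  rw [sum_const, card_range, nsmul_eq_mul] at h2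
  have h3 : ((A + 1 : ℕ) : ℝ) * (2 * (dirInf f σ i / (2 * (A + 1)))) = dirInf f σ i := by
    push_cast
    field_simp
  linarith

lemma le_ev_randSearch {σ : Bool} {q : ℕ} {S : Finset (Fin n)} {i : Fin n} {a : ℕ} {x : Point n}
    {η : ℝ} (hi : i ∈ S) (ha : 2 ^ a ≤ S.card) (hx : HasEdge f σ i x)
    (hc : Calm f (S.erase i) i η a x) (hη : q * (2 * η) ≤ 1 / 4) (hη0 : 0 ≤ η)
    (hq : (2 : ℝ) ^ a / 2 ^ q ≤ 1 / 4) :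
    2 ^ a / (2 * S.card) ≤
      (randSearch σ q S (2 ^ a) x).ev f fun o => ind (∃ e ∈ o, e.1 = i) := by
  obtain ⟨m, hm⟩ : ∃ m, 2 ^ a = m + 1 := ⟨2 ^ a - 1, by have := Nat.one_le_two_pow (n := a); omega⟩
  have hmR : (2 : ℝ) ^ a = m + 1 := by exact_mod_cast hm
  rw [randSearch, ev_bind, ev_pick f (powersetCard_nonempty.2 ha)]
  have h1 : ∀ R ∈ S.powersetCard (2 ^ a), ind (i ∈ R) *
      (1 - q * (noise f (R.erase i) (m / 2 + 1) x + noise f (R.erase i) (m / 2) (flip x {i})) -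
        (m : ℝ) / 2 ^ q) ≤ (search σ q x R).ev f fun o => ind (∃ e ∈ o, e.1 = i) := by
    intro R hR
    by_cases hiR : i ∈ R
    · rw [ind_of hiR, one_mul]
      exact le_ev_search f hiR (by rw [(mem_powersetCard.1 hR).2, hm]) hx q
    · rw [ind_of_not hiR, zero_mul]
      exact ev_nonneg f _ fun _ => ind_nonneg _
  refine le_trans ?_ (expect_le_expect h1)
  have hcard : (S.erase i).card = S.card - 1 := card_erase_of_mem hi
  have hne : ((S.erase i).powersetCard m).Nonempty := powersetCard_nonempty.2 (by omega)
  rw [hm, expect_ind_mem_mul hi (by omega)]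
  have h2 : ∀ Q ∈ (S.erase i).powersetCard m,
      1 - q * (noise f ((insert i Q).erase i) (m / 2 + 1) x +
        noise f ((insert i Q).erase i) (m / 2) (flip x {i})) - (m : ℝ) / 2 ^ q =
      (1 - (m : ℝ) / 2 ^ q) -
        q * (noise f Q (m / 2 + 1) x + noise f Q (m / 2) (flip x {i})) := by
    intro Q hQ
    rw [erase_insert fun h => notMem_erase i S ((mem_powersetCard.1 hQ).1 h)]
    ring
  rw [expect_congr rfl h2, expect_sub_distrib, expect_const hne, ← mul_expect, expect_add_distrib]
  have h3 : 𝔼 Q ∈ (S.erase i).powersetCard m, noise f Q (m / 2 + 1) x ≤ η ∧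
      𝔼 Q ∈ (S.erase i).powersetCard m, noise f Q (m / 2) (flip x {i}) ≤ η := by
    cases a with
    | zero =>
      obtain rfl : m = 0 := by simpa using hm.symm
      have e0 : powersetCard 1 (∅ : Finset (Fin n)) = ∅ := rfl
      simp [noise, ind, e0, hη0]
    | succ a =>
      have hpos := Nat.one_le_two_pow (n := a)
      have e1 : m / 2 + 1 = 2 ^ a := by rw [pow_succ] at hm; omega
      have e2 : m / 2 = 2 ^ a - 1 := by omega
      simp only [Calm, Loud, not_or, not_lt] at hc
      constructor
      · rw [show (𝔼 Q ∈ (S.erase i).powersetCard m, noise f Q (m / 2 + 1) x) =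
          noise f (S.erase i) (m / 2 + 1) x from
          expect_powersetCard_powersetCard (by rw [pow_succ] at hm; omega) (by omega) _, e1]
        exact hc.1.1
      · rw [show (𝔼 Q ∈ (S.erase i).powersetCard m, noise f Q (m / 2) (flip x {i})) =
          noise f (S.erase i) (m / 2) (flip x {i}) from
          expect_powersetCard_powersetCard (by omega) (by omega) _, e2]
        exact hc.2.2
  have h4 : (m : ℝ) / 2 ^ q ≤ 1 / 4 := by
    refine le_trans ?_ hq
    gcongr
    linarith
  have h5 : (q : ℝ) * (𝔼 Q ∈ (S.erase i).powersetCard m, noise f Q (m / 2 + 1) x +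
      𝔼 Q ∈ (S.erase i).powersetCard m, noise f Q (m / 2) (flip x {i})) ≤ 1 / 4 := by
    refine le_trans ?_ hη
    gcongr
    linarith
  rw [hmR, mul_comm (2 : ℝ), ← div_div, div_eq_mul_one_div _ (2 : ℝ)]
  gcongr
  linarith

lemma le_one_sub_one_sub_pow {s : ℝ} {K : ℕ} (hs : 0 ≤ s) (hs1 : s ≤ 1) (hK : K * s ≤ 1) :
    K * s / 2 ≤ 1 - (1 - s) ^ K := by
  have h1 : 1 + K * s ≤ (1 + s) ^ K := one_add_mul_le_pow (by linarith) K
  have h2 : (1 - s) ^ K * (1 + s) ^ K ≤ 1 := by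
    rw [← mul_pow]
    exact pow_le_one₀ (by nlinarith) (by nlinarith)
  have h3 : 0 ≤ (1 - s) ^ K := pow_nonneg (by linarith) K
  have h4 : (1 - s) ^ K * (1 + K * s) ≤ 1 := (mul_le_mul_of_nonneg_left h1 h3).trans h2
  have h5 : 0 ≤ K * s := by positivity
  by_contra hcon
  push Not at hcon
  nlinarith

lemma le_ev_startTest {S : Finset (Fin n)} {i : Fin n} {η : ℝ} {A a : ℕ} (hi : i ∈ S)
    (haA : a ≤ A) (hA : 2 ^ A ≤ S.card) (hη1 : η ≤ 1) {x : Point n}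
    (hx : IsStart f (S.erase i) η A a x) :
    η / 2 ≤ (startTest S A a x).ev f fun b => ind (b = true) := by
  unfold startTest
  split_ifs with h
  · rw [ev_output, ind_of rfl]; linarith
  · have h2 : 2 * 2 ^ a ≤ S.card := by
      rw [← pow_succ']
      exact (Nat.pow_le_pow_right two_pos (by omega : a + 1 ≤ A)).trans hA
    have hne : (S.powersetCard (2 ^ a)).Nonempty := powersetCard_nonempty.2 (by omega)
    have hne' : (S.powersetCard (2 ^ a - 1)).Nonempty := powersetCard_nonempty.2 (by omega)
    rw [loudTest, ev_bind, ev_pick f hne]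
    simp only [ev_bind, ev_pick f hne', ev_query, ev_output, decide_eq_true_eq]
    rcases hx.resolve_left h with h3 | h3
    · have h4 := noise_erase_le f hi h2 x
      have h5 : noise f S (2 ^ a) x ≤ 𝔼 R ∈ S.powersetCard (2 ^ a),
          𝔼 R' ∈ S.powersetCard (2 ^ a - 1),
            ind (f (flip x R) ≠ f x ∨ f (flip x R') ≠ f x) :=
        expect_le_expect fun R _ => le_expect hne' fun R' _ => ind_mono Or.inl
      linarith
    · have h4 := noise_erase_le f hi (by omega : 2 * (2 ^ a - 1) ≤ S.card) x
      have h5 : noise f S (2 ^ a - 1) x ≤ 𝔼 R ∈ S.powersetCard (2 ^ a),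
          𝔼 R' ∈ S.powersetCard (2 ^ a - 1),
            ind (f (flip x R) ≠ f x ∨ f (flip x R') ≠ f x) :=
        le_expect hne fun R _ => expect_le_expect fun R' _ => ind_mono Or.inr
      linarith

lemma expect_ev_startTest_le {S : Finset (Fin n)} {A a : ℕ} (haA : a < A)
    (hA : 2 ^ A ≤ S.card) :
    𝔼 x, (startTest S A a x).ev f (fun b => ind (b = true)) ≤
      2 * (2 ^ a / S.card) * ∑ j ∈ S, influence f j := by
  have h2 : 2 ^ a ≤ S.card := (Nat.pow_le_pow_right two_pos haA.le).trans hA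
  have hne : (S.powersetCard (2 ^ a)).Nonempty := powersetCard_nonempty.2 (by omega)
  have hne' : (S.powersetCard (2 ^ a - 1)).Nonempty := powersetCard_nonempty.2 (by omega)
  have h1 : ∀ x ∈ (univ : Finset (Point n)),
      (startTest S A a x).ev f (fun b => ind (b = true)) ≤
        noise f S (2 ^ a) x + noise f S (2 ^ a - 1) x := by
    intro x _
    rw [startTest, if_neg haA.ne, loudTest, ev_bind, ev_pick f hne]
    simp only [ev_bind, ev_pick f hne', ev_query, ev_output, decide_eq_true_eq]
    calc 𝔼 R ∈ S.powersetCard (2 ^ a), 𝔼 R' ∈ S.powersetCard (2 ^ a - 1),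
            ind (f (flip x R) ≠ f x ∨ f (flip x R') ≠ f x)
        ≤ 𝔼 R ∈ S.powersetCard (2 ^ a), 𝔼 R' ∈ S.powersetCard (2 ^ a - 1),
            (ind (f (flip x R) ≠ f x) + ind (f (flip x R') ≠ f x)) :=
          expect_le_expect fun R _ => expect_le_expect fun R' _ => ind_or_le _ _
      _ = _ := by
          simp only [expect_add_distrib, expect_const hne', expect_const hne]
          rfl
  refine (expect_le_expect h1).trans ?_
  rw [expect_add_distrib]
  have h3 := expect_noise_le f h2
  have h4 := expect_noise_le f (by omega : 2 ^ a - 1 ≤ S.card)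
  have h5 : 0 ≤ ∑ j ∈ S, influence f j := sum_nonneg fun j _ => influence_nonneg f j
  have h6 : ((2 ^ a - 1 : ℕ) : ℝ) ≤ 2 ^ a := by
    have : 2 ^ a - 1 ≤ 2 ^ a := Nat.sub_le _ _
    exact_mod_cast this
  have h7 : ((2 ^ a - 1 : ℕ) / S.card : ℝ) * ∑ j ∈ S, influence f j ≤
      (2 ^ a / S.card : ℝ) * ∑ j ∈ S, influence f j := by gcongr
  push_cast at h3
  linarith

/-- A group finds an edge along `i` with a probability that has an extra factor `2 ^ A` compared
with sampling edges: at scale `a` the search has `2 ^ a` variables at once, and, as starting points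
are rare, `2 ^ (A - a)` searches at each of them cost no more than finding it. -/
lemma le_ev_edgeGroup {σ : Bool} {q : ℕ} {S : Finset (Fin n)} {i : Fin n} {A a : ℕ} {η : ℝ}
    (hi : i ∈ S) (haA : a ≤ A) (hA : 2 ^ A ≤ S.card) (hη0 : 0 ≤ η) (hη1 : η ≤ 1)
    (hη : q * (2 * η) ≤ 1 / 4) (hq : (2 : ℝ) ^ a / 2 ^ q ≤ 1 / 4)
    (hS : A = 0 ∨ 4 * 2 ^ A * ∑ j ∈ S, influence f j ≤ S.card) :
    2 ^ (A - a) * 2 ^ A * η / (16 * S.card) *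
        (𝔼 x, ind (HasEdge f σ i x ∧ Calm f (S.erase i) i η a x ∧
          IsStart f (S.erase i) η A a x)) ≤
      (edgeGroup σ q S A a).ev f fun F => ind (∃ e ∈ F, e.1 = i) := by
  have hS0 : (0 : ℝ) < S.card := by exact_mod_cast card_pos.2 ⟨i, hi⟩
  have hAR : (2 : ℝ) ^ A ≤ S.card := by exact_mod_cast hA
  have hpow : (2 : ℝ) ^ (A - a) * 2 ^ a = 2 ^ A := by rw [← pow_add, Nat.sub_add_cancel haA]
  set K := 2 ^ (A - a) with hK
  have hKR : (K : ℝ) = 2 ^ (A - a) := by rw [hK]; push_cast; rfl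
  set φ : Point n → ℝ := fun x => (QueryAlg.replicate K (randSearch σ q S (2 ^ a) x)).ev f
    fun l => ind (∃ o ∈ l, ∃ e ∈ o, e.1 = i) with hφ
  have hφ0 : ∀ x, 0 ≤ φ x := fun x => ev_nonneg f _ fun _ => ind_nonneg _
  have hev : (edgeGroup σ q S A a).ev f (fun F => ind (∃ e ∈ F, e.1 = i)) =
      (firstPos (startTest S A a) K).ev f fun o => o.elim 0 φ := by
    rw [edgeGroup, ev_bind]
    congr 1
    funext o
    rcases o with _ | x
    · simp [ind]
    · simp only [ev_bind, ev_output, Option.elim_some, hφ]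
      congr 1
      funext l
      refine ind_congr ?_
      simp only [List.reduceOption_mem_iff, Option.mem_def]
      constructor
      · rintro ⟨e, he, h⟩
        exact ⟨_, he, e, rfl, h⟩
      · rintro ⟨_, ho, e, rfl, h⟩
        exact ⟨e, ho, h⟩
  rw [hev]
  refine le_trans ?_ (le_ev_firstPos f hφ0 K)
  -- a search point that is calm and carries the edge yields it with some probability
  have hφ1 : ∀ x, HasEdge f σ i x ∧ Calm f (S.erase i) i η a x → 2 ^ A / (4 * S.card) ≤ φ x := by
    intro x hx
    have h1 := le_ev_randSearch f hi ((Nat.pow_le_pow_right two_pos haA).trans hA) hx.1 hx.2 hη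
      hη0 hq
    simp only [hφ]
    rw [ev_replicate_exists]
    set s := (randSearch σ q S (2 ^ a) x).ev f fun o => ind (∃ e ∈ o, e.1 = i)
    have hs1 : s ≤ 1 := ev_le_one f _ fun _ => ind_le_one _
    have h0 : (0 : ℝ) ≤ 2 ^ a / (2 * S.card) := by positivity
    have h3 : (K : ℝ) * (2 ^ a / (2 * S.card)) = 2 ^ A / (2 * S.card) := by
      rw [hKR, ← mul_div_assoc, hpow]
    have h4 : (K : ℝ) * (2 ^ a / (2 * S.card)) ≤ 1 := by
      rw [h3, div_le_one (by positivity)]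
      linarith
    have h2 := le_one_sub_one_sub_pow h0 (h1.trans hs1) h4
    have h5 : (1 - s) ^ K ≤ (1 - 2 ^ a / (2 * S.card)) ^ K :=
      pow_le_pow_left₀ (by linarith) (by linarith) K
    rw [h3, div_div] at h2
    have h6 : (2 : ℝ) * S.card * 2 = 4 * S.card := by ring
    rw [h6] at h2
    linarith
  set π : Point n → ℝ := fun x => (startTest S A a x).ev f fun b => ind (b = true) with hπ
  have hπ0 : ∀ x, 0 ≤ π x := fun x => ev_nonneg f _ fun _ => ind_nonneg _
  set E := 𝔼 x, ind (HasEdge f σ i x ∧ Calm f (S.erase i) i η a x ∧ IsStart f (S.erase i) η A a x)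
    with hE
  have hE0 : 0 ≤ E := expect_nonneg fun _ _ => ind_nonneg _
  have he : η / 2 * (2 ^ A / (4 * S.card)) * E ≤ 𝔼 x, π x * φ x := by
    rw [hE, mul_expect]
    refine expect_le_expect fun x _ => ?_
    by_cases hx : HasEdge f σ i x ∧ Calm f (S.erase i) i η a x ∧ IsStart f (S.erase i) η A a x
    · rw [ind_of hx, mul_one]
      exact mul_le_mul (le_ev_startTest f hi haA hA hη1 hx.2.2) (hφ1 x ⟨hx.1, hx.2.1⟩)
        (by positivity) (hπ0 x)
    · rw [ind_of_not hx, mul_zero]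
      exact mul_nonneg (hπ0 x) (hφ0 x)
  have hp : (1 : ℝ) / 2 ≤ 1 - (K - 1) * 𝔼 x, π x := by
    rcases haA.eq_or_lt with rfl | hlt
    · have : (K : ℝ) = 1 := by rw [hKR]; simp
      rw [this]; norm_num
    · have h1 := expect_ev_startTest_le f hlt hA
      have h2 := hS.resolve_left (by omega)
      have h0 : 0 ≤ 𝔼 x, π x := expect_nonneg fun x _ => hπ0 x
      have h3 : ((K : ℝ) - 1) * 𝔼 x, π x ≤
          K * (2 * (2 ^ a / S.card) * ∑ j ∈ S, influence f j) := by
        have : (0 : ℝ) ≤ K := by positivity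
        nlinarith
      have h4 : (K : ℝ) * (2 * (2 ^ a / S.card) * ∑ j ∈ S, influence f j) =
          (4 * 2 ^ A * ∑ j ∈ S, influence f j) / (2 * S.card) := by
        rw [hKR, ← hpow]
        field_simp
        ring
      have h5 : (4 * 2 ^ A * ∑ j ∈ S, influence f j) / (2 * S.card) ≤ 1 / 2 := by
        rw [div_le_div_iff₀ (by positivity) two_pos]
        linarith
      linarith
  have hK0 : (0 : ℝ) ≤ K := by positivity
  have h1 : (K : ℝ) * (η / 2 * (2 ^ A / (4 * S.card)) * E) * (1 / 2) ≤
      K * (𝔼 x, π x * φ x) * (1 - (K - 1) * 𝔼 x, π x) := by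
    have : 0 ≤ 𝔼 x, π x * φ x := expect_nonneg fun x _ => mul_nonneg (hπ0 x) (hφ0 x)
    gcongr
  refine le_trans (le_of_eq ?_) h1
  rw [hKR]
  field_simp
  ring

end EdgeGroup

/-! ### Functions of large total influence -/

section LargeInfluence

/-- Return two random edges along a random variable. -/
noncomputable def randomPair (n : ℕ) : QueryAlg n (Answer n) :=
  pick ((univ : Finset (Fin n × Point n × Point n)).map Function.Embedding.some)

/-- The sign `1` or `-1` of a bit. -/
def bitSign (b : Bool) : ℝ := if b then 1 else -1

lemma bitSign_mul_self (b : Bool) : bitSign b * bitSign b = 1 := by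
  cases b <;> simp [bitSign]

lemma bitSign_not (b : Bool) : bitSign (!b) = -bitSign b := by cases b <;> simp [bitSign]

lemma expect_bitSign_mul (i j : Fin n) :
    𝔼 x : Point n, bitSign (x i) * bitSign (x j) = if i = j then 1 else 0 := by
  split_ifs with h
  · subst h
    simp only [bitSign_mul_self]
    exact expect_const univ_nonempty _
  · have h1 := expect_flip {i} fun x : Point n => bitSign (x i) * bitSign (x j)
    have h2 : ∀ x : Point n, bitSign (flip x {i} i) * bitSign (flip x {i} j) =
        -(bitSign (x i) * bitSign (x j)) := by
      intro x
      have e1 : flip x {i} i = !(x i) := by simp [flip]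
      have e2 : flip x {i} j = x j := by simp [flip, Ne.symm h]
      rw [e1, e2, bitSign_not, neg_mul]
    simp only [h2, expect_neg_distrib] at h1
    linarith

variable (f : Point n → Bool)

/-- The difference of the two directed influences is a Fourier coefficient of degree one. -/
lemma dirInf_sub (i : Fin n) :
    dirInf f true i - dirInf f false i = 𝔼 x, bitSign (f x) * bitSign (x i) := by
  have h1 := expect_flip {i} fun x => bitSign (f x) * bitSign (x i)
  have h2 : ∀ x, bitSign (f x) * bitSign (x i) +
      bitSign (f (flip x {i})) * bitSign (flip x {i} i) =
      2 * (ind (HasEdge f true i x) - ind (HasEdge f false i x)) := by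
    intro x
    have e1 : flip x {i} i = !(x i) := by simp [flip]
    rw [e1]
    simp only [HasEdge]
    cases f x <;> cases f (flip x {i}) <;> cases x i <;> simp [ind, bitSign] <;> norm_num
  have h3 : 𝔼 x, (bitSign (f x) * bitSign (x i) +
      bitSign (f (flip x {i})) * bitSign (flip x {i} i)) =
      2 * (dirInf f true i - dirInf f false i) := by
    rw [expect_congr rfl fun x _ => h2 x, ← mul_expect, expect_sub_distrib]
    rfl
  rw [expect_add_distrib] at h3
  linarith

/-- The differences of the two directed influences are the Fourier coefficients of `f` at level one,
up to sign, and the signed sum of the corresponding characters has `L²` norm at most `√n`. -/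
lemma sum_abs_dirInf_sub_le :
    ∑ i, |dirInf f true i - dirInf f false i| ≤ √n := by
  set D : Fin n → ℝ := fun i => dirInf f true i - dirInf f false i with hD
  set s : Fin n → ℝ := fun i => SignType.sign (D i) with hs
  have hs1 : ∀ i, s i * s i ≤ 1 := by
    intro i
    simp only [hs]
    rcases SignType.trichotomy (SignType.sign (D i)) with h | h | h <;> rw [h] <;> norm_num
  set W : Point n → ℝ := fun x => ∑ i, s i * bitSign (x i) with hW
  have h1 : ∑ i, |D i| = 𝔼 x, bitSign (f x) * W x := by
    simp only [hW, mul_sum]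
    rw [expect_sum_comm]
    refine sum_congr rfl fun i _ => ?_
    rw [← sign_mul_self (D i)]
    change s i * D i = _
    simp only [hD]
    rw [dirInf_sub, mul_expect]
    exact expect_congr rfl fun x _ => by ring
  have h2 : 𝔼 x, W x ^ 2 ≤ n := by
    have e : ∀ x, W x ^ 2 = ∑ i, ∑ j, s i * s j * (bitSign (x i) * bitSign (x j)) := by
      intro x
      rw [hW, sq, sum_mul_sum]
      exact sum_congr rfl fun i _ => sum_congr rfl fun j _ => by ring
    simp only [e]
    rw [expect_sum_comm]
    have e2 : ∀ i, 𝔼 x : Point n, ∑ j, s i * s j * (bitSign (x i) * bitSign (x j)) = s i * s i := by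
      intro i
      rw [expect_sum_comm]
      simp only [← mul_expect, expect_bitSign_mul]
      simp
    simp only [e2]
    refine (sum_le_sum fun i _ => hs1 i).trans ?_
    simp
  have h3 := expect_mul_sq_le_sq_mul_sq (univ : Finset (Point n)) (fun x => bitSign (f x)) W
  have h4 : 𝔼 x, bitSign (f x) ^ 2 = 1 := by
    simp only [sq, bitSign_mul_self]
    exact expect_const univ_nonempty _
  rw [h4, one_mul] at h3
  rw [h1]
  exact Real.le_sqrt_of_sq_le (h3.trans h2)

lemma success_randomPair (hn : 0 < n) :
    (randomPair n).success f = 𝔼 i, dirInf f true i * dirInf f false i := by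
  have : NeZero n := ⟨hn.ne'⟩
  rw [success, randomPair, ev_pick f ((map_nonempty).2 univ_nonempty), expect_eq_sum_div_card,
    sum_map, card_map, ← expect_eq_sum_div_card, ← univ_product_univ, expect_product]
  refine expect_congr rfl fun i _ => ?_
  rw [← univ_product_univ, expect_product]
  simp only [dirInf]
  rw [expect_mul_expect]
  refine expect_congr rfl fun x _ => expect_congr rfl fun y _ => ?_
  rw [← ind_and]
  refine ind_congr ?_
  rw [hasEdge_true, hasEdge_false]
  constructor
  · rintro ⟨i', x', y', h, h1, h2⟩
    have h : (i, x, y) = (i', x', y') := by simpa using h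
    simp only [Prod.mk.injEq] at h
    obtain ⟨rfl, rfl, rfl⟩ := h
    exact ⟨h1, h2⟩
  · rintro ⟨h1, h2⟩
    exact ⟨i, x, y, rfl, h1, h2⟩

/-- If the total influence exceeds `√n`, which bounds the influence that the edges of the majority
directions can have in excess of the others, then two random edges along the same variable
form a violation with noticeable probability. -/
lemma le_success_randomPair (hn : 0 < n) (h : √n ≤ ∑ i, influence f i) :
    ((∑ i, influence f i - √n) / (2 * n)) ^ 2 ≤ (randomPair n).success f := by
  have hn' : (0 : ℝ) < n := by exact_mod_cast hn
  have : NeZero n := ⟨hn.ne'⟩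
  rw [success_randomPair f hn]
  set μ : Fin n → ℝ := fun i => min (dirInf f true i) (dirInf f false i) with hμ
  have hμ0 : ∀ i, 0 ≤ μ i := fun i => le_min (dirInf_nonneg f _ i) (dirInf_nonneg f _ i)
  have h1 : ∀ i, 2 * μ i = influence f i - |dirInf f true i - dirInf f false i| := by
    intro i
    rw [← dirInf_add]
    simp only [hμ]
    rcases le_total (dirInf f true i) (dirInf f false i) with h | h
    · rw [min_eq_left h, abs_of_nonpos (by linarith)]; ring
    · rw [min_eq_right h, abs_of_nonneg (by linarith)]; ring
  have h2 : (∑ i, influence f i - √n) / (2 * n) ≤ 𝔼 i, μ i := by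
    rw [Fintype.expect_eq_sum_div_card, Fintype.card_fin, div_le_div_iff₀ (by positivity) hn']
    have h3 : ∑ i, 2 * μ i = ∑ i, influence f i - ∑ i, |dirInf f true i - dirInf f false i| := by
      rw [← sum_sub_distrib]
      exact sum_congr rfl fun i _ => h1 i
    rw [← mul_sum] at h3
    have h4 := sum_abs_dirInf_sub_le f
    nlinarith
  have h3 : (𝔼 i, μ i) ^ 2 ≤ 𝔼 i, μ i ^ 2 := by
    have := expect_mul_sq_le_sq_mul_sq (univ : Finset (Fin n)) μ fun _ => 1
    simpa using this
  calc ((∑ i, influence f i - √n) / (2 * n)) ^ 2 ≤ (𝔼 i, μ i) ^ 2 :=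
        pow_le_pow_left₀ (div_nonneg (by linarith) (by positivity)) h2 2
    _ ≤ 𝔼 i, μ i ^ 2 := h3
    _ ≤ 𝔼 i, dirInf f true i * dirInf f false i := by
        refine expect_le_expect fun i _ => ?_
        rw [sq]
        exact mul_le_mul (min_le_left _ _) (min_le_right _ _) (hμ0 i) (dirInf_nonneg f _ i)

end LargeInfluence

/-! ### One attempt at finding a violation -/

section Attempt

/-- Search for an edge along a variable of `S` at a random point. -/
noncomputable def sampleEdge (σ : Bool) (q : ℕ) (S : Finset (Fin n)) :
    QueryAlg n (Option (Fin n × Point n)) :=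
  (pick univ).bind fun x => search σ q x S

/-- Choose a random set `S` of `m + 1` variables, and look for a collision between `M` groups of
edges with direction `σ` and `b` samples of edges with the opposite direction, all along
variables of `S`. -/
noncomputable def attempt (σ : Bool) (q m A a M b : ℕ) : QueryAlg n (Answer n) :=
  (pick ((univ : Finset (Fin n)).powersetCard (m + 1))).bind fun S =>
    collide σ M b (edgeGroup σ q S A a) (sampleEdge (!σ) q S)

lemma queries_attempt_le (σ : Bool) (q m A a M b : ℕ) :
    (attempt σ q m A a M b : QueryAlg n (Answer n)).queries ≤
      M * (2 ^ (A - a) * (q + 5)) + b * (q + 2) := by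
  refine (queries_bind_le (queries_pick _).le fun S => (queries_collide_le ..).trans ?_).trans_eq
    (Nat.zero_add _)
  gcongr
  · exact queries_edgeGroup_le ..
  · rw [sampleEdge, ← Nat.zero_add (q + 2)]
    exact queries_bind_le (queries_pick _).le fun x => queries_search_le ..

variable (f : Point n → Bool)

/-- The search with all of `insert i Q`, where `Q` has `m` elements, is not disturbed at the edge
along `i` at `x`. This is persistency with a general error `η`. -/
def Steady (Q : Finset (Fin n)) (i : Fin n) (η : ℝ) (m : ℕ) (x : Point n) : Prop :=
  noise f Q (m / 2 + 1) x ≤ η ∧ noise f Q (m / 2) (flip x {i}) ≤ η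

/-- Edges that are likely to be steady are found by sampling, for most sets of variables. -/
lemma expect_ind_lt_ev_sampleEdge {σ : Bool} {q m : ℕ} {i : Fin n} {η s : ℝ}
    (hη : q * (2 * η) ≤ 1 / 4) (hq : (m : ℝ) / 2 ^ q ≤ 1 / 4) {X : Point n → Prop}
    (hX : ∀ x, X x → HasEdge f σ i x) (hs : 0 < s) (hsX : s ≤ 𝔼 x, ind (X x))
    (hsteady : ∀ x, X x →
      𝔼 Q ∈ (univ.erase i).powersetCard m, ind (¬Steady f Q i η m x) ≤ 1 / 8) :
    𝔼 Q ∈ (univ.erase i).powersetCard m,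
      ind (¬s / 4 ≤ (sampleEdge σ q (insert i Q)).ev f fun o => ind (∃ e ∈ o, e.1 = i)) ≤
      1 / 4 := by
  set p := 𝔼 x, ind (X x) with hp
  have hp0 : 0 < p := hs.trans_le hsX
  set bad : Finset (Fin n) → ℝ := fun Q => 𝔼 x, ind (X x) * ind (¬Steady f Q i η m x) with hbad
  have h1 : ∀ Q ∈ (univ.erase i).powersetCard m, (p - bad Q) / 2 ≤
      (sampleEdge σ q (insert i Q)).ev f fun o => ind (∃ e ∈ o, e.1 = i) := by
    intro Q hQ
    have hQ' := mem_powersetCard.1 hQ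
    have hiQ : i ∉ Q := fun h => notMem_erase i univ (hQ'.1 h)
    rw [sampleEdge, ev_bind, ev_pick f univ_nonempty, hp, hbad, ← expect_sub_distrib, expect_div]
    refine expect_le_expect fun x _ => ?_
    have h0 : 0 ≤ (search σ q x (insert i Q)).ev f fun o => ind (∃ e ∈ o, e.1 = i) :=
      ev_nonneg f _ fun _ => ind_nonneg _
    by_cases hx : X x
    · by_cases hst : Steady f Q i η m x
      · have h2 := le_ev_search f (mem_insert_self i Q)
          (by rw [card_insert_of_notMem hiQ, hQ'.2]) (hX x hx) q
        rw [erase_insert hiQ] at h2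
        rw [ind_of hx, ind_of_not (not_not.2 hst)]
        have h3 : (q : ℝ) * (noise f Q (m / 2 + 1) x + noise f Q (m / 2) (flip x {i})) ≤ 1 / 4 := by
          refine le_trans ?_ hη
          gcongr
          linarith [hst.1, hst.2]
        linarith
      · rw [ind_of hx, ind_of hst]
        simpa using h0
    · rw [ind_of_not hx]
      simpa using h0
  have h2 : 𝔼 Q ∈ (univ.erase i).powersetCard m, bad Q ≤ p / 8 := by
    rw [hbad, expect_comm, hp, expect_div]
    refine expect_le_expect fun x _ => ?_
    rw [← mul_expect]
    by_cases hx : X x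
    · rw [ind_of hx, one_mul]; exact hsteady x hx
    · rw [ind_of_not hx]; simp
  have h3 : ∀ Q ∈ (univ.erase i).powersetCard m,
      ind (¬s / 4 ≤ (sampleEdge σ q (insert i Q)).ev f fun o => ind (∃ e ∈ o, e.1 = i)) ≤
      2 / p * bad Q := by
    intro Q hQ
    have hb0 : 0 ≤ bad Q := expect_nonneg fun x _ => mul_nonneg (ind_nonneg _) (ind_nonneg _)
    have hr : 0 ≤ 2 / p * bad Q := by positivity
    by_cases hc : s / 4 ≤ (sampleEdge σ q (insert i Q)).ev f fun o => ind (∃ e ∈ o, e.1 = i)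
    · rw [ind_of_not (not_not.2 hc)]; exact hr
    · rw [ind_of hc, div_mul_eq_mul_div, one_le_div hp0]
      have := h1 Q hQ
      push Not at hc
      linarith
  refine (expect_le_expect h3).trans ?_
  rw [← mul_expect]
  calc 2 / p * 𝔼 Q ∈ (univ.erase i).powersetCard m, bad Q ≤ 2 / p * (p / 8) := by gcongr
    _ = 1 / 4 := by field_simp; norm_num

/-- Most sets of `m + 1` variables containing a variable `i` of moderate influence have about the
expected total influence. -/
lemma expect_ind_influence_le {m : ℕ} {i : Fin n} {c B : ℝ} (hm : m + 1 ≤ n) (hc : 0 < c)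
    (hi : c * (influence f i + (m + 1) / n * ∑ j, influence f j) ≤ B / 4) (hB : 0 < B) :
    𝔼 Q ∈ (univ.erase i).powersetCard m, ind (¬c * ∑ j ∈ insert i Q, influence f j ≤ B) ≤
      1 / 4 := by
  have hcard : #(univ.erase i) = n - 1 := by rw [card_erase_of_mem (mem_univ i)]; simp
  have hne : ((univ.erase i).powersetCard m).Nonempty := powersetCard_nonempty.2 (by omega)
  have h1 : ∀ Q ∈ (univ.erase i).powersetCard m,
      ind (¬c * ∑ j ∈ insert i Q, influence f j ≤ B) ≤
        c / B * ∑ j ∈ insert i Q, influence f j := by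
    intro Q _
    have h0 : 0 ≤ ∑ j ∈ insert i Q, influence f j := sum_nonneg fun j _ => influence_nonneg f j
    by_cases h : c * ∑ j ∈ insert i Q, influence f j ≤ B
    · rw [ind_of_not (not_not.2 h)]; positivity
    · rw [ind_of h, div_mul_eq_mul_div, one_le_div hB]
      exact (not_le.1 h).le
  refine (expect_le_expect h1).trans ?_
  rw [← mul_expect]
  have h2 : 𝔼 Q ∈ (univ.erase i).powersetCard m, ∑ j ∈ insert i Q, influence f j ≤
      influence f i + (m + 1) / n * ∑ j, influence f j := by
    have h3 : ∀ Q ∈ (univ.erase i).powersetCard m, ∑ j ∈ insert i Q, influence f j =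
        influence f i + ∑ j ∈ univ.erase i, influence f j * ind (j ∈ Q) := by
      intro Q hQ
      have hQ' := mem_powersetCard.1 hQ
      rw [sum_insert fun h => notMem_erase i univ (hQ'.1 h)]
      congr 1
      rw [← sum_subset hQ'.1]
      · exact sum_congr rfl fun j hj => by rw [ind_of hj, mul_one]
      · intro j _ hj
        rw [ind_of_not hj, mul_zero]
    rw [expect_congr rfl h3, expect_add_distrib, expect_const hne, expect_sum_comm]
    gcongr
    have h4 : ∀ j ∈ univ.erase i, 𝔼 Q ∈ (univ.erase i).powersetCard m,
        influence f j * ind (j ∈ Q) ≤ (m + 1) / n * influence f j := by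
      intro j hj
      rw [← mul_expect, expect_ind_mem hj (by omega), hcard, mul_comm]
      refine mul_le_mul_of_nonneg_right ?_ (influence_nonneg f j)
      have hn1 : 1 < n := by
        have : 0 < #(univ.erase i) := card_pos.2 ⟨j, hj⟩
        omega
      have h5 : ((n - 1 : ℕ) : ℝ) = n - 1 := by rw [Nat.cast_sub hn1.le]; norm_num
      have h6 : (1 : ℝ) < n := by exact_mod_cast hn1
      have h7 : (m : ℝ) + 1 ≤ n := by exact_mod_cast hm
      rw [h5, div_le_div_iff₀ (by linarith) (by linarith)]
      nlinarith
    refine (sum_le_sum h4).trans ?_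
    rw [← mul_sum]
    refine mul_le_mul_of_nonneg_left ?_ (by positivity)
    exact sum_le_sum_of_subset_of_nonneg (erase_subset _ _) fun j _ _ => influence_nonneg f j
  calc c / B * 𝔼 Q ∈ (univ.erase i).powersetCard m, ∑ j ∈ insert i Q, influence f j
      ≤ c / B * (influence f i + (m + 1) / n * ∑ j, influence f j) := by gcongr
    _ = c * (influence f i + (m + 1) / n * ∑ j, influence f j) / B := by ring
    _ ≤ (B / 4) / B := by gcongr
    _ = 1 / 4 := by field_simp

/-- The lower bound for the probability that a group of edges at scale `a` contains one along a
given variable. -/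
noncomputable def groupRate (m A a : ℕ) (η d : ℝ) : ℝ :=
  2 ^ (A - a) * 2 ^ A * η / (16 * (m + 1)) * (d / (2 * (A + 1)))

lemma sub_moments_le {t Y ν g1 g2 κ : ℝ} (ht : 0 ≤ t) (hY0 : 0 ≤ Y) (hY4 : Y ≤ 4) (hν : 0 ≤ ν)
    (h1 : κ * ν ≤ g1) (h1' : g1 ≤ ν) (h2 : g2 ≤ ν ^ 2 + ν) :
    2 * t * (Y * (κ * ν)) - t ^ 2 * (Y * ν * (Y * ν + 9)) ≤
      2 * t * Y * g1 - t ^ 2 * (Y ^ 2 * g2 + 5 * Y * g1) := by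
  have h4 : Y ^ 2 * g2 + 5 * Y * g1 ≤ Y * ν * (Y * ν + 9) := by
    have e1 : Y ^ 2 * g2 ≤ Y ^ 2 * (ν ^ 2 + ν) := by gcongr
    have e2 : 5 * Y * g1 ≤ 5 * Y * ν := by gcongr
    have e3 : Y * (Y * ν) ≤ 4 * (Y * ν) := by gcongr
    nlinarith
  have h5 := mul_le_mul_of_nonneg_left h4 (sq_nonneg t)
  have h6 : 2 * t * Y * (κ * ν) ≤ 2 * t * Y * g1 := by gcongr
  linarith

/-- Averaging the second moment bound over the set `S`. -/
lemma le_success_attempt {σ : Bool} {q m A a M b : ℕ} {I : Finset (Fin n)} (hm : m + 1 ≤ n)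
    (G : Finset (Fin n) → Finset (Fin n)) (hGI : ∀ S, G S ⊆ I) (hGS : ∀ S, G S ⊆ S) {α w κ y : ℝ}
    (hα : 0 < α) (hw : 0 < w) (hκ : 0 ≤ κ) (hy : 0 ≤ y)
    (hαG : ∀ S, ∀ i ∈ G S, α ≤ (edgeGroup σ q S A a).ev f fun F => ind (∃ e ∈ F, e.1 = i))
    (hwG : ∀ S, ∀ i ∈ G S, w ≤ (sampleEdge (!σ) q S).ev f fun X => ind (∃ e ∈ X, e.1 = i))
    (hM : M * α ≤ 2) (hb : b * 2 ^ A * w ≤ 2) (hyM : y ≤ M * b * α * w)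
    (hκG : κ * (I.card * ((m + 1) / n)) ≤
      𝔼 S ∈ (univ : Finset (Fin n)).powersetCard (m + 1), ((G S).card : ℝ)) :
    κ ^ 2 * (y * (I.card * ((m + 1) / n))) / (y * (I.card * ((m + 1) / n)) + 9) ≤
      (attempt σ q m A a M b).success f := by
  have hn : (univ : Finset (Fin n)).card = n := by simp
  have hne : ((univ : Finset (Fin n)).powersetCard (m + 1)).Nonempty :=
    powersetCard_nonempty.2 (by rwa [hn])
  set ν : ℝ := I.card * ((m + 1) / n) with hν
  have hν0 : 0 ≤ ν := by positivity
  set Y : ℝ := M * b * α * w with hY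
  have hY0 : 0 ≤ Y := by positivity
  have hY4 : Y ≤ 4 := by
    have h1 : b * w ≤ 2 := by
      refine le_trans ?_ hb
      have : (1 : ℝ) ≤ 2 ^ A := one_le_pow₀ one_le_two
      have h0 : (0 : ℝ) ≤ b * w := by positivity
      nlinarith
    calc Y = (M * α) * (b * w) := by rw [hY]; ring
      _ ≤ 2 * 2 := by gcongr
      _ = 4 := by norm_num
  set g1 := 𝔼 S ∈ (univ : Finset (Fin n)).powersetCard (m + 1), ((G S).card : ℝ) with hg1
  set g2 := 𝔼 S ∈ (univ : Finset (Fin n)).powersetCard (m + 1), ((G S).card : ℝ) ^ 2 with hg2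
  have hGc : ∀ S, ((G S).card : ℝ) ≤ ∑ i ∈ I, ind (i ∈ S) := by
    intro S
    classical
    rw [sum_ind]
    exact_mod_cast card_le_card fun i hi => mem_filter.2 ⟨hGI S hi, hGS S hi⟩
  have hg2' : g2 ≤ ν ^ 2 + ν := by
    have h1 := expect_sum_ind_mem_sq_le (subset_univ I) (by rwa [hn] : m + 1 ≤ #univ)
    rw [hn] at h1
    refine le_trans (expect_le_expect fun S _ => ?_) h1
    exact pow_le_pow_left₀ (by positivity) (hGc S) 2
  have hg1' : g1 ≤ ν := by
    refine (expect_le_expect fun S _ => hGc S).trans (le_of_eq ?_)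
    rw [expect_sum_comm, sum_congr rfl fun i _ =>
      expect_ind_mem (mem_univ i) (by rwa [hn] : m + 1 ≤ #univ), sum_const, nsmul_eq_mul, hn, hν]
    push_cast
    rfl
  have key : ∀ t : ℝ, 0 ≤ t → 2 * t * (Y * (κ * ν)) - t ^ 2 * (Y * ν * (Y * ν + 9)) ≤
      (attempt σ q m A a M b).success f := by
    intro t ht
    have h1 : ∀ S ∈ (univ : Finset (Fin n)).powersetCard (m + 1),
        2 * t * Y * (G S).card - t ^ 2 * (Y ^ 2 * ((G S).card : ℝ) ^ 2 + 5 * Y * (G S).card) ≤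
        (collide σ M b (edgeGroup σ q S A a) (sampleEdge (!σ) q S)).success f := by
      intro S _
      have h2 := le_success_collide f (always_edgeGroup f σ q S A a)
        ((always_true f _).bind f fun x _ => always_search f (!σ) q x S :
          (sampleEdge (!σ) q S).Always f _) hα hw (hαG S) (hwG S) hM (b := b)
        (le_trans (by
          push_cast
          gcongr
          · exact one_le_two
          · omega) hb) t
      refine le_trans (le_of_eq ?_) h2
      rw [hY]; ring
    have h3 : (attempt σ q m A a M b).success f =
        𝔼 S ∈ (univ : Finset (Fin n)).powersetCard (m + 1),
          (collide σ M b (edgeGroup σ q S A a) (sampleEdge (!σ) q S)).success f := by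
      rw [success, attempt, ev_bind, ev_pick f hne]
      rfl
    rw [h3]
    refine le_trans ?_ (expect_le_expect h1)
    rw [expect_sub_distrib, ← mul_expect, ← mul_expect, expect_add_distrib, ← mul_expect,
      ← mul_expect, ← hg1, ← hg2]
    exact sub_moments_le ht hY0 hY4 hν0 hκG hg1' hg2'
  have h9 : 0 < Y * ν + 9 := by positivity
  have h9' : 0 < y * ν + 9 := by positivity
  have h1 := key (κ / (Y * ν + 9)) (by positivity)
  have h2 : 2 * (κ / (Y * ν + 9)) * (Y * (κ * ν)) -
      (κ / (Y * ν + 9)) ^ 2 * (Y * ν * (Y * ν + 9)) = κ ^ 2 * (Y * ν / (Y * ν + 9)) := by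
    field_simp
    ring
  rw [h2] at h1
  refine le_trans ?_ h1
  rw [mul_div_assoc]
  refine mul_le_mul_of_nonneg_left ?_ (sq_nonneg κ)
  rw [div_le_div_iff₀ h9' h9]
  have : y * ν ≤ Y * ν := by gcongr
  nlinarith

/-- For some scale, an attempt succeeds with a probability comparable to the expected number of
collisions (or to a constant, if this is larger). -/
lemma exists_le_success_attempt {σ : Bool} {q m A : ℕ} {I : Finset (Fin n)} {η s d y : ℝ}
    (hm : m + 1 ≤ n) (hA : 2 ^ A ≤ m + 1) (hη0 : 0 < η) (hη1 : η ≤ 1)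
    (hη : q * (2 * η) ≤ 1 / 4) (hq : ((m : ℝ) + 1) / 2 ^ q ≤ 1 / 4)
    (hs : 0 < s) (X : Fin n → Point n → Prop)
    (hX : ∀ i ∈ I, ∀ x, X i x → HasEdge f (!σ) i x)
    (hsX : ∀ i ∈ I, s ≤ 𝔼 x, ind (X i x))
    (hsteady : ∀ i ∈ I, ∀ x, X i x →
      𝔼 Q ∈ (univ.erase i).powersetCard m, ind (¬Steady f Q i η m x) ≤ 1 / 8)
    (hd : 0 < d) {J : Finset (Fin n)} (hJI : J ⊆ I) (hJ : (I.card : ℝ) / 4 ≤ J.card)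
    (hdJ : ∀ i ∈ J, d ≤ dirInf f σ i)
    (hinf : A = 0 ∨ 4 * 2 ^ A * ((8 / I.card + (m + 1) / n) * ∑ j, influence f j) ≤
      ((m : ℝ) + 1) / 4)
    (M : ℕ → ℕ) (b : ℕ) (hM : ∀ a ≤ A, M a * groupRate m A a η d ≤ 2)
    (hb : b * 2 ^ A * (s / 4) ≤ 2) (hy : 0 ≤ y)
    (hyM : ∀ a ≤ A, y ≤ M a * b * groupRate m A a η d * (s / 4)) :
    ∃ a ≤ A, (1 / (16 * (A + 1))) ^ 2 * (y * (I.card * ((m + 1) / n))) /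
        (y * (I.card * ((m + 1) / n)) + 9) ≤
      (attempt σ q m A a (M a) b).success f := by
  classical
  have hn : (univ : Finset (Fin n)).card = n := by simp
  have hn0 : (0 : ℝ) < n := by exact_mod_cast (by omega : 0 < n)
  have hm' : (m : ℝ) / 2 ^ q ≤ 1 / 4 := by
    refine le_trans ?_ hq
    gcongr
    linarith
  have h2A : (2 : ℝ) ^ A ≤ m + 1 := by exact_mod_cast hA
  have hqa : ∀ a ≤ A, (2 : ℝ) ^ a / 2 ^ q ≤ 1 / 4 := by
    intro a ha
    refine le_trans ?_ hq
    gcongr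
    exact (pow_le_pow_right₀ one_le_two ha).trans h2A
  have hrate : ∀ a, 0 < groupRate m A a η d := fun a => by unfold groupRate; positivity
  set T := ∑ j, influence f j with hT
  have hT0 : 0 ≤ T := sum_nonneg fun j _ => influence_nonneg f j
  -- the variables of `J` of moderate influence
  set J' := J.filter fun i => A = 0 ∨ influence f i ≤ 8 / I.card * T with hJ'
  have hJ'c : (I.card : ℝ) / 8 ≤ J'.card := by
    by_cases hA0 : A = 0
    · have : J' = J := by rw [hJ', filter_true_of_mem]; exact fun i _ => Or.inl hA0
      rw [this]
      have : (0 : ℝ) ≤ I.card := by positivity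
      linarith
    · rcases Nat.eq_zero_or_pos I.card with h0 | hI
      · rw [h0]; simp
      have hI' : (0 : ℝ) < I.card := by exact_mod_cast hI
      set D := J.filter fun i => ¬(A = 0 ∨ influence f i ≤ 8 / I.card * T) with hD
      have h1 : (J'.card : ℝ) + D.card = J.card := by
        exact_mod_cast card_filter_add_card_filter_not (s := J) _
      have h2 : (D.card : ℝ) ≤ I.card / 8 := by
        by_contra hcon
        push Not at hcon
        have hDne : D.Nonempty := by
          rw [← card_pos]
          have : (0 : ℝ) < D.card := lt_of_le_of_lt (by positivity) hcon
          exact_mod_cast this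
        have h3 : ∑ i ∈ D, 8 / I.card * T < ∑ i ∈ D, influence f i :=
          sum_lt_sum_of_nonempty hDne fun i hi => by
            have := (mem_filter.1 hi).2
            push Not at this
            exact this.2
        have h4 : ∑ i ∈ D, influence f i ≤ T :=
          sum_le_sum_of_subset_of_nonneg (subset_univ _) fun j _ _ => influence_nonneg f j
        rw [sum_const, nsmul_eq_mul] at h3
        have h5 : T ≤ D.card * (8 / I.card * T) := by
          have : 1 ≤ (D.card : ℝ) * (8 / I.card) := by
            rw [mul_div_assoc', one_le_div hI']
            linarith
          nlinarith
        linarith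
      linarith
  have hJ'I : J' ⊆ I := (filter_subset _ _).trans hJI
  -- the variables of a set `S` that are found at scale `a`
  set G : ℕ → Finset (Fin n) → Finset (Fin n) := fun a S => J'.filter fun i => i ∈ S ∧
    groupRate m A a η d ≤ (edgeGroup σ q S A a).ev f (fun F => ind (∃ e ∈ F, e.1 = i)) ∧
    s / 4 ≤ (sampleEdge (!σ) q S).ev f (fun o => ind (∃ e ∈ o, e.1 = i)) with hG
  have hcount : (1 / 2 : ℝ) * ((m + 1) / n) * J'.card ≤
      ∑ a ∈ range (A + 1),
        𝔼 S ∈ (univ : Finset (Fin n)).powersetCard (m + 1), ((G a S).card : ℝ) := by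
    rw [← expect_sum_comm]
    have h1 : ∀ S ∈ (univ : Finset (Fin n)).powersetCard (m + 1),
        ∑ i ∈ J', ind (i ∈ S) * ind (∃ a ≤ A, i ∈ G a S) ≤
          ∑ a ∈ range (A + 1), ((G a S).card : ℝ) := by
      intro S _
      have h2 : ∀ a ∈ range (A + 1), ((G a S).card : ℝ) = ∑ i ∈ J', ind (i ∈ G a S) := by
        intro a _
        rw [sum_ind]
        congr 2
        ext i
        simp only [mem_filter, hG]
        tauto
      rw [sum_congr rfl h2, sum_comm]
      refine sum_le_sum fun i _ => ?_
      by_cases h : ∃ a ≤ A, i ∈ G a S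
      · obtain ⟨a, ha, haS⟩ := h
        refine le_trans ?_ (single_le_sum (f := fun a => ind (i ∈ G a S))
          (fun a _ => ind_nonneg _) (mem_range.2 (Nat.lt_succ_of_le ha)))
        simp only [ind_of haS]
        exact mul_le_one₀ (ind_le_one _) (ind_nonneg _) (ind_le_one _)
      · rw [ind_of_not h, mul_zero]
        exact sum_nonneg fun a _ => ind_nonneg _
    refine le_trans ?_ (expect_le_expect h1)
    rw [expect_sum_comm, mul_comm, ← nsmul_eq_mul, ← sum_const]
    refine sum_le_sum fun i hi => ?_
    rw [expect_ind_mem_mul (mem_univ i) (by rwa [hn]), hn, mul_comm]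
    refine mul_le_mul_of_nonneg_left ?_ (by positivity)
    have hiI := hJ'I hi
    have hiJ := (mem_filter.1 hi).1
    have hne : ((univ.erase i).powersetCard m).Nonempty := powersetCard_nonempty.2 (by
      rw [card_erase_of_mem (mem_univ i), hn]; omega)
    have hbad1 := expect_ind_lt_ev_sampleEdge f hη hm' (hX i hiI) hs (hsX i hiI) (hsteady i hiI)
    have hbad2 : 𝔼 Q ∈ (univ.erase i).powersetCard m,
        ind (¬(A = 0 ∨ 4 * 2 ^ A * ∑ j ∈ insert i Q, influence f j ≤ m + 1)) ≤ 1 / 4 := by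
      by_cases hA0 : A = 0
      · simp [hA0, ind]
      · have h3 := hinf.resolve_left hA0
        have h4 := (mem_filter.1 hi).2.resolve_left hA0
        simp only [hA0, false_or]
        refine expect_ind_influence_le f hm (by positivity) (le_trans ?_ h3) (by positivity)
        rw [add_mul]
        gcongr
    have h5 : ∀ Q ∈ (univ.erase i).powersetCard m,
        1 - (ind (¬s / 4 ≤ (sampleEdge (!σ) q (insert i Q)).ev f
          fun o => ind (∃ e ∈ o, e.1 = i)) +
          ind (¬(A = 0 ∨ 4 * 2 ^ A * ∑ j ∈ insert i Q, influence f j ≤ m + 1))) ≤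
        ind (∃ a ≤ A, i ∈ G a (insert i Q)) := by
      intro Q hQ
      have hQ' := mem_powersetCard.1 hQ
      have hiQ : i ∉ Q := fun h => notMem_erase i univ (hQ'.1 h)
      have hcard : (insert i Q).card = m + 1 := by rw [card_insert_of_notMem hiQ, hQ'.2]
      have hcard' : ((insert i Q).card : ℝ) = m + 1 := by rw [hcard]; push_cast; rfl
      by_cases h6 : s / 4 ≤ (sampleEdge (!σ) q (insert i Q)).ev f
          fun o => ind (∃ e ∈ o, e.1 = i)
      · by_cases h7 : A = 0 ∨ 4 * 2 ^ A * ∑ j ∈ insert i Q, influence f j ≤ m + 1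
        · rw [ind_of_not (not_not.2 h6), ind_of_not (not_not.2 h7), ind_of]
          · norm_num
          obtain ⟨a, ha, h8⟩ := exists_scale f σ ((insert i Q).erase i) i η A
          refine ⟨a, ha, mem_filter.2 ⟨hi, mem_insert_self i Q, ?_, h6⟩⟩
          have h9 := le_ev_edgeGroup f (σ := σ) (q := q) (S := insert i Q) (mem_insert_self i Q) ha
            (by rw [hcard]; exact hA) hη0.le hη1 hη (hqa a ha) (by rw [hcard']; exact h7)
          refine le_trans ?_ h9
          rw [groupRate, hcard']
          refine mul_le_mul_of_nonneg_left (le_trans ?_ h8) (by positivity)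
          gcongr
          exact hdJ i hiJ
        · rw [ind_of h7]
          have h8 := ind_nonneg (¬s / 4 ≤ (sampleEdge (!σ) q (insert i Q)).ev f
            fun o => ind (∃ e ∈ o, e.1 = i))
          have h9 := ind_nonneg (∃ a ≤ A, i ∈ G a (insert i Q))
          linarith
      · rw [ind_of h6]
        have h8 := ind_nonneg (¬(A = 0 ∨ 4 * 2 ^ A * ∑ j ∈ insert i Q, influence f j ≤ m + 1))
        have h9 := ind_nonneg (∃ a ≤ A, i ∈ G a (insert i Q))
        linarith
    refine le_trans ?_ (expect_le_expect h5)
    rw [expect_sub_distrib, expect_const hne, expect_add_distrib]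
    linarith
  -- one of the scales is responsible for its share of these variables
  obtain ⟨a, ha, haG⟩ : ∃ a ∈ range (A + 1), 1 / (16 * ((A : ℝ) + 1)) *
      (I.card * ((m + 1) / n)) ≤
      𝔼 S ∈ (univ : Finset (Fin n)).powersetCard (m + 1), ((G a S).card : ℝ) := by
    refine exists_le_of_sum_le (by simp) (le_trans ?_ hcount)
    rw [sum_const, card_range, nsmul_eq_mul]
    have e : ((A + 1 : ℕ) : ℝ) * (1 / (16 * ((A : ℝ) + 1)) * (I.card * ((m + 1) / n))) =
        (1 / 2) * ((m + 1) / n) * (I.card / 8) := by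
      push_cast
      field_simp
      ring
    rw [e]
    gcongr
  refine ⟨a, Nat.lt_succ_iff.1 (mem_range.1 ha), ?_⟩
  have ha' := Nat.lt_succ_iff.1 (mem_range.1 ha)
  exact le_success_attempt f hm (G a) (fun S => (filter_subset _ _).trans hJ'I)
    (fun S i hi => (mem_filter.1 hi).2.1) (hrate a) (by positivity) (by positivity) hy
    (fun S i hi => (mem_filter.1 hi).2.2.1) (fun S i hi => (mem_filter.1 hi).2.2.2)
    (hM a ha') hb (hyM a ha') haG

end Attempt

/-! ### Strong edges and scores -/

section Strong

lemma prob_uniformSubset_map {α β : Type} (e : α ↪ β) {s : Finset α} {k : ℕ} (hk : k ≤ #s)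
    (E : Set (Finset β)) :
    prob (uniformSubset (s.map e) k) E = 𝔼 T ∈ s.powersetCard k, ind (T.map e ∈ E) := by
  classical
  rw [uniformSubset, dif_pos (by rwa [card_map]), prob, PMF.toOuterMeasure_uniformOfFinset_apply,
    ENNReal.toReal_div, expect_eq_sum_div_card, sum_ind, ENNReal.toReal_natCast,
    ENNReal.toReal_natCast, card_powersetCard, card_powersetCard, card_map]
  congr 2
  rw [powersetCard_map, filter_map, card_map]
  rfl

lemma erase_last_erase_castSucc (i : Fin n) :
    ((univ : Finset (Var n)).erase (Fin.last n)).erase i.castSucc =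
      (univ.erase i).map Fin.castSuccEmb := by
  ext v
  simp only [mem_erase, mem_univ, mem_map, Fin.coe_castSuccEmb, and_true]
  constructor
  · rintro ⟨h1, h2⟩
    obtain ⟨j, rfl⟩ := Fin.exists_castSucc_eq.2 h2
    exact ⟨j, fun h => h1 (by rw [h]), rfl⟩
  · rintro ⟨j, hj, rfl⟩
    exact ⟨fun h => hj (Fin.castSucc_injective n h), (Fin.castSucc_lt_last j).ne⟩

variable (f : Point n → Bool)

lemma prob_uniformSubset_flip {Q : Finset (Fin n)} {k : ℕ} (hk : k ≤ #Q) (x : Point n) :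
    prob (uniformSubset (Q.map Fin.castSuccEmb) k) {T | f x = f (flipSet x T)} =
      1 - noise f Q k x := by
  have hne : (Q.powersetCard k).Nonempty := powersetCard_nonempty.2 hk
  rw [prob_uniformSubset_map _ hk, noise, ← expect_const hne (1 : ℝ), ← expect_sub_distrib]
  refine expect_congr rfl fun T _ => ?_
  rw [← ind_not]
  refine ind_congr ?_
  rw [not_not, Set.mem_ofPred_eq, flipSet_map]
  exact eq_comm

lemma steady_of_edgePersistent {Q : Finset (Fin n)} {i : Fin n} {x : Point n} {η : ℝ}
    (hQ : 1 ≤ #Q) (hη : 1 / Real.logb 2 n ^ 2 ≤ η)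
    (h : EdgePersistent f i x (Q.map Fin.castSuccEmb)) : Steady f Q i η (#Q) x := by
  obtain ⟨⟨-, h1⟩, ⟨h2, -⟩⟩ := h
  rw [card_map] at h1 h2
  rw [prob_uniformSubset_flip f (by omega)] at h1
  rw [flipVar_eq, prob_uniformSubset_flip f (by omega)] at h2
  exact ⟨by linarith, by linarith⟩

lemma expect_not_steady_le {ε η : ℝ} {l m : ℕ} {i : Fin n} {x : Point n} (hm1 : 1 ≤ m)
    (hmn : m + 1 ≤ n) (hm : m = ⌈√(n : ℝ) / 2 ^ l⌉₊) (hη : 1 / Real.logb 2 n ^ 2 ≤ η)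
    (h : Strong ε f l i x) :
    𝔼 Q ∈ (univ.erase i).powersetCard m, ind (¬Steady f Q i η m x) ≤ 1 / Real.logb 2 n := by
  have hcard : #((univ : Finset (Fin n)).erase i) = n - 1 := by
    rw [card_erase_of_mem (mem_univ i)]; simp
  have hne : ((univ.erase i).powersetCard m).Nonempty := powersetCard_nonempty.2 (by omega)
  have h1 := h.2
  rw [distP, ← hm, erase_last_erase_castSucc, prob_uniformSubset_map _ (by omega)] at h1
  have h2 : 𝔼 Q ∈ (univ.erase i).powersetCard m,
      ind (Q.map Fin.castSuccEmb ∈ {S | EdgePersistent f i x S}) ≤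
      𝔼 Q ∈ (univ.erase i).powersetCard m, ind (Steady f Q i η m x) := by
    refine expect_le_expect fun Q hQ => ind_mono fun hS => ?_
    have hQ' := (mem_powersetCard.1 hQ).2
    have := steady_of_edgePersistent f (by omega) hη hS
    rwa [hQ'] at this
  simp only [ind_not]
  rw [expect_sub_distrib, expect_const hne]
  linarith

/-- The points counted by the scores: lower endpoints of strong edges with direction `σ`. -/
def IsScored (ε : ℝ) (σ : Bool) (l : ℕ) (i : Fin n) (x : Point n) : Prop :=
  x i = false ∧ HasEdge f σ i x ∧ Strong ε f l i x

lemma ncard_div_two_pow (P : Point n → Prop) :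
    (Set.ncard {x | P x} : ℝ) / 2 ^ n = 𝔼 x, ind (P x) := by
  classical
  rw [Fintype.expect_eq_sum_div_card, sum_ind, Set.ncard_eq_toFinset_card']
  simp

lemma scorePos_eq_expect (ε : ℝ) (l : ℕ) (i : Fin n) :
    scorePos ε f l i = 𝔼 x, ind (IsScored f ε true l i x) := by
  simp only [scorePos, IsScored, hasEdge_true, ncard_div_two_pow]

lemma scoreNeg_eq_expect (ε : ℝ) (l : ℕ) (i : Fin n) :
    scoreNeg ε f l i = 𝔼 x, ind (IsScored f ε false l i x) := by
  simp only [scoreNeg, IsScored, hasEdge_false, ncard_div_two_pow]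

lemma expect_isScored_le_influence (ε : ℝ) (σ : Bool) (l : ℕ) (i : Fin n) :
    𝔼 x, ind (IsScored f ε σ l i x) ≤ influence f i := by
  rw [influence_eq_expect]
  exact expect_le_expect fun x _ => ind_mono fun h => h.2.1.1

/-! ### Querying all points -/

/-- Query the points of a list, and record the answers in the table `g`. -/
def readTable : List (Point n) → (Point n → Bool) → QueryAlg n (Point n → Bool)
  | [], g => output g
  | x :: l, g => query x fun b => readTable l fun y => if y = x then b else g y

lemma queries_readTable_le (l : List (Point n)) (g : Point n → Bool) :
    (readTable l g).queries ≤ l.length := by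
  induction l generalizing g with
  | nil => simp [readTable]
  | cons x l ih =>
    rw [readTable, List.length_cons, add_comm]
    exact queries_query_le fun b => ih _

lemma ev_readTable (l : List (Point n)) (g : Point n → Bool) (φ : (Point n → Bool) → ℝ) :
    (readTable l g).ev f φ = φ fun x => if x ∈ l then f x else g x := by
  induction l generalizing g with
  | nil => simp [readTable]
  | cons x l ih =>
    rw [readTable, ev_query, ih]
    congr 1
    funext y
    by_cases h1 : y ∈ l
    · simp [h1]
    · by_cases h2 : y = x
      · simp [h2]
      · simp [h1, h2]

/-- An edge violation of `g`, if there is one. -/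
noncomputable def someViolation (g : Point n → Bool) : Answer n :=
  open Classical in if h : ∃ o, IsEdgeViolation g o then h.choose else none

/-- Query all points, and return an edge violation if there is one. -/
noncomputable def queryAll (n : ℕ) : QueryAlg n (Answer n) :=
  (readTable univ.toList fun _ => false).bind fun g => output (someViolation g)

lemma queries_queryAll_le (n : ℕ) : (queryAll n).queries ≤ 2 ^ n := by
  refine (queries_bind_le (b := 0) (queries_readTable_le _ _) fun g => le_rfl).trans ?_
  simp

lemma success_queryAll (h : ∃ o, IsEdgeViolation f o) : (queryAll n).success f = 1 := by
  have e : (fun x => if x ∈ (univ : Finset (Point n)).toList then f x else false) = f := by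
    funext x; simp
  rw [success, queryAll, ev_bind, ev_readTable, e, ev_output, someViolation, dif_pos h,
    ind_of h.choose_spec]

lemma exists_isEdgeViolation {ε : ℝ} {s t : ℕ} {i : Fin n} (hs : 0 < scorePos ε f s i)
    (ht : 0 < scoreNeg ε f t i) : ∃ o, IsEdgeViolation f o := by
  rw [scorePos_eq_expect] at hs
  rw [scoreNeg_eq_expect] at ht
  obtain ⟨x, -, hx⟩ := exists_ne_zero_of_expect_ne_zero hs.ne'
  obtain ⟨y, -, hy⟩ := exists_ne_zero_of_expect_ne_zero ht.ne'
  have hx' : IsScored f ε true s i x := by by_contra h; exact hx (ind_of_not h)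
  have hy' : IsScored f ε false t i y := by by_contra h; exact hy (ind_of_not h)
  exact ⟨_, i, x, y, rfl, (hasEdge_true f).1 hx'.2.1, (hasEdge_false f).1 hy'.2.1⟩

end Strong

/-! ### The choice of the parameters -/

section Parameters

variable {u v P l₂ m₁ a₂ : ℝ}

/-- The number of attempts, up to logarithmic factors: the expected size of the intersection of `S`
with `I` is `P * m₁ / u ^ 3`, and if it is below `1`, then the sets `S` that contain a variable of
`I` are rare. -/
noncomputable def repeats (u P m₁ : ℝ) : ℝ := max 1 (u ^ 3 / (P * m₁))

lemma one_le_repeats : 1 ≤ repeats u P m₁ := le_max_left _ _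

lemma top_scale_le (hu : 1 ≤ u) (hv : 0 < v) (hvu : v ^ 2 = u ^ 3) (hP : P ≤ u ^ 3)
    (hl : 1 ≤ l₂) (hm : v / l₂ ≤ m₁) (hm₁ : 1 ≤ m₁) (hA : a₂ = 1 ∨ a₂ ≤ P / l₂ / u ^ 2) :
    a₂ ≤ m₁ := by
  rcases hA with rfl | hA
  · exact hm₁
  · refine hA.trans (le_trans ?_ hm)
    rw [div_right_comm]
    gcongr
    rw [div_le_iff₀ (by positivity)]
    have h1 : u ≤ v := by
      refine le_of_sq_le_sq ?_ hv.le
      nlinarith [mul_le_mul_of_nonneg_left hu (sq_nonneg u)]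
    nlinarith [mul_le_mul_of_nonneg_right h1 (sq_nonneg u)]

lemma top_scale_mul_le (hu : 1 ≤ u) (hv : 0 < v) (hvu : v ^ 2 = u ^ 3) (hP : u ^ 2 ≤ P)
    (hl : 1 ≤ l₂) (hm : v / l₂ ≤ m₁) (hA : a₂ ≤ P / l₂ / u ^ 2) : a₂ * u ^ 3 ≤ P * m₁ := by
  have h1 : u ≤ v := by
    refine le_of_sq_le_sq ?_ hv.le
    nlinarith [mul_le_mul_of_nonneg_left hu (sq_nonneg u)]
  have hP0 : 0 < P := lt_of_lt_of_le (by positivity) hP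
  calc a₂ * u ^ 3 ≤ P / l₂ / u ^ 2 * u ^ 3 := by gcongr
    _ = P * (u / l₂) := by field_simp
    _ ≤ P * (v / l₂) := by gcongr
    _ ≤ P * m₁ := by gcongr

lemma top_scale_mul_le_repeats (hu : 1 ≤ u) (hv : 0 < v) (hvu : v ^ 2 = u ^ 3) (hP : u ^ 2 ≤ P)
    (hl : 1 ≤ l₂) (hm : v / l₂ ≤ m₁) (hm₁ : 1 ≤ m₁) (hA : a₂ = 1 ∨ a₂ ≤ P / l₂ / u ^ 2) :
    a₂ * u ^ 3 ≤ repeats u P m₁ * (P * m₁) := by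
  have hP0 : 0 < P := lt_of_lt_of_le (by positivity) hP
  have hPm : 0 < P * m₁ := by positivity
  rcases hA with rfl | hA
  · rw [one_mul, ← div_le_iff₀ hPm]
    exact le_max_right _ _
  · exact (top_scale_mul_le hu hv hvu hP hl hm hA).trans
      (le_mul_of_one_le_left hPm.le one_le_repeats)

lemma repeats_eq_one (hP : 0 < P) (hm₁ : 1 ≤ m₁) (h : u ^ 3 ≤ P * m₁) :
    repeats u P m₁ = 1 :=
  max_eq_left ((div_le_one (by positivity)).2 h)

lemma repeats_mul_top_scale_le (hu : 1 ≤ u) (hv : 0 < v) (hvu : v ^ 2 = u ^ 3) (hP : u ^ 2 ≤ P)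
    (hP' : P ≤ u ^ 3) (hl : 1 ≤ l₂) (hm : v / l₂ ≤ m₁) (hm₁ : 1 ≤ m₁) (ha : 1 ≤ a₂)
    (hA : a₂ = 1 ∨ a₂ ≤ P / l₂ / u ^ 2) : repeats u P m₁ * a₂ ≤ u := by
  have hP0 : 0 < P := lt_of_lt_of_le (by positivity) hP
  rcases hA with rfl | hA
  · rw [mul_one]
    refine max_le hu ?_
    rw [div_le_iff₀ (by positivity)]
    have h1 : u ^ 2 ≤ P * m₁ := hP.trans (le_mul_of_one_le_right hP0.le hm₁)
    calc u ^ 3 = u * u ^ 2 := by ring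
      _ ≤ u * (P * m₁) := by gcongr
  · have h1 := top_scale_mul_le hu hv hvu hP hl hm hA
    have h2 : u ^ 3 ≤ P * m₁ := le_trans (le_mul_of_one_le_left (by positivity) ha) h1
    rw [repeats_eq_one hP0 hm₁ h2, one_mul]
    refine hA.trans ?_
    rw [div_div, div_le_iff₀ (by positivity)]
    have : u ^ 2 ≤ l₂ * u ^ 2 := le_mul_of_one_le_left (by positivity) hl
    calc P ≤ u * u ^ 2 := by rw [← pow_succ']; exact hP'
      _ ≤ u * (l₂ * u ^ 2) := by gcongr

lemma repeats_mul_samples_le (hu : 1 ≤ u) (hv : 0 < v) (hvu : v ^ 2 = u ^ 3) (hP : u ^ 2 ≤ P)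
    (hl : 1 ≤ l₂) (hm : v / l₂ ≤ m₁) (hm₁ : 1 ≤ m₁) (ha : 1 ≤ a₂)
    (hA : a₂ = 1 ∨ a₂ ≤ P / l₂ / u ^ 2) (hA' : P / l₂ / u ^ 2 < 2 * a₂) {H : ℝ} (hH : 0 ≤ H) :
    repeats u P m₁ * (H / (l₂ * a₂)) ≤ 2 * u ^ 2 * (H / P) := by
  have hP0 : 0 < P := lt_of_lt_of_le (by positivity) hP
  by_cases h2 : u ^ 3 ≤ P * m₁
  · rw [repeats_eq_one hP0 hm₁ h2, one_mul, div_div, div_lt_iff₀ (by positivity)] at *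
    rw [← mul_div_assoc, div_le_div_iff₀ (by positivity) hP0]
    calc H * P ≤ H * (2 * a₂ * (l₂ * u ^ 2)) := by gcongr
      _ = 2 * u ^ 2 * H * (l₂ * a₂) := by ring
  · have hA1 : a₂ = 1 := hA.resolve_right fun hA => h2 <|
      le_trans (le_mul_of_one_le_left (by positivity) ha) (top_scale_mul_le hu hv hvu hP hl hm hA)
    subst hA1
    have h3 : repeats u P m₁ = u ^ 3 / (P * m₁) :=
      max_eq_right ((one_le_div (by positivity)).2 (not_le.1 h2).le)
    have hvu2 : v ≤ u ^ 2 := by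
      refine le_of_sq_le_sq ?_ (by positivity)
      rw [hvu]
      calc u ^ 3 = u ^ 3 * 1 := (mul_one _).symm
        _ ≤ u ^ 3 * u := by gcongr
        _ = (u ^ 2) ^ 2 := by ring
    have hm2 : v ≤ m₁ * l₂ := (div_le_iff₀ (by positivity)).1 hm
    rw [h3, mul_one, div_mul_div_comm, ← hvu, ← mul_div_assoc,
      div_le_div_iff₀ (by positivity) hP0]
    have h4 : v * v ≤ 2 * u ^ 2 * (m₁ * l₂) := by
      calc v * v ≤ u ^ 2 * (m₁ * l₂) := by gcongr
        _ ≤ 2 * u ^ 2 * (m₁ * l₂) := by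
          have : 0 ≤ u ^ 2 * (m₁ * l₂) := by positivity
          linarith
    calc v ^ 2 * H * P = (v * v) * (H * P) := by ring
      _ ≤ (2 * u ^ 2 * (m₁ * l₂)) * (H * P) := by gcongr
      _ = 2 * u ^ 2 * H * (P * m₁ * l₂) := by ring

end Parameters

/-- Repeated attempts at all scales. -/
noncomputable def directedSearch (σ : Bool) (q m A : ℕ) (M : ℕ → ℕ) (b N : ℕ) :
    QueryAlg n (Answer n) :=
  tryAll ((List.range (A + 1)).map fun a =>
    tryAll (List.replicate N (attempt σ q m A a (M a) b)))

lemma queries_directedSearch_le (σ : Bool) (q m A : ℕ) (M : ℕ → ℕ) (b N B : ℕ)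
    (h : ∀ a ≤ A, M a * 2 ^ (A - a) ≤ B) :
    (directedSearch σ q m A M b N : QueryAlg n (Answer n)).queries ≤
      (A + 1) * (N * ((B + b) * (q + 5) + 4) + 4) := by
  refine (queries_tryAll_le (B := N * ((B + b) * (q + 5) + 4)) ?_).trans_eq (by simp)
  intro alg halg
  obtain ⟨a, ha, rfl⟩ := List.mem_map.1 halg
  have ha' : a ≤ A := Nat.lt_succ_iff.1 (List.mem_range.1 ha)
  refine (queries_tryAll_le (B := (B + b) * (q + 5)) ?_).trans_eq (by simp)
  intro alg halg
  rw [List.eq_of_mem_replicate halg]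
  refine (queries_attempt_le ..).trans ?_
  rw [← mul_assoc, add_mul]
  gcongr
  · exact h a ha'
  · norm_num

lemma le_success_directedSearch (f : Point n → Bool) {σ : Bool} {q m A : ℕ} {M : ℕ → ℕ} {b N a : ℕ}
    {p : ℝ} (ha : a ≤ A) (h : p ≤ (attempt σ q m A a (M a) b).success f) (hN : 2 ≤ N * p) :
    2 / 3 ≤ (directedSearch σ q m A M b N).success f := by
  refine (success_amplify f (hN.trans ?_)).trans (success_le_tryAll f
    (List.mem_map.2 ⟨a, List.mem_range.2 (Nat.lt_succ_of_le ha), rfl⟩))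
  gcongr

/-! ### Functions of small total influence -/

lemma exists_dyadic_scale (r : ℝ) :
    ∃ A : ℕ, (A = 0 ∨ (2 : ℝ) ^ A ≤ r) ∧ r < 2 * 2 ^ A := by
  rcases lt_or_ge r 1 with hr | hr
  · exact ⟨0, Or.inl rfl, by norm_num; linarith⟩
  · have h0 : ⌊r⌋₊ ≠ 0 := (Nat.floor_pos.2 hr).ne'
    refine ⟨Nat.log 2 ⌊r⌋₊, Or.inr ?_, ?_⟩
    · refine le_trans ?_ (Nat.floor_le (zero_le_one.trans hr))
      exact_mod_cast Nat.pow_log_le_self 2 h0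
    · have h1 : ⌊r⌋₊ < 2 ^ (Nat.log 2 ⌊r⌋₊ + 1) := Nat.lt_pow_succ_log_self one_lt_two _
      have h2 := (Nat.floor_lt (zero_le_one.trans hr)).1 h1
      push_cast at h2
      rw [pow_succ'] at h2
      exact h2

/-- The search depth `q`: halving `q - 2` times reduces any set of variables to one variable. -/
lemma exists_depth (hn : 1 ≤ n) :
    ∃ q : ℕ, 4 * (n : ℝ) ≤ 2 ^ q ∧ (q : ℝ) ≤ Real.logb 2 n + 3 ∧ 1 ≤ q := by
  refine ⟨Nat.clog 2 n + 2, ?_, ?_, by omega⟩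
  · have : n ≤ 2 ^ Nat.clog 2 n := Nat.le_pow_clog one_lt_two n
    have h : (n : ℝ) ≤ 2 ^ Nat.clog 2 n := by exact_mod_cast this
    rw [pow_add]
    linarith
  · have h : (Nat.clog 2 n : ℝ) ≤ Real.logb 2 n + 1 := by
      rcases hn.eq_or_lt with rfl | hn
      · simp
      · have h1 : 2 ^ (Nat.clog 2 n).pred < n := Nat.pow_pred_clog_lt_self one_lt_two hn
        have h2 : (2 : ℝ) ^ (Nat.clog 2 n).pred ≤ n := by exact_mod_cast h1.le
        have h3 : ((Nat.clog 2 n).pred : ℝ) ≤ Real.logb 2 n := by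
          rw [Real.le_logb_iff_rpow_le one_lt_two (by positivity), Real.rpow_natCast]
          exact h2
        have h4 : Nat.clog 2 n ≤ (Nat.clog 2 n).pred + 1 := by
          rw [Nat.pred_eq_sub_one]; omega
        have h5 : (Nat.clog 2 n : ℝ) ≤ (Nat.clog 2 n).pred + 1 := by exact_mod_cast h4
        linarith
    push_cast
    linarith

section Rates

variable {u P m₁ a₂ E W Λ A η : ℝ}

lemma samples_mul_rate_le_one (hu : 1 ≤ u) (hP : 0 < P) (hm₁ : 1 ≤ m₁) (ha : 1 ≤ a₂) (hE : 0 < E)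
    (hW : 1 ≤ W) (hΛ : 1 ≤ Λ) (hA : 0 ≤ A) (hη0 : 0 < η) (hη1 : η ≤ 1)
    (hcover : a₂ * u ^ 3 ≤ W * (P * m₁)) :
    u ^ 2 / (E * W) * (a₂ * (η * (E / Λ ^ 13 * (u / P) / 2) / (32 * m₁ * (A + 1)))) ≤ 1 := by
  have e : u ^ 2 / (E * W) * (a₂ * (η * (E / Λ ^ 13 * (u / P) / 2) / (32 * m₁ * (A + 1)))) =
      η * (a₂ * u ^ 3 / (W * (P * m₁))) / (64 * (Λ ^ 13 * (A + 1))) := by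
    field_simp
    norm_num
  have h1 : 1 ≤ Λ ^ 13 * (A + 1) := one_le_mul_of_one_le_of_one_le (one_le_pow₀ hΛ) (by linarith)
  have h2 := mul_le_one₀ hη1 (by positivity)
    (div_le_one_of_le₀ hcover (by positivity) : a₂ * u ^ 3 / (W * (P * m₁)) ≤ 1)
  rw [e, div_le_one (by positivity)]
  linarith

lemma rate_le_one (hu : 1 ≤ u) (hP : u ^ 2 ≤ P) (hm₁ : 1 ≤ m₁) (ha : 1 ≤ a₂) (ham : a₂ ≤ m₁)
    (hau : a₂ ≤ u) (hE : 0 < E) (hE1 : E ≤ 1) (hΛ : 1 ≤ Λ) (hA : 0 ≤ A) (hη0 : 0 < η)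
    (hη1 : η ≤ 1) :
    a₂ * (a₂ * (η * (E / Λ ^ 13 * (u / P) / 2) / (32 * m₁ * (A + 1)))) ≤ 1 := by
  have hP0 : 0 < P := lt_of_lt_of_le (by positivity) hP
  have h1 : E / Λ ^ 13 ≤ 1 := (div_le_one (by positivity)).2 (hE1.trans (one_le_pow₀ hΛ))
  have h2 : a₂ * (u / P) ≤ 1 := by
    rw [← mul_div_assoc, div_le_one hP0]
    nlinarith
  have h3 : a₂ / (m₁ * (A + 1)) ≤ 1 := by
    rw [div_le_one (by positivity)]
    nlinarith
  calc a₂ * (a₂ * (η * (E / Λ ^ 13 * (u / P) / 2) / (32 * m₁ * (A + 1))))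
      = η * (E / Λ ^ 13) * (a₂ * (u / P)) * (a₂ / (m₁ * (A + 1))) / 64 := by
        field_simp
        norm_num
    _ ≤ 1 / 64 := by
        gcongr
        exact mul_le_one₀ (mul_le_one₀ (mul_le_one₀ hη1 (by positivity) h1) (by positivity) h2)
          (by positivity) h3
    _ ≤ 1 := by norm_num

lemma attempt_yield_eq (hu : 1 ≤ u) (hP : 0 < P) (hm₁ : 1 ≤ m₁) (hE : 0 < E) (hW : 1 ≤ W)
    (hΛ : 1 ≤ Λ) (hA : 0 ≤ A) :
    u ^ 2 / (E * W) * (η * (E / Λ ^ 13 * (u / P) / 2) / (32 * m₁ * (A + 1))) *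
      (P * (m₁ / u ^ 3)) = η / (64 * (Λ ^ 13 * (A + 1) * W)) := by
  field_simp
  ring

/-- A lower bound for the success probability of one attempt. -/
lemma inv_le_attempt_success {q : ℝ} (hq : 1 ≤ q) (hW : 1 ≤ W) (hΛ : 1 ≤ Λ) (hA : 0 ≤ A) :
    1 / (1310720 * q * Λ ^ 13 * (A + 1) ^ 3 * W) ≤
      (1 / (16 * (A + 1))) ^ 2 * (1 / (8 * q) / (64 * (Λ ^ 13 * (A + 1) * W))) /
        (1 / (8 * q) / (64 * (Λ ^ 13 * (A + 1) * W)) + 9) := by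
  have h1 : 1 ≤ Λ ^ 13 * (A + 1) * W :=
    one_le_mul_of_one_le_of_one_le
      (one_le_mul_of_one_le_of_one_le (one_le_pow₀ hΛ) (by linarith)) hW
  obtain ⟨z, hz⟩ : ∃ z, z = 1 / (8 * q) / (64 * (Λ ^ 13 * (A + 1) * W)) := ⟨_, rfl⟩
  have hz0 : 0 < z := hz ▸ by positivity
  have hz1 : z ≤ 1 := by
    rw [hz, div_div, div_le_one (by positivity)]
    nlinarith
  rw [← hz]
  calc 1 / (1310720 * q * Λ ^ 13 * (A + 1) ^ 3 * W) = (1 / (16 * (A + 1))) ^ 2 * z / 10 := by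
        rw [hz]
        field_simp
        norm_num
    _ ≤ (1 / (16 * (A + 1))) ^ 2 * z / (z + 9) := by
        gcongr
        linarith

end Rates

section Cost

variable {u P m₁ a₂ l₂ E W Λ L₀ c H A q N B b : ℝ}

/-- The number of queries of all attempts together. Here `3 * D * W` bounds the number of attempts
at each scale, where `D` is polylogarithmic. -/
lemma total_cost_le (hu : 1 ≤ u) (hE : 0 < E) (hE1 : E ≤ 1) (hP : 0 < P) (hW : 1 ≤ W)
    (ha : 0 < a₂) (hl : 0 < l₂) (hH : 0 < H) (hc : 0 < c) (hΛ : 1 ≤ Λ) (hΛL : Λ ≤ 3 * L₀)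
    (hA0 : 0 ≤ A) (hA : A + 1 ≤ 2 * L₀) (hq1 : 1 ≤ q) (hq : q ≤ 4 * L₀) (hq5 : q + 5 ≤ 9 * L₀)
    (hWa : W * a₂ ≤ u) (hWu : W ≤ u) (hWb : W * (H / (l₂ * a₂)) ≤ 2 * u ^ 2 * (H / P))
    (hcP : c * (E / Λ ^ 11) ≤ P / H)
    (hN1 : 1 ≤ N) (hN : N ≤ 3 * (1310720 * q * Λ ^ 13 * (A + 1) ^ 3 * W))
    (hB0 : 0 ≤ B) (hB : B ≤ u ^ 2 / (E * W) + a₂) (hb0 : 0 ≤ b)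
    (hb : b ≤ 1 / (l₂ / H / 4 * a₂) + 1) :
    (A + 1) * (N * ((B + b) * (q + 5) + 4) + 4) ≤
      (31457280 * 576 * 3 ^ 24) * (1 + 1 / c) * (u ^ 2 / E) * L₀ ^ 30 := by
  have hL : 0 < L₀ := by linarith
  have hΛ11 : 1 ≤ Λ ^ 11 := one_le_pow₀ hΛ
  have hU : u ≤ u ^ 2 / E := by
    rw [le_div_iff₀ hE]
    nlinarith
  have hU0 : 0 ≤ u ^ 2 / E := by positivity
  have hHP : H / P ≤ Λ ^ 11 / (c * E) := by
    rw [div_le_div_iff₀ hP (by positivity)]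
    rw [← mul_div_assoc, div_le_div_iff₀ (by positivity) hH] at hcP
    nlinarith
  have h1 : W * (B + b + 2) ≤ 8 * (u ^ 2 / E) * Λ ^ 11 * (1 + 1 / c) := by
    have e1 : W * (u ^ 2 / (E * W)) = u ^ 2 / E := by field_simp
    have e2 : W * (1 / (l₂ / H / 4 * a₂)) = 4 * (W * (H / (l₂ * a₂))) := by field_simp
    have e3 : 2 * u ^ 2 * (Λ ^ 11 / (c * E)) = 2 * (u ^ 2 / E) * Λ ^ 11 * (1 / c) := by field_simp
    have h2 : W * (B + b + 2) ≤
        W * (u ^ 2 / (E * W) + a₂ + (1 / (l₂ / H / 4 * a₂) + 1) + 2) := by gcongr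
    have h3 : 2 * u ^ 2 * (H / P) ≤ 2 * u ^ 2 * (Λ ^ 11 / (c * E)) := by gcongr
    have h4 : u ^ 2 / E ≤ (u ^ 2 / E) * Λ ^ 11 := le_mul_of_one_le_right hU0 hΛ11
    have h5 : W * (u ^ 2 / (E * W) + a₂ + (1 / (l₂ / H / 4 * a₂) + 1) + 2) =
        u ^ 2 / E + W * a₂ + 4 * (W * (H / (l₂ * a₂))) + 3 * W := by
      rw [← e1, ← e2]; ring
    nlinarith
  have h2 : N * ((B + b) * (q + 5) + 4) + 4 ≤ N * ((B + b + 2) * (q + 5)) := by nlinarith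
  calc (A + 1) * (N * ((B + b) * (q + 5) + 4) + 4)
      ≤ (A + 1) * (N * ((B + b + 2) * (q + 5))) := by gcongr
    _ ≤ (A + 1) * (3 * (1310720 * q * Λ ^ 13 * (A + 1) ^ 3 * W) * ((B + b + 2) * (q + 5))) := by
        gcongr
    _ = 3932160 * (A + 1) ^ 4 * q * (q + 5) * Λ ^ 13 * (W * (B + b + 2)) := by ring
    _ ≤ 3932160 * (2 * L₀) ^ 4 * (4 * L₀) * (9 * L₀) * Λ ^ 13 *
          (8 * (u ^ 2 / E) * Λ ^ 11 * (1 + 1 / c)) := by gcongr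
    _ = 31457280 * 576 * (1 + 1 / c) * (u ^ 2 / E) * L₀ ^ 6 * Λ ^ 24 := by ring
    _ ≤ 31457280 * 576 * (1 + 1 / c) * (u ^ 2 / E) * L₀ ^ 6 * (3 * L₀) ^ 24 := by gcongr
    _ = _ := by ring

end Cost

lemma le_logb_of_two_pow_le {A : ℕ} {r : ℝ} (h : (2 : ℝ) ^ A ≤ r) : (A : ℝ) ≤ Real.logb 2 r := by
  rw [Real.le_logb_iff_rpow_le one_lt_two (lt_of_lt_of_le (by positivity) h), Real.rpow_natCast]
  exact h

lemma logb_le_logb_div {ε : ℝ} (hn : 0 < n) (hε0 : 0 < ε) (hε1 : ε ≤ 1) :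
    Real.logb 2 n ≤ Real.logb 2 (n / ε) := by
  have : (0 : ℝ) < n := by exact_mod_cast hn
  exact Real.logb_le_logb_of_le one_lt_two this (le_div_self this.le hε0 hε1)

set_option maxHeartbeats 600000 in
/-- If the total influence is small, then a search directed at edges with direction `σ` along
influential variables, and at `l`-strong edges with the opposite direction, succeeds. -/
lemma exists_directedSearch {c ε : ℝ} (hc : 0 < c) (hε0 : 0 < ε) (hε1 : ε ≤ 1) {l h ℓ : ℕ}
    (hl : 1 ≤ l) (hL : 54 ≤ Real.logb 2 n) (h1 : (n : ℝ) ^ (2 / 3 : ℝ) ≤ 2 ^ ℓ)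
    (h2 : (2 : ℝ) ^ ℓ ≤ n) (hch : c * (ε ^ 2 / (Lam n ε : ℝ) ^ 11) ≤ 2 ^ ℓ / 2 ^ h) (σ : Bool) :
    ∃ A : QueryAlg n (Answer n), (A.queries : ℝ) ≤
      (31457280 * 576 * 3 ^ 24) * (1 + 1 / c) * ((n : ℝ) ^ (2 / 3 : ℝ) / ε ^ 2) *
        Real.logb 2 (n / ε) ^ 30 ∧
      ∀ (f : Point n → Bool) (I : Finset (Fin n)), I.card = 2 ^ ℓ →
        ∑ i, influence f i ≤ (n : ℝ) ^ (2 / 3 : ℝ) / 144 →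
        (∀ i ∈ I, (2 : ℝ) ^ l / 2 ^ h ≤ 𝔼 x, ind (IsScored f ε (!σ) l i x)) →
        ∀ J ⊆ I, (I.card : ℝ) / 4 ≤ J.card →
          (∀ i ∈ J, infThreshold n ε I.card / 2 ≤ dirInf f σ i) → 2 / 3 ≤ A.success f := by
  have hn : 2 ≤ n := by
    by_contra hn
    have : n = 0 ∨ n = 1 := by omega
    rcases this with rfl | rfl <;> norm_num at hL
  have hnR : (2 : ℝ) ≤ n := by exact_mod_cast hn
  have hn0 : (0 : ℝ) < n := by linarith
  -- the powers of `n` in terms of `u = n ^ (1 / 3)` and `v = √n`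
  set u : ℝ := (n : ℝ) ^ (1 / 3 : ℝ) with hu_def
  set v : ℝ := √(n : ℝ) with hv_def
  set P : ℝ := 2 ^ ℓ with hP_def
  set H : ℝ := 2 ^ h with hH_def
  set l₂ : ℝ := 2 ^ l with hl₂_def
  have hu : 1 ≤ u := Real.one_le_rpow (by linarith) (by norm_num)
  have hu2 : (n : ℝ) ^ (2 / 3 : ℝ) = u ^ 2 := by
    rw [hu_def, ← Real.rpow_natCast, ← Real.rpow_mul hn0.le]; norm_num
  have hu3 : u ^ 3 = n := by
    rw [hu_def, ← Real.rpow_natCast, ← Real.rpow_mul hn0.le]; norm_num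
  have hv : 0 < v := Real.sqrt_pos.2 hn0
  have hvu : v ^ 2 = u ^ 3 := by rw [hu3, hv_def, Real.sq_sqrt hn0.le]
  rw [hu2] at h1 ⊢
  have hP' : P ≤ u ^ 3 := by rwa [hu3]
  clear_value u v
  have hP0 : 0 < P := by positivity
  have hH0 : 0 < H := by positivity
  have hl2 : 2 ≤ l₂ := by
    calc (2 : ℝ) = 2 ^ 1 := by norm_num
      _ ≤ 2 ^ l := pow_le_pow_right₀ one_le_two hl
  have hl1 : 1 ≤ l₂ := by linarith
  clear_value P H l₂
  -- the size of the random sets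
  obtain ⟨m, hm⟩ : ∃ m, m = ⌈v / l₂⌉₊ := ⟨_, rfl⟩
  have hm0 : 1 ≤ m := hm ▸ Nat.one_le_iff_ne_zero.2 (Nat.ceil_pos.2 (by positivity)).ne'
  have hmv : v / l₂ ≤ m := hm ▸ Nat.le_ceil _
  have hmn : m + 1 ≤ n := by
    have hlt : (m : ℝ) < v / l₂ + 1 := hm ▸ Nat.ceil_lt_add_one (by positivity)
    have hvl : v / l₂ ≤ v / 2 := by gcongr
    have hvn : v / 2 + 1 ≤ n := by
      have h3 : v ^ 2 = n := by rw [hvu, hu3]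
      have h4 : (v - 1) ^ 2 = v ^ 2 - 2 * v + 1 := by ring
      have h5 := sq_nonneg (v - 1)
      linarith only [h3, h4, h5, hnR]
    have : (m : ℝ) < n := by linarith
    exact_mod_cast this
  obtain ⟨m₁, hm₁_def⟩ : ∃ m₁ : ℝ, m₁ = (m : ℝ) + 1 := ⟨_, rfl⟩
  have hm₁ : 1 ≤ m₁ := by rw [hm₁_def]; linarith [(Nat.cast_nonneg m : (0 : ℝ) ≤ m)]
  have hmv' : v / l₂ ≤ m₁ := by rw [hm₁_def]; linarith
  -- the number of scales
  obtain ⟨A, hA, hA'⟩ := exists_dyadic_scale (P / l₂ / u ^ 2)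
  obtain ⟨a₂, ha₂_def⟩ : ∃ a₂ : ℝ, a₂ = (2 : ℝ) ^ A := ⟨_, rfl⟩
  have ha : 1 ≤ a₂ := ha₂_def ▸ one_le_pow₀ one_le_two
  have hAa : a₂ = 1 ∨ a₂ ≤ P / l₂ / u ^ 2 := by
    rcases hA with rfl | hA
    · exact Or.inl (by simp [ha₂_def])
    · exact Or.inr (ha₂_def ▸ hA)
  rw [← ha₂_def] at hA'
  obtain ⟨W, hW_def⟩ : ∃ W, W = repeats u P m₁ := ⟨_, rfl⟩
  have hW1 : 1 ≤ W := hW_def ▸ one_le_repeats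
  have ham := top_scale_le hu hv hvu hP' hl1 hmv' hm₁ hAa
  have hcover : a₂ * u ^ 3 ≤ W * (P * m₁) :=
    hW_def ▸ top_scale_mul_le_repeats hu hv hvu h1 hl1 hmv' hm₁ hAa
  have hWa : W * a₂ ≤ u := hW_def ▸ repeats_mul_top_scale_le hu hv hvu h1 hP' hl1 hmv' hm₁ ha hAa
  have hWb : W * (H / (l₂ * a₂)) ≤ 2 * u ^ 2 * (H / P) :=
    hW_def ▸ repeats_mul_samples_le hu hv hvu h1 hl1 hmv' hm₁ ha hAa hA' hH0.le
  have hWu : W ≤ u := (le_mul_of_one_le_right (by linarith) ha).trans hWa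
  have hau : a₂ ≤ u := (le_mul_of_one_le_left (by linarith) hW1).trans hWa
  -- the logarithms
  obtain ⟨q, hq4, hqL, hq1⟩ := exists_depth (n := n) (by omega)
  set L := Real.logb 2 (n : ℝ) with hL_def
  set L₀ := Real.logb 2 ((n : ℝ) / ε) with hL₀_def
  have hLL : L ≤ L₀ := logb_le_logb_div (by omega) hε0 hε1
  have hlog8 : 8 * (q : ℝ) ≤ L ^ 2 := by
    have h3 : 54 * L ≤ L * L := by gcongr
    rw [sq]
    linarith only [h3, hqL, hL]
  have hΛ2 : (Lam n ε : ℝ) < 2 * L₀ + 1 := Nat.ceil_lt_add_one (by linarith)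
  have hΛ0 : 0 < Lam n ε := Nat.ceil_pos.2 (by linarith)
  clear_value L₀
  have hq1R : (1 : ℝ) ≤ q := by exact_mod_cast hq1
  obtain ⟨Λ, hΛ_def⟩ : ∃ Λ : ℝ, Λ = (Lam n ε : ℝ) := ⟨_, rfl⟩
  have hΛ1 : 1 ≤ Λ := by
    rw [hΛ_def]
    exact_mod_cast hΛ0
  have hΛL : Λ ≤ 3 * L₀ := by
    rw [hΛ_def]; linarith
  have hAL : (A : ℝ) + 1 ≤ 2 * L₀ := by
    have h3 : (A : ℝ) ≤ L := le_logb_of_two_pow_le (by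
      rw [← ha₂_def, ← hu3]
      exact hau.trans (le_self_pow₀ hu (by norm_num)))
    linarith
  clear_value L
  rw [← hΛ_def] at hch
  obtain ⟨E, hE_def⟩ : ∃ E : ℝ, E = ε ^ 2 := ⟨_, rfl⟩
  have hE0 : 0 < E := hE_def ▸ by positivity
  have hE1 : E ≤ 1 := hE_def ▸ pow_le_one₀ hε0.le hε1
  rw [← hE_def] at hch ⊢
  have hA0 : (0 : ℝ) ≤ A := Nat.cast_nonneg A
  -- the rest of the parameters
  obtain ⟨η, hη_def⟩ : ∃ η : ℝ, η = 1 / (8 * q) := ⟨_, rfl⟩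
  have hη0 : 0 < η := hη_def ▸ by positivity
  have hη1 : η ≤ 1 := by rw [hη_def, div_le_one (by positivity)]; linarith
  obtain ⟨w, hw_def⟩ : ∃ w : ℝ, w = l₂ / H / 4 := ⟨_, rfl⟩
  have hw0 : 0 < w := hw_def ▸ by positivity
  obtain ⟨d, hd_def⟩ : ∃ d : ℝ, d = E / Λ ^ 13 * (u / P) / 2 := ⟨_, rfl⟩
  have hd0 : 0 < d := hd_def ▸ by positivity
  obtain ⟨B, hB_def⟩ : ∃ B : ℝ, B = u ^ 2 / (E * W) := ⟨_, rfl⟩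
  have hB0 : 0 < B := hB_def ▸ by positivity
  obtain ⟨D, hD_def⟩ : ∃ D : ℝ, D = 1310720 * q * Λ ^ 13 * (A + 1) ^ 3 := ⟨_, rfl⟩
  have hD1 : 1 ≤ D := by
    have h3 : 1 ≤ Λ ^ 13 := one_le_pow₀ hΛ1
    have h4 : (1 : ℝ) ≤ (A + 1) ^ 3 := one_le_pow₀ (by linarith)
    have h5 : (1 : ℝ) ≤ 1310720 * q := by linarith
    rw [hD_def]
    exact one_le_mul_of_one_le_of_one_le (one_le_mul_of_one_le_of_one_le h5 h3) h4
  have hDW : 1 ≤ D * W := one_le_mul_of_one_le_of_one_le hD1 hW1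
  obtain ⟨b, hb_def⟩ : ∃ b : ℕ, b = ⌈1 / (w * a₂)⌉₊ := ⟨_, rfl⟩
  obtain ⟨M, hM_def⟩ : ∃ M : ℕ → ℕ, M = fun a => ⌈B / 2 ^ (A - a)⌉₊ := ⟨_, rfl⟩
  obtain ⟨N, hN_def⟩ : ∃ N : ℕ, N = ⌈2 * (D * W)⌉₊ := ⟨_, rfl⟩
  have hb_le : 1 / (w * a₂) ≤ b := hb_def ▸ Nat.le_ceil _
  have hb_lt : (b : ℝ) ≤ 1 / (w * a₂) + 1 := hb_def ▸ (Nat.ceil_lt_add_one (by positivity)).le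
  have hM_le : ∀ a, B / 2 ^ (A - a) ≤ M a := fun a => hM_def ▸ Nat.le_ceil _
  have hM_lt : ∀ a, (M a : ℝ) ≤ B / 2 ^ (A - a) + 1 := fun a =>
    hM_def ▸ (Nat.ceil_lt_add_one (by positivity)).le
  have hN_le : 2 * (D * W) ≤ N := hN_def ▸ Nat.le_ceil _
  have hN_lt : (N : ℝ) ≤ 2 * (D * W) + 1 :=
    hN_def ▸ (Nat.ceil_lt_add_one (by positivity)).le
  refine ⟨directedSearch σ q m A M b N, ?_, ?_⟩
  · have hBM : ∀ a ≤ A, M a * 2 ^ (A - a) ≤ ⌊B + a₂⌋₊ := by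
      intro a _
      refine Nat.le_floor ?_
      push_cast
      calc (M a : ℝ) * 2 ^ (A - a) ≤ (B / 2 ^ (A - a) + 1) * 2 ^ (A - a) := by
            gcongr; exact hM_lt a
        _ = B + 2 ^ (A - a) := by field_simp
        _ ≤ B + a₂ := by
            rw [ha₂_def]
            gcongr
            · norm_num
            · omega
    have hcost := queries_directedSearch_le (n := n) σ q m A M b N _ hBM
    have hcost' : ((directedSearch σ q m A M b N : QueryAlg n (Answer n)).queries : ℝ) ≤
        ((A + 1) * (N * ((⌊B + a₂⌋₊ + b) * (q + 5) + 4) + 4) : ℕ) := by exact_mod_cast hcost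
    refine hcost'.trans ?_
    push_cast
    refine total_cost_le hu hE0 hE1 hP0 hW1 (by linarith) (by linarith) hH0 hc hΛ1 hΛL hA0 hAL
      hq1R (by linarith) (by linarith) hWa hWu hWb hch (by linarith) ?_ (Nat.cast_nonneg _) ?_
      (Nat.cast_nonneg _) ?_
    · rw [← hD_def]; linarith
    · rw [← hB_def]; exact Nat.floor_le (by linarith)
    · rw [← hw_def]; exact hb_lt
  · intro f I hI hT hscore J hJI hJ hJd
    have hIP : (I.card : ℝ) = P := by rw [hI, hP_def]; push_cast; rfl
    have hne : I.Nonempty := card_pos.1 (by rw [hI]; positivity)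
    have hw4 : l₂ / H = 4 * w := by rw [hw_def]; ring
    rw [hw4] at hscore
    have haw : a₂ * w ≤ 1 := by
      rcases hAa with hA1 | hA1
      · obtain ⟨i, hi⟩ := hne
        have h3 := hscore i hi
        have h4 : 𝔼 x, ind (IsScored f ε (!σ) l i x) ≤ 1 :=
          expect_le univ_nonempty fun x _ => ind_le_one _
        rw [hA1]; linarith
      · have h3 : P * (4 * w) ≤ ∑ i, influence f i := by
          rw [← hIP, ← nsmul_eq_mul, ← sum_const]
          calc ∑ i ∈ I, 4 * w ≤ ∑ i ∈ I, influence f i := sum_le_sum fun i hi =>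
                (hscore i hi).trans (expect_isScored_le_influence f ε _ l i)
            _ ≤ ∑ i, influence f i :=
                sum_le_sum_of_subset_of_nonneg (subset_univ _) fun i _ _ => influence_nonneg f i
        have hu20 : 0 < u ^ 2 := by positivity
        have h5 : P / l₂ ≤ P := div_le_self hP0.le hl1
        calc a₂ * w ≤ P / l₂ / u ^ 2 * w := by gcongr
          _ ≤ P / u ^ 2 * w := by gcongr
          _ = P * w / u ^ 2 := by ring
          _ ≤ 1 := by
            have h6 : 0 ≤ P * w := by positivity
            rw [div_le_one hu20]
            linarith only [h3, hT, h6]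
    have hrate : ∀ a, groupRate m A a η d =
        2 ^ (A - a) * (a₂ * (η * d / (32 * m₁ * (A + 1)))) := by
      intro a
      rw [groupRate, ← hm₁_def, ← ha₂_def]
      field_simp
      ring
    have hρ : B * (a₂ * (η * d / (32 * m₁ * (A + 1)))) ≤ 1 := by
      rw [hB_def, hd_def]
      exact samples_mul_rate_le_one hu hP0 hm₁ ha hE0 hW1 hΛ1 hA0 hη0 hη1 hcover
    have hρ1 : ∀ a, groupRate m A a η d ≤ 1 := by
      intro a
      have h3 : (2 : ℝ) ^ (A - a) ≤ a₂ := by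
        rw [ha₂_def]
        gcongr
        · norm_num
        · omega
      calc groupRate m A a η d ≤ a₂ * (a₂ * (η * d / (32 * m₁ * (A + 1)))) := by
            rw [hrate]; gcongr
        _ ≤ 1 := by
            rw [hd_def]
            exact rate_le_one hu h1 hm₁ ha ham hau hE0 hE1 hΛ1 hA0 hη0 hη1
    have h2A : 2 ^ A ≤ m + 1 := by
      have : (2 : ℝ) ^ A ≤ ((m + 1 : ℕ) : ℝ) := by
        push_cast
        rw [← ha₂_def, ← hm₁_def]
        exact ham
      exact_mod_cast this
    have hηq : q * (2 * η) ≤ 1 / 4 := by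
      rw [hη_def]
      field_simp
      norm_num
    have hmq : ((m : ℝ) + 1) / 2 ^ q ≤ 1 / 4 := by
      rw [div_le_iff₀ (by positivity)]
      have : (m : ℝ) + 1 ≤ n := by exact_mod_cast hmn
      linarith
    have hsteady : ∀ i ∈ I, ∀ x, IsScored f ε (!σ) l i x →
        𝔼 Q ∈ (univ.erase i).powersetCard m, ind (¬Steady f Q i η m x) ≤ 1 / 8 := by
      intro i _ x hx
      have hη2 : 1 / Real.logb 2 (n : ℝ) ^ 2 ≤ η := by
        rw [hη_def, ← hL_def]
        exact one_div_le_one_div_of_le (by positivity) hlog8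
      refine (expect_not_steady_le f hm0 hmn (by rw [hm, hv_def, hl₂_def]) hη2 hx.2.2).trans ?_
      rw [← hL_def]
      exact one_div_le_one_div_of_le (by norm_num) (by linarith)
    have hJd' : ∀ i ∈ J, d ≤ dirInf f σ i := by
      intro i hi
      refine le_trans (le_of_eq ?_) (hJd i hi)
      rw [infThreshold, hIP, ← hE_def, ← hΛ_def, hd_def, hu_def]
    have hinf : A = 0 ∨ 4 * 2 ^ A * ((8 / I.card + (m + 1) / n) * ∑ j, influence f j) ≤
        ((m : ℝ) + 1) / 4 := by
      rcases hA with hA | hA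
      · exact Or.inl hA
      · right
        rw [← ha₂_def] at hA
        have h3 := top_scale_mul_le hu hv hvu h1 hl1 hmv' hA
        have h4 : u ^ 3 ≤ P * m₁ := le_trans (le_mul_of_one_le_left (by positivity) ha) h3
        have h5 : 1 / P ≤ m₁ / n := by
          rw [div_le_div_iff₀ hP0 hn0, ← hu3]; linarith
        have h6 : 8 / P + m₁ / n ≤ 9 * (m₁ / n) := by
          have : 8 / P = 8 * (1 / P) := by ring
          linarith
        have hT0 : 0 ≤ ∑ j, influence f j := sum_nonneg fun j _ => influence_nonneg f j
        rw [hIP, ← hm₁_def, ← ha₂_def]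
        calc 4 * a₂ * ((8 / P + m₁ / n) * ∑ j, influence f j)
            ≤ 4 * u * ((9 * (m₁ / n)) * (u ^ 2 / 144)) := by gcongr
          _ = m₁ / 4 * (u ^ 3 / n) := by ring
          _ = m₁ / 4 := by rw [hu3, div_self hn0.ne', mul_one]
    have hM : ∀ a ≤ A, M a * groupRate m A a η d ≤ 2 := by
      intro a _
      have h3 : B / 2 ^ (A - a) * groupRate m A a η d =
          B * (a₂ * (η * d / (32 * m₁ * (A + 1)))) := by
        rw [hrate, ← mul_assoc, div_mul_cancel₀ _ (by positivity)]
      calc (M a : ℝ) * groupRate m A a η d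
          ≤ (B / 2 ^ (A - a) + 1) * groupRate m A a η d := by
            gcongr
            · rw [hrate]; positivity
            · exact hM_lt a
        _ ≤ 2 := by rw [add_mul, h3]; linarith [hρ1 a]
    have h4w : 4 * w / 4 = w := by ring
    have hb2 : b * 2 ^ A * (4 * w / 4) ≤ 2 := by
      rw [← ha₂_def, h4w]
      calc (b : ℝ) * a₂ * w ≤ (1 / (w * a₂) + 1) * a₂ * w := by gcongr
        _ = 1 + a₂ * w := by field_simp
        _ ≤ 2 := by linarith
    have hyM : ∀ a ≤ A, B * (η * d / (32 * m₁ * (A + 1))) ≤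
        M a * b * groupRate m A a η d * (4 * w / 4) := by
      intro a _
      have hr0 : 0 ≤ groupRate m A a η d := by rw [hrate]; positivity
      have e : ∀ x : ℝ, B / 2 ^ (A - a) * (1 / (w * a₂)) * (2 ^ (A - a) * (a₂ * x)) * w =
          B * x := fun x => by field_simp
      rw [← e, ← hrate, h4w]
      gcongr
      exact hM_le a
    obtain ⟨a, haA, hsucc⟩ := exists_le_success_attempt f hmn h2A hη0 hη1 hηq hmq
      (by positivity) (IsScored f ε (!σ) l) (fun i _ x hx => hx.2.1) hscore hsteady hd0 hJI hJ
      hJd' hinf M b hM hb2 (by positivity) hyM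
    -- the success probability of one attempt
    refine le_success_directedSearch f haA (p := 1 / (D * W)) (le_trans ?_ hsucc) ?_
    · have e : B * (η * d / (32 * m₁ * (A + 1))) * (I.card * ((m + 1) / n)) =
          η / (64 * (Λ ^ 13 * (A + 1) * W)) := by
        rw [hIP, ← hm₁_def, hB_def, hd_def, ← hu3]
        exact attempt_yield_eq hu hP0 hm₁ hE0 hW1 hΛ1 hA0
      rw [e, hη_def, hD_def]
      exact inv_le_attempt_success hq1R hW1 hΛ1 hA0
    · rw [mul_one_div, le_div_iff₀ (by positivity)]
      exact hN_le

/-! ### Combining the searches -/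

lemma exists_randomPairs (hL : 54 ≤ Real.logb 2 n) :
    ∃ A : QueryAlg n (Answer n), (A.queries : ℝ) ≤ 2654212 * (n : ℝ) ^ (2 / 3 : ℝ) ∧
      ∀ f : Point n → Bool, (n : ℝ) ^ (2 / 3 : ℝ) / 144 < ∑ i, influence f i →
        2 / 3 ≤ A.success f := by
  have hn : 0 < n := by
    by_contra hn
    obtain rfl : n = 0 := by omega
    norm_num at hL
  have hn0 : (0 : ℝ) < n := by exact_mod_cast hn
  set u : ℝ := (n : ℝ) ^ (1 / 3 : ℝ) with hu_def
  set v : ℝ := √(n : ℝ) with hv_def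
  have hu2 : (n : ℝ) ^ (2 / 3 : ℝ) = u ^ 2 := by
    rw [hu_def, ← Real.rpow_natCast, ← Real.rpow_mul hn0.le]; norm_num
  have hu3 : (n : ℝ) = u ^ 3 := by
    rw [hu_def, ← Real.rpow_natCast, ← Real.rpow_mul hn0.le]; norm_num
  have hv : 0 < v := Real.sqrt_pos.2 hn0
  have hvn : v ^ 2 = n := by rw [hv_def, Real.sq_sqrt hn0.le]
  have hu : (2 : ℝ) ^ 18 ≤ u := by
    have h1 : (2 : ℝ) ^ (54 : ℝ) ≤ n := (Real.le_logb_iff_rpow_le one_lt_two hn0).1 hL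
    calc (2 : ℝ) ^ 18 = ((2 : ℝ) ^ (54 : ℝ)) ^ (1 / 3 : ℝ) := by
          rw [← Real.rpow_mul zero_le_two, ← Real.rpow_natCast]; norm_num
      _ ≤ u := Real.rpow_le_rpow (by positivity) h1 (by norm_num)
  rw [hu2]
  have hu0 : 0 < u := lt_of_lt_of_le (by norm_num) hu
  clear_value u v
  have hvu : v ≤ u ^ 2 / 288 := by
    refine le_of_sq_le_sq ?_ (by positivity)
    rw [hvn, hu3]
    have h1 : u ^ 3 * 82944 ≤ u ^ 3 * u := by
      gcongr
      exact le_trans (by norm_num) hu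
    calc u ^ 3 ≤ u ^ 3 * u / 82944 := by rw [le_div_iff₀ (by norm_num)]; exact h1
      _ = (u ^ 2 / 288) ^ 2 := by ring
  obtain ⟨N, hN⟩ : ∃ N : ℕ, N = ⌈663552 * u ^ 2⌉₊ := ⟨_, rfl⟩
  have hN1 : 663552 * u ^ 2 ≤ N := hN ▸ Nat.le_ceil _
  have hN2 : (N : ℝ) ≤ 663552 * u ^ 2 + 1 := hN ▸ (Nat.ceil_lt_add_one (by positivity)).le
  refine ⟨tryAll (List.replicate N (randomPair n)), ?_, fun f hT => success_amplify f ?_⟩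
  · have h1 : (tryAll (List.replicate N (randomPair n))).queries ≤ N * (0 + 4) := by
      refine (queries_tryAll_le (B := 0) ?_).trans_eq (by simp)
      intro alg halg
      rw [List.eq_of_mem_replicate halg]
      exact (queries_pick _).le
    have h2 : ((tryAll (List.replicate N (randomPair n))).queries : ℝ) ≤ N * (0 + 4) := by
      exact_mod_cast h1
    have h3 : 1 ≤ u ^ 2 := one_le_pow₀ (le_trans (by norm_num) hu)
    linarith
  · have h1 := le_success_randomPair f hn (by rw [← hv_def]; linarith)
    rw [← hv_def] at h1
    have h2 : (u ^ 2 / 288 / (2 * n)) ^ 2 ≤ ((∑ i, influence f i - v) / (2 * n)) ^ 2 := by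
      gcongr
      linarith
    calc (2 : ℝ) = 663552 * u ^ 2 * (u ^ 2 / 288 / (2 * n)) ^ 2 := by
          rw [hu3]; field_simp; norm_num
      _ ≤ N * (randomPair n).success f := by
          gcongr
          exact h2.trans h1

/-- Among many influential variables, many are influential in the same direction. -/
lemma exists_direction (f : Point n → Bool) {I : Finset (Fin n)} {τ : ℝ}
    (h : (I.card : ℝ) / 2 ≤ Set.ncard {i : Fin n | i ∈ I ∧ τ < influence f i}) :
    ∃ σ : Bool, ∃ J ⊆ I, (I.card : ℝ) / 4 ≤ J.card ∧ ∀ i ∈ J, τ / 2 ≤ dirInf f σ i := by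
  classical
  set J : Bool → Finset (Fin n) := fun σ => I.filter fun i => τ / 2 ≤ dirInf f σ i with hJ
  have h1 : {i : Fin n | i ∈ I ∧ τ < influence f i} ⊆ (J true ∪ J false : Finset (Fin n)) := by
    rintro i ⟨hi, hτ⟩
    rw [← dirInf_add] at hτ
    simp only [hJ, coe_union, Set.mem_union, mem_coe, mem_filter]
    by_cases h2 : τ / 2 ≤ dirInf f true i
    · exact Or.inl ⟨hi, h2⟩
    · exact Or.inr ⟨hi, by linarith⟩
  have h2 := (Set.ncard_le_ncard h1 (Finset.finite_toSet _)).trans_eq (Set.ncard_coe_finset _)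
  have h3 : ((Set.ncard {i : Fin n | i ∈ I ∧ τ < influence f i} : ℕ) : ℝ) ≤
      (J true).card + (J false).card := by exact_mod_cast h2.trans (card_union_le _ _)
  by_cases h4 : (I.card : ℝ) / 4 ≤ (J true).card
  · exact ⟨true, J true, filter_subset _ _, h4, fun i hi => (mem_filter.1 hi).2⟩
  · exact ⟨false, J false, filter_subset _ _, by linarith, fun i hi => (mem_filter.1 hi).2⟩

lemma exists_forall_le_of_logb_lt (b : ℝ) : ∃ N : ℕ, ∀ n : ℕ, Real.logb 2 n < b → n ≤ N := by
  refine ⟨⌈(2 : ℝ) ^ b⌉₊, fun n hn => ?_⟩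
  rcases n.eq_zero_or_pos with rfl | h
  · exact Nat.zero_le _
  · have h1 := (Real.logb_lt_iff_lt_rpow one_lt_two (by exact_mod_cast h)).1 hn
    exact_mod_cast h1.le.trans (Nat.le_ceil _)

/-- The algorithm for large `n`: directed searches in both directions, and random pairs. -/
lemma exists_search {c ε : ℝ} (hc : 0 < c) (hε0 : 0 < ε) (hε1 : ε ≤ 1) {s t h ℓ : ℕ}
    (hs : 1 ≤ s) (ht : 1 ≤ t) (hL : 54 ≤ Real.logb 2 n) (h1 : (n : ℝ) ^ (2 / 3 : ℝ) ≤ 2 ^ ℓ)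
    (h2 : (2 : ℝ) ^ ℓ ≤ n) :
    ∃ A : QueryAlg n (Answer n), (A.queries : ℝ) ≤
      3 * ((31457280 * 576 * 3 ^ 24) * (1 + 1 / c) + 2654216) *
        ((n : ℝ) ^ (2 / 3 : ℝ) / ε ^ 2) * Real.logb 2 (n / ε) ^ 30 ∧
      ∀ (f : Point n → Bool) (I : Finset (Fin n)), I.card = 2 ^ ℓ → ScoreSummary c ε s t h f I →
        (I.card : ℝ) / 2 ≤
          (Set.ncard {i : Fin n | i ∈ I ∧ infThreshold n ε I.card < influence f i} : ℝ) →
        2 / 3 ≤ A.success f := by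
  have hn : 0 < n := by
    by_contra hn
    obtain rfl : n = 0 := by omega
    norm_num at hL
  have hn1 : (1 : ℝ) ≤ n := by exact_mod_cast hn
  have hU1 : 1 ≤ (n : ℝ) ^ (2 / 3 : ℝ) := Real.one_le_rpow hn1 (by norm_num)
  have hU : (n : ℝ) ^ (2 / 3 : ℝ) ≤ (n : ℝ) ^ (2 / 3 : ℝ) / ε ^ 2 :=
    le_div_self (by positivity) (by positivity) (pow_le_one₀ hε0.le hε1)
  have hL30 : 1 ≤ Real.logb 2 ((n : ℝ) / ε) ^ 30 := by
    refine one_le_pow₀ ?_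
    linarith [logb_le_logb_div hn hε0 hε1]
  set K : ℝ := (31457280 * 576 * 3 ^ 24) * (1 + 1 / c) with hK
  have hK0 : 0 ≤ K := by positivity
  set V : ℝ := (n : ℝ) ^ (2 / 3 : ℝ) / ε ^ 2 * Real.logb 2 (n / ε) ^ 30 with hV
  have hUV : (n : ℝ) ^ (2 / 3 : ℝ) ≤ V :=
    hU.trans (le_mul_of_one_le_right (by positivity) hL30)
  by_cases hch : c * (ε ^ 2 / (Lam n ε : ℝ) ^ 11) ≤ 2 ^ ℓ / 2 ^ h
  swap
  · refine ⟨output none, ?_, fun f I hI hsum _ => ?_⟩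
    · simp only [queries_output, Nat.cast_zero]
      positivity
    · -- no set of size `2 ^ ℓ` satisfies the bound of the score summary
      refine absurd ?_ hch
      have := hsum.1
      rw [hI] at this
      exact_mod_cast this
  obtain ⟨A₁, hA₁, hA₁'⟩ := exists_directedSearch hc hε0 hε1 ht hL h1 h2 hch true
  obtain ⟨A₂, hA₂, hA₂'⟩ := exists_directedSearch hc hε0 hε1 hs hL h1 h2 hch false
  obtain ⟨A₃, hA₃, hA₃'⟩ := exists_randomPairs hL
  rw [← hK, mul_assoc, ← hV] at hA₁ hA₂
  refine ⟨tryAll [A₁, A₂, A₃], ?_, fun f I hI hsum hinf => ?_⟩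
  · have hq : (tryAll [A₁, A₂, A₃]).queries ≤ 3 * (⌊(K + 2654212) * V⌋₊ + 4) := by
      refine queries_tryAll_le ?_
      have hV0 : 0 ≤ V := by linarith
      have hKV : 0 ≤ K * V := by positivity
      intro A hA
      refine Nat.le_floor ?_
      simp only [List.mem_cons, List.not_mem_nil, or_false] at hA
      rcases hA with rfl | rfl | rfl <;> linarith
    have hq' : ((tryAll [A₁, A₂, A₃]).queries : ℝ) ≤ 3 * (⌊(K + 2654212) * V⌋₊ + 4) := by
      exact_mod_cast hq
    have hfl : (⌊(K + 2654212) * V⌋₊ : ℝ) ≤ (K + 2654212) * V := by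
      have hV0 : 0 ≤ V := by linarith
      exact Nat.floor_le (by positivity)
    rw [mul_assoc _ ((n : ℝ) ^ (2 / 3 : ℝ) / ε ^ 2), ← hV]
    linarith
  · rcases lt_or_ge ((n : ℝ) ^ (2 / 3 : ℝ) / 144) (∑ i, influence f i) with hT | hT
    · exact (hA₃' f hT).trans (success_le_tryAll f (by simp))
    obtain ⟨σ, J, hJI, hJ, hJd⟩ := exists_direction f hinf
    have hscore : ∀ i ∈ I, (2 : ℝ) ^ s / 2 ^ h ≤ scorePos ε f s i ∧
        (2 : ℝ) ^ t / 2 ^ h ≤ scoreNeg ε f t i := by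
      intro i hi
      have h3 := hsum.2 i hi
      have h4 := h3.trans (min_le_left _ _)
      have h5 := h3.trans (min_le_right _ _)
      rw [mul_one_div, le_div_iff₀ (by positivity), one_div_mul_eq_div] at h4 h5
      exact ⟨h4, h5⟩
    cases σ with
    | true =>
      refine (hA₁' f I hI hT (fun i hi => ?_) J hJI hJ hJd).trans (success_le_tryAll f (by simp))
      rw [Bool.not_true, ← scoreNeg_eq_expect]
      exact (hscore i hi).2
    | false =>
      refine (hA₂' f I hI hT (fun i hi => ?_) J hJI hJ hJd).trans (success_le_tryAll f (by simp))
      rw [Bool.not_false, ← scorePos_eq_expect]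
      exact (hscore i hi).1

end Unateness

theorem lemma5p2 :
    ∃ k : ℕ, ∀ c : ℝ, 0 < c → ∃ C : ℝ, 0 < C ∧
      ∀ (n : ℕ) (ε : ℝ), 0 < ε → ε ≤ 1 →
      ∀ s t h ℓ : ℕ,
        1 ≤ t → t ≤ s → s ≤ Lam n ε →
        1 ≤ h → h ≤ 3 * Lam n ε →
        1 ≤ ℓ → ℓ ≤ ⌊Real.logb 2 (n : ℝ)⌋₊ →
        (n : ℝ) ^ (2 / 3 : ℝ) ≤ (2 : ℝ) ^ ℓ / 2 ^ t →
        ∃ A : QueryAlg n (Answer n),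
          (A.queries : ℝ) ≤
            C * ((n : ℝ) ^ (2 / 3 : ℝ) / ε ^ 2) * Real.logb 2 ((n : ℝ) / ε) ^ k ∧
          ∀ (f : Point n → Bool) (I : Finset (Fin n)),
            I.card = 2 ^ ℓ →
            ScoreSummary c ε s t h f I →
            (I.card : ℝ) / 2 ≤
              (Set.ncard {i : Fin n | i ∈ I ∧ infThreshold n ε I.card < influence f i} : ℝ) →
            2 / 3 ≤ prob (A.run f) {o | IsEdgeViolation f o} := by
  obtain ⟨N₀, hN₀⟩ := exists_forall_le_of_logb_lt 54
  refine ⟨30, fun c hc => ⟨(2 : ℝ) ^ N₀ +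
    3 * ((31457280 * 576 * 3 ^ 24) * (1 + 1 / c) + 2654216), by positivity, ?_⟩⟩
  intro n ε hε0 hε1 s t h ℓ ht hts _ _ _ hℓ1 hℓ hPt
  have hℓ2 : (ℓ : ℝ) ≤ Real.logb 2 n :=
    le_trans (by exact_mod_cast hℓ) (Nat.floor_le (by
      by_contra hneg
      rw [Nat.floor_of_nonpos (not_le.1 hneg).le] at hℓ
      omega))
  have hL1 : 1 ≤ Real.logb 2 n := le_trans (by exact_mod_cast hℓ1) hℓ2
  have hn : 0 < n := by
    by_contra hn
    obtain rfl : n = 0 := by omega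
    norm_num at hL1
  have hn1 : (1 : ℝ) ≤ n := by exact_mod_cast hn
  have h2 : (2 : ℝ) ^ ℓ ≤ n := by
    rw [Real.le_logb_iff_rpow_le one_lt_two (by linarith), Real.rpow_natCast] at hℓ2
    exact hℓ2
  have h1 : (n : ℝ) ^ (2 / 3 : ℝ) ≤ 2 ^ ℓ :=
    hPt.trans (div_le_self (by positivity) (one_le_pow₀ one_le_two))
  have hL30 : 1 ≤ Real.logb 2 ((n : ℝ) / ε) ^ 30 :=
    one_le_pow₀ (hL1.trans (logb_le_logb_div hn hε0 hε1))
  have hU : 1 ≤ (n : ℝ) ^ (2 / 3 : ℝ) / ε ^ 2 :=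
    (Real.one_le_rpow hn1 (by norm_num)).trans
      (le_div_self (by positivity) (by positivity) (pow_le_one₀ hε0.le hε1))
  rcases lt_or_ge (Real.logb 2 (n : ℝ)) 54 with hL | hL
  · -- finitely many `n`: query all points
    refine ⟨queryAll n, ?_, fun f I hI hsum _ => ?_⟩
    · have h3 : ((queryAll n).queries : ℝ) ≤ 2 ^ n := by exact_mod_cast queries_queryAll_le n
      calc ((queryAll n).queries : ℝ) ≤ 2 ^ n := h3
        _ ≤ 2 ^ N₀ := pow_le_pow_right₀ one_le_two (hN₀ n hL)
        _ ≤ 2 ^ N₀ + 3 * ((31457280 * 576 * 3 ^ 24) * (1 + 1 / c) + 2654216) :=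
            le_add_of_nonneg_right (by positivity)
        _ ≤ _ := by
            rw [mul_assoc _ ((n : ℝ) ^ (2 / 3 : ℝ) / ε ^ 2)]
            exact le_mul_of_one_le_right (by positivity)
              (one_le_mul_of_one_le_of_one_le hU hL30)
    · obtain ⟨i, hi⟩ : I.Nonempty := Finset.card_pos.1 (by rw [hI]; positivity)
      have h4 := hsum.2 i hi
      have h5 : (0 : ℝ) < 1 / 2 ^ h := by positivity
      have hpos : 0 < scorePos ε f s i :=
        pos_of_mul_pos_left (h5.trans_le (h4.trans (min_le_left _ _))) (by positivity)
      have hneg : 0 < scoreNeg ε f t i :=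
        pos_of_mul_pos_left (h5.trans_le (h4.trans (min_le_right _ _))) (by positivity)
      rw [QueryAlg.prob_run]
      exact le_trans (by norm_num)
        (success_queryAll f (exists_isEdgeViolation f hpos hneg)).ge
  · obtain ⟨A, hA, hA'⟩ := exists_search hc hε0 hε1 (ht.trans hts) ht hL h1 h2 (s := s) (h := h)
    refine ⟨A, hA.trans ?_, fun f I hI hsum hinf => ?_⟩
    · gcongr
      exact le_add_of_nonneg_left (by positivity)
    · rw [QueryAlg.prob_run]
      exact hA' f I hI hsum hinf
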